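/- **Setting.** Let $T=U(1)$ and let $LT=C^\infty(\mathbb R/2\pi\mathbb Z,T)$ with its $C^\infty$ topology. Every loop is uniquely $t\,e^{-in\theta}e^{if(\theta)}$ with $t\in T$, $n\in\Pi_T=\mathbb Z$ and $f\in\Omega T_0$, the group of smooth real $2\pi$-periodic functions of mean zero; so $LT=T\times\Pi_T\times\Omega T_0$. Fix an integer $\kappa>0$ and put $\kappa^\tau(n)(t)=t^{\kappa n}$. The level $\tau$ is the cocycle $$\tau\big((t_1,n_1,f_1),(t_2,n_2,f_2)\big)=\kappa^\tau(n_1)(t_2)\,e^{i\omega(f_1,f_2)},\qquad \omega(f,g)=\frac{\kappa}{4\pi^2}\int_0^{2\pi}f\,g'\,d\theta ,$$ $LT^\tau=LT\times U(1)$ is the corresponding central extension, and $T^\tau$ is its restriction to the constant loops. The rotations $l(\theta)\mapsto l(\theta+s)$ are lifted to automorphisms of $LT^\tau$ by multiplying the central coordinate by $e^{is(bn-\kappa n(n+1)/2)}$, for a fixed $b\in\mathbb Z$. A *positive energy representation* (P.E.R.) at level $\tau$ is a strongly continuous unitary representation $\rho$ of $LT^\tau$ on a Hilbert space in which the added centre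 $U(1)$ acts by scalars and which extends to a strongly continuous unitary representation of $\mathbb T_{\rm rot}\ltimes LT^\tau$ whose weight spaces for $\mathbb T_{\rm rot}$ are finite dimensional, and zero for all sufficiently small weights. $R^\tau(LT)$ is the free abelian group on the isomorphism classes of irreducible P.E.R.s at level $\tau$; a finite orthogonal sum of irreducible P.E.R.s has as its class the sum of their classes. Let $V$ be the completion of $\mathbb C[z_1,z_2,\dots]$ for the inner product in which monomials are orthogonal and $\|\prod z_k^{m_k}\|^2=\prod m_k!$. Let $\rho$ be the representation of $\Omega T_0$ on $V$, at level $\tau$, with $d\rho(z_k)=-\sqrt2\,M_{z_k}$ and $d\rho(\overline{z_k})=\sqrt2\,\partial/\partial z_k$, where $z_k=\frac1{\sqrt2}\frac{e^{ik\theta}}{\sqrt{k\pi}}\frac{2\pi}{\sqrt\kappa}\in{\rm Lie}(\Omega T_0)\otimes\mathbb C$. Let $V^*$ be the dual space with $d\rho^*(X)=-d\rho(X)^{t}$, and put $L^2(\Omega T_0)=V^*\otimes V$ with $\Omega T_0$ acting by ${\rm id}\otimes\rho$. Let $S$ be the completed exterior algebra on the orthonormal vectors $\overline{z_k}$, $k\ge1$,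 graded by parity, with $\gamma(\overline{z_k})=\sqrt2\,\overline{z_k}\wedge$ and $\gamma(z_k)=-\sqrt2\,\overline{z_k}\rfloor$. **Theorem.** Let $\lambda$ be a continuous character of $T^\tau$ on which the added centre $U(1)$ acts by scalar multiplication. 1. $\mathcal L_\lambda=LT^\tau\times_{T^\tau}\mathbb C_\lambda$ (where $[gh,v]=[g,\lambda(h)v]$) is an $LT^\tau$-equivariant complex line bundle on the flag manifold $\Omega T=LT^\tau/T^\tau=\Pi_T\times\Omega T_0$. 2. On the Hilbert space $L^2(\Omega T,\mathcal L_\lambda\otimes\mathcal S)=L^2(\Pi_T,\mathcal L_\lambda|_{\Pi_T})\otimes L^2(\Omega T_0)\otimes S$ the group $LT^\tau$ acts by a strongly continuous unitary representation, in which the added centre acts by scalars, and the Dirac operator $$\mathcal D_\lambda={\rm id}\otimes\sum_{k\ge1}\sqrt k\,\big(d\rho^*(z_k)\otimes{\rm id}\otimes\gamma(\overline{z_k})+d\rho^*(\overline{z_k})\otimes{\rm id}\otimes\gamma(z_k)\big),$$ defined on the algebraic span of the vectors of finite energy in the factors $V^*$ and $S$ and of finite support in $\Pi_T$, is essentially self-adjoint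 and commutes with $LT^\tau$. 3. Let $V_{[\lambda]}=\bigoplus_{n\in\Pi_T}V\otimes\mathbb C_{\lambda+\kappa^\tau(n)}$, where $\Omega T_0$ acts on each summand by $\rho$, $T$ acts on the $n$-th summand by the character $\lambda|_T\cdot\kappa^\tau(n)$, and $m\in\Pi_T$ permutes the summands by $n\mapsto n-m$. This is an irreducible P.E.R. at level $\tau$, and the analytic index $${\rm ind}(\mathcal D_\lambda)=\big[\ker\overline{\mathcal D_\lambda}\big|_{\rm even}\big]-\big[\ker\overline{\mathcal D_\lambda}\big|_{\rm odd}\big]\in R^\tau(LT)$$ is well defined and equal to $[V_{[\lambda]}]$. -/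

import Mathlib

open scoped ContDiff
open Real

namespace BorelWeilLT
noncomputable section

/-- The loop group of the circle `T = Circle`: smooth maps from the circle `ℝ / 2πℤ` to `T`,
written as smooth `2π`-periodic functions on the line. -/
@[ext]
structure LoopGp where
  toFun : ℝ → Circle
  smooth' : ContDiff ℝ ∞ (fun θ => (toFun θ : ℂ))
  periodic' : ∀ θ, toFun (θ + 2 * π) = toFun θ

namespace LoopGp

instance : CoeFun LoopGp (fun _ => ℝ → Circle) := ⟨LoopGp.toFun⟩

instance : CommGroup LoopGp where
  mul a b := ⟨fun θ => a θ * b θ, by simpa using a.smooth'.mul b.smooth',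
    fun θ => by rw [a.periodic', b.periodic']⟩
  one := ⟨fun _ => 1, contDiff_const, fun _ => rfl⟩
  inv a := ⟨fun θ => (a θ)⁻¹, by
      have h : ContDiff ℝ ∞ (fun θ => Complex.conjCLE (a θ : ℂ)) :=
        Complex.conjCLE.contDiff.comp a.smooth'
      simpa only [Circle.coe_inv_eq_conj, Complex.conjCLE_apply] using h, fun θ => by rw [a.periodic']⟩
  mul_assoc a b c := LoopGp.ext (funext fun θ => mul_assoc (a θ) (b θ) (c θ))
  one_mul a := LoopGp.ext (funext fun θ => one_mul (a θ))
  mul_one a := LoopGp.ext (funext fun θ => mul_one (a θ))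
  inv_mul_cancel a := LoopGp.ext (funext fun θ => inv_mul_cancel (a θ))
  mul_comm a b := LoopGp.ext (funext fun θ => mul_comm (a θ) (b θ))

theorem mul_apply (a b : LoopGp) (θ : ℝ) : (a * b) θ = a θ * b θ := rfl
theorem inv_apply (a : LoopGp) (θ : ℝ) : (a⁻¹) θ = (a θ)⁻¹ := rfl
theorem one_apply (θ : ℝ) : (1 : LoopGp) θ = 1 := rfl

/-- The `C^∞` topology: locally uniform convergence of all derivatives. -/
instance : TopologicalSpace LoopGp :=
  TopologicalSpace.induced
    (fun (l : LoopGp) (j : ℕ) =>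
      (⟨iteratedDeriv j (fun θ => (l θ : ℂ)),
        l.smooth'.continuous_iteratedDeriv j (mod_cast le_top)⟩ : C(ℝ, ℂ)))
    inferInstance

/-- Rigid rotation of loops, `(s.l)(θ) = l(θ + s)`. -/
def rot (s : ℝ) (l : LoopGp) : LoopGp :=
  ⟨fun θ => l (θ + s), l.smooth'.comp (contDiff_id.add contDiff_const),
    fun θ => by rw [add_right_comm, l.periodic']⟩

end LoopGp

/-- Smooth `2π`-periodic real functions of mean zero; through `f ↦ exp (i f)` this is the group
`ΩT₀` of the canonical decomposition `LT = T × Π_T × ΩT₀`. -/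
def meanZero : AddSubgroup (ℝ → ℝ) where
  carrier := {f | ContDiff ℝ ∞ f ∧ (∀ θ, f (θ + 2 * π) = f θ) ∧ ∫ θ in (0 : ℝ)..2 * π, f θ = 0}
  zero_mem' := ⟨contDiff_const, fun _ => rfl, by simp⟩
  add_mem' := by
    rintro f g ⟨hf, hf', hf0⟩ ⟨hg, hg', hg0⟩
    refine ⟨hf.add hg, fun θ => by simp [hf', hg'], ?_⟩
    have := intervalIntegral.integral_add (μ := MeasureTheory.volume) (hf.continuous.intervalIntegrable 0 (2 * π))
      (hg.continuous.intervalIntegrable 0 (2 * π))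
    simp only [Pi.add_apply]
    rw [this, hf0, hg0, add_zero]
  neg_mem' := by
    rintro f ⟨hf, hf', hf0⟩
    refine ⟨hf.neg, fun θ => by simp [hf'], ?_⟩
    simp only [Pi.neg_apply, intervalIntegral.integral_neg, hf0, neg_zero]

/-- The group `ΩT₀`, written additively. -/
abbrev U : Type := meanZero

theorem U.smooth (f : U) : ContDiff ℝ ∞ (f : ℝ → ℝ) := f.2.1
theorem U.periodic (f : U) (θ : ℝ) : (f : ℝ → ℝ) (θ + 2 * π) = (f : ℝ → ℝ) θ :=
  f.2.2.1 θ
theorem U.mean (f : U) : ∫ θ in (0 : ℝ)..2 * π, (f : ℝ → ℝ) θ = 0 := f.2.2.2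

theorem contDiff_circleExp {g : ℝ → ℝ} (hg : ContDiff ℝ ∞ g) :
    ContDiff ℝ ∞ (fun θ => (Circle.exp (g θ) : ℂ)) := by
  simp only [Circle.coe_exp]
  exact ((Complex.ofRealCLM.contDiff.comp hg).mul contDiff_const).cexp

theorem circleExp_int_period (n : ℤ) : Circle.exp (n * (2 * π)) = 1 :=
  Circle.exp_eq_one.2 ⟨n, rfl⟩

/-- The loop `t · exp (-i n θ) · exp (i f(θ))` with coordinates `(t, n, f) ∈ T × Π_T × ΩT₀`, where
`Π_T` is identified with `ℤ`. With this orientation of the identification of `Π_T` with the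
components of the loop group the cocycle `cocycle` below has representations of positive energy
with respect to `l(θ) ↦ l(θ + s)`. -/
def ofCoord (t : Circle) (n : ℤ) (f : U) : LoopGp where
  toFun θ := t * Circle.exp (-(n * θ)) * Circle.exp ((f : ℝ → ℝ) θ)
  smooth' := by
    simp only [Circle.coe_mul]
    exact (contDiff_const.mul (contDiff_circleExp (contDiff_const.mul contDiff_id).neg)).mul
      (contDiff_circleExp f.smooth)
  periodic' θ := by
    rw [f.periodic, mul_add, neg_add, Circle.exp_add (-(n * θ)), Circle.exp_neg (n * (2 * π)),
      circleExp_int_period, inv_one, mul_one]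

theorem ofCoord_mul (t t' : Circle) (n n' : ℤ) (f f' : U) :
    ofCoord t n f * ofCoord t' n' f' = ofCoord (t * t') (n + n') (f + f') := by
  refine LoopGp.ext (funext fun θ => ?_)
  show (t * Circle.exp (-(n * θ)) * Circle.exp ((f : ℝ → ℝ) θ)) *
    (t' * Circle.exp (-(n' * θ)) * Circle.exp ((f' : ℝ → ℝ) θ)) =
    t * t' * Circle.exp (-(((n + n' : ℤ) : ℝ) * θ)) * Circle.exp ((f : ℝ → ℝ) θ + (f' : ℝ → ℝ) θ)
  rw [Circle.exp_add, show -(((n + n' : ℤ) : ℝ) * θ) = -(n * θ) + -(n' * θ) by push_cast; ring,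
    Circle.exp_add]
  simp only [mul_assoc, mul_comm, mul_left_comm]

theorem exists_coord (l : LoopGp) : ∃ (t : Circle) (n : ℤ) (f : U), ofCoord t n f = l := by
  set u : ℝ → ℂ := fun θ => (l θ : ℂ) with hu
  have hus : ContDiff ℝ ∞ u := l.smooth'
  have hdu : ContDiff ℝ ∞ (deriv u) := (contDiff_infty_iff_deriv.1 hus).2
  have hnorm : ∀ θ, (starRingEnd ℂ) (u θ) * u θ = 1 := fun θ => by
    rw [mul_comm, Complex.mul_conj, Circle.normSq_coe]; simp
  have hd : ∀ θ, HasDerivAt u (deriv u θ) θ := fun θ =>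
    (hus.differentiable (by simp)).differentiableAt.hasDerivAt
  set g : ℝ → ℝ := fun θ => ((starRingEnd ℂ) (u θ) * deriv u θ).im with hg
  have hgs : ContDiff ℝ ∞ g :=
    Complex.imCLM.contDiff.comp ((Complex.conjCLE.contDiff.comp hus).mul hdu)
  have hre : ∀ θ, ((starRingEnd ℂ) (u θ) * deriv u θ).re = 0 := fun θ => by
    have h1 : HasDerivAt (fun θ => (starRingEnd ℂ) (u θ) * u θ)
        ((starRingEnd ℂ) (deriv u θ) * u θ + (starRingEnd ℂ) (u θ) * deriv u θ) θ :=
      (hd θ).star_conj.mul (hd θ) 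
    have h2 : HasDerivAt (fun θ => (starRingEnd ℂ) (u θ) * u θ) 0 θ := by
      simp only [hnorm]; exact hasDerivAt_const _ _
    have h3 := congrArg Complex.re (h1.unique h2)
    simp only [Complex.add_re, Complex.mul_re, Complex.conj_re, Complex.conj_im,
      Complex.zero_re] at h3 ⊢
    linarith
  have hdu' : ∀ θ, deriv u θ = (g θ : ℂ) * Complex.I * u θ := fun θ => by
    have h1 : (starRingEnd ℂ) (u θ) * deriv u θ = (g θ : ℂ) * Complex.I := by
      apply Complex.ext <;> simp [hre, hg]
    rw [← h1, mul_right_comm, hnorm, one_mul]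
  set Φ : ℝ → ℝ := fun θ => ∫ s in (0 : ℝ)..θ, g s with hΦ
  have hΦd : ∀ θ, HasDerivAt Φ (g θ) θ := fun θ =>
    intervalIntegral.integral_hasDerivAt_right (hgs.continuous.intervalIntegrable _ _)
      (hgs.continuous.stronglyMeasurableAtFilter _ _) hgs.continuous.continuousAt
  have hΦs : ContDiff ℝ ∞ Φ := by
    rw [contDiff_infty_iff_deriv]
    refine ⟨fun θ => (hΦd θ).differentiableAt, ?_⟩
    rwa [show deriv Φ = g from funext fun θ => (hΦd θ).deriv]
  have hΦ0 : Φ 0 = 0 := by simp [hΦ]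
  have huΦ : ∀ θ, u θ = u 0 * Complex.exp (Φ θ * Complex.I) := by
    have hc : ∀ θ, HasDerivAt (fun θ => u θ * Complex.exp (-(Φ θ * Complex.I))) 0 θ := fun θ => by
      have h1 := (hd θ).mul ((((hΦd θ).ofReal_comp).mul_const Complex.I).neg.cexp)
      refine h1.congr_deriv ?_
      rw [hdu' θ]; ring
    intro θ
    have h := is_const_of_deriv_eq_zero (fun θ => (hc θ).differentiableAt)
      (fun θ => (hc θ).deriv) θ 0
    simp only [hΦ0, Complex.ofReal_zero, zero_mul, neg_zero, Complex.exp_zero, mul_one] at h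
    rw [← h, mul_assoc, ← Complex.exp_add]; simp
  have hup : ∀ θ, u (θ + 2 * π) = u θ := fun θ => by simp only [hu, l.periodic']
  have hgp : ∀ θ, g (θ + 2 * π) = g θ := fun θ => by
    have : deriv u (θ + 2 * π) = deriv u θ := by
      rw [← deriv_comp_add_const u (2 * π) θ]; simp only [hup]
    simp only [hg, hup, this]
  have hΦp : ∀ θ, Φ (θ + 2 * π) = Φ θ + Φ (2 * π) := fun θ => by
    have h1 : ∀ θ, HasDerivAt (fun θ => Φ (θ + 2 * π) - Φ θ) 0 θ := fun θ => by
      have := ((hΦd (θ + 2 * π)).comp_add_const θ (2 * π)).sub (hΦd θ)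
      rwa [hgp, sub_self] at this
    have h := is_const_of_deriv_eq_zero (fun θ => (h1 θ).differentiableAt)
      (fun θ => (h1 θ).deriv) θ 0
    simp only [hΦ0, zero_add, sub_zero] at h
    linarith
  obtain ⟨N, hN⟩ : ∃ N : ℤ, Φ (2 * π) = N * (2 * π) := by
    have h1 := huΦ (2 * π)
    have h0 : u (2 * π) = u 0 := by simpa using hup 0
    rw [h0] at h1
    have h2 : Circle.exp (Φ (2 * π)) = 1 := by
      apply Circle.ext
      rw [Circle.coe_exp, Circle.coe_one]
      have : u 0 ≠ 0 := Circle.coe_ne_zero _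
      exact (mul_left_cancel₀ this (by rw [mul_one]; exact h1)).symm
    exact Circle.exp_eq_one.1 h2
  set a : ℝ := (∫ θ in (0 : ℝ)..2 * π, (Φ θ - N * θ)) / (2 * π) with ha
  have hfs : ContDiff ℝ ∞ (fun θ => Φ θ - N * θ - a) :=
    (hΦs.sub (contDiff_const.mul contDiff_id)).sub contDiff_const
  have hfm : ∫ θ in (0 : ℝ)..2 * π, (Φ θ - N * θ - a) = 0 := by
    have hi : IntervalIntegrable (fun θ => Φ θ - N * θ) MeasureTheory.volume 0 (2 * π) :=
      (hΦs.continuous.sub (continuous_const.mul continuous_id)).intervalIntegrable _ _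
    rw [intervalIntegral.integral_sub hi (continuous_const.intervalIntegrable _ _),
      intervalIntegral.integral_const, ha]
    have := Real.pi_pos
    simp only [smul_eq_mul, sub_zero]
    field_simp
    simp
  refine ⟨l 0 * Circle.exp a, -N, ⟨fun θ => Φ θ - N * θ - a, hfs, fun θ => ?_, hfm⟩, ?_⟩
  · show Φ (θ + 2 * π) - N * (θ + 2 * π) - a = Φ θ - N * θ - a
    rw [hΦp, hN]; ring
  · refine LoopGp.ext (funext fun θ => ?_)
    have h1 : l θ = l 0 * Circle.exp (Φ θ) := Circle.ext (by
      rw [Circle.coe_mul, Circle.coe_exp]; exact huΦ θ)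
    show l 0 * Circle.exp a * Circle.exp (-(((-N : ℤ) : ℝ) * θ)) *
      Circle.exp (Φ θ - N * θ - a) = l θ
    rw [h1, mul_assoc, mul_assoc, ← Circle.exp_add, ← Circle.exp_add]
    congr 2
    push_cast; ring

theorem coord_unique_one (t : Circle) (n : ℤ) (f : U) (h : ofCoord t n f = 1) :
    t = 1 ∧ n = 0 ∧ f = 0 := by
  have hfd : ∀ θ, HasDerivAt (f : ℝ → ℝ) (deriv (f : ℝ → ℝ) θ) θ := fun θ =>
    (f.smooth.differentiable (by simp)).differentiableAt.hasDerivAt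
  have hC : ∀ θ, (t : ℂ) * Complex.exp (((f : ℝ → ℝ) θ - n * θ : ℝ) * Complex.I) = 1 := fun θ => by
    have h1 : t * Circle.exp (-(n * θ)) * Circle.exp ((f : ℝ → ℝ) θ) = 1 :=
      congrFun (congrArg LoopGp.toFun h) θ
    rw [mul_assoc, ← Circle.exp_add] at h1
    have h2 := congrArg (fun z : Circle => (z : ℂ)) h1
    simp only [Circle.coe_mul, Circle.coe_exp, Circle.coe_one] at h2
    rw [← h2]; congr 4; ring
  have hder : ∀ θ, deriv (f : ℝ → ℝ) θ = n := fun θ => by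
    have h1 := ((((hfd θ).sub ((hasDerivAt_id θ).const_mul (n : ℝ))).ofReal_comp.mul_const
      Complex.I).cexp).const_mul (t : ℂ)
    have h2 : HasDerivAt (fun θ => (t : ℂ) *
        Complex.exp (((f : ℝ → ℝ) θ - n * θ : ℝ) * Complex.I)) 0 θ := by
      simp only [hC]; exact hasDerivAt_const _ _
    have h3 := h1.unique h2
    simp only [mul_one, mul_eq_zero, Circle.coe_ne_zero, Complex.exp_ne_zero, Complex.I_ne_zero,
      or_false, false_or] at h3
    have h4 : deriv (f : ℝ → ℝ) θ - n = 0 := by exact_mod_cast h3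
    linarith
  have hlin : ∀ θ, (f : ℝ → ℝ) θ = (f : ℝ → ℝ) 0 + n * θ := fun θ => by
    have h1 : ∀ θ, HasDerivAt (fun θ => (f : ℝ → ℝ) θ - n * θ) 0 θ := fun θ => by
      have := (hfd θ).sub ((hasDerivAt_id θ).const_mul (n : ℝ))
      rwa [hder, mul_one, sub_self] at this
    have h := is_const_of_deriv_eq_zero (fun θ => (h1 θ).differentiableAt)
      (fun θ => (h1 θ).deriv) θ 0
    simp only [mul_zero, sub_zero] at h
    linarith
  have hpi := Real.pi_pos
  have hn : n = 0 := by
    have h1 := f.periodic 0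
    rw [zero_add, hlin (2 * π)] at h1
    have : (n : ℝ) * (2 * π) = 0 := by linarith
    have : (n : ℝ) = 0 := by
      rcases mul_eq_zero.1 this with h | h
      · exact h
      · exfalso; linarith
    exact_mod_cast this
  subst hn
  have hf0 : (f : ℝ → ℝ) 0 = 0 := by
    have h1 := f.mean
    have h2 : (f : ℝ → ℝ) = fun _ => (f : ℝ → ℝ) 0 := funext fun θ => by simpa using hlin θ
    rw [h2] at h1
    rw [intervalIntegral.integral_const, smul_eq_mul, sub_zero] at h1
    rcases mul_eq_zero.1 h1 with h | h
    · exfalso; linarith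
    · exact h
  have hf : f = 0 := Subtype.ext (funext fun θ => by rw [hlin θ, hf0]; simp)
  refine ⟨Circle.ext ?_, rfl, hf⟩
  have := hC 0
  rw [hf0] at this
  simpa using this

theorem coord_injective {t t' : Circle} {n n' : ℤ} {f f' : U}
    (h : ofCoord t n f = ofCoord t' n' f') : t = t' ∧ n = n' ∧ f = f' := by
  have h1 : ofCoord (t * t'⁻¹) (n + -n') (f + -f') = 1 := by
    rw [← ofCoord_mul, h, ofCoord_mul]
    refine LoopGp.ext (funext fun θ => ?_)
    show (t' * t'⁻¹) * Circle.exp (-(((n' + -n' : ℤ) : ℝ) * θ)) * Circle.exp (((f' + -f' : U) : ℝ → ℝ) θ) = 1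
    simp
  obtain ⟨h2, h3, h4⟩ := coord_unique_one _ _ _ h1
  exact ⟨mul_inv_eq_one.1 h2, by omega, by rwa [← sub_eq_add_neg, sub_eq_zero] at h4⟩

namespace LoopGp

/-- The component in `T` of a loop. -/
def t (l : LoopGp) : Circle := (exists_coord l).choose
/-- The component in `Π_T = ℤ` of a loop. -/
def n (l : LoopGp) : ℤ := (exists_coord l).choose_spec.choose
/-- The component in `ΩT₀` of a loop. -/
def f (l : LoopGp) : U := (exists_coord l).choose_spec.choose_spec.choose

theorem ofCoord_eq (l : LoopGp) : ofCoord l.t l.n l.f = l :=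
  (exists_coord l).choose_spec.choose_spec.choose_spec

@[simp] theorem t_ofCoord (t : Circle) (n : ℤ) (f : U) : (ofCoord t n f).t = t :=
  (coord_injective (ofCoord_eq (ofCoord t n f))).1
@[simp] theorem n_ofCoord (t : Circle) (n : ℤ) (f : U) : (ofCoord t n f).n = n :=
  (coord_injective (ofCoord_eq (ofCoord t n f))).2.1
@[simp] theorem f_ofCoord (t : Circle) (n : ℤ) (f : U) : (ofCoord t n f).f = f :=
  (coord_injective (ofCoord_eq (ofCoord t n f))).2.2

theorem mul_eq (a b : LoopGp) : a * b = ofCoord (a.t * b.t) (a.n + b.n) (a.f + b.f) := by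
  rw [← ofCoord_mul, ofCoord_eq, ofCoord_eq]

@[simp] theorem t_mul (a b : LoopGp) : (a * b).t = a.t * b.t := by rw [mul_eq, t_ofCoord]
@[simp] theorem n_mul (a b : LoopGp) : (a * b).n = a.n + b.n := by rw [mul_eq, n_ofCoord]
@[simp] theorem f_mul (a b : LoopGp) : (a * b).f = a.f + b.f := by rw [mul_eq, f_ofCoord]

theorem one_eq : (1 : LoopGp) = ofCoord 1 0 0 := by
  refine LoopGp.ext (funext fun θ => ?_)
  show (1 : Circle) = 1 * Circle.exp (-(((0 : ℤ) : ℝ) * θ)) * Circle.exp (((0 : U) : ℝ → ℝ) θ)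
  simp

@[simp] theorem t_one : (1 : LoopGp).t = 1 := by rw [one_eq, t_ofCoord]
@[simp] theorem n_one : (1 : LoopGp).n = 0 := by rw [one_eq, n_ofCoord]
@[simp] theorem f_one : (1 : LoopGp).f = 0 := by rw [one_eq, f_ofCoord]

theorem const_iff (l : LoopGp) : (∀ θ, l θ = l 0) ↔ l.n = 0 ∧ l.f = 0 := by
  constructor
  · intro h
    have h1 : ofCoord (l 0) 0 0 = l := LoopGp.ext (funext fun θ => by
      rw [h θ]
      show l 0 * Circle.exp (-(((0 : ℤ) : ℝ) * θ)) * Circle.exp (((0 : U) : ℝ → ℝ) θ) = l 0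
      simp)
    rw [← h1]; simp
  · rintro ⟨h1, h2⟩ θ
    rw [← ofCoord_eq l, h1, h2]
    show l.t * Circle.exp (-(((0 : ℤ) : ℝ) * θ)) * Circle.exp (((0 : U) : ℝ → ℝ) θ) =
      l.t * Circle.exp (-(((0 : ℤ) : ℝ) * 0)) * Circle.exp (((0 : U) : ℝ → ℝ) 0)
    simp

end LoopGp

/-- The data of the level `τ`: a homomorphism `κ^τ : Π_T → Λ_T`, that is `n ↦ κ n` for an integer
`κ`, whose bilinear form is positive definite, and an integer `b` that selects the lift of the
rigid rotations to the central extension (see `rotPhase`). -/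
structure Level where
  κ : ℤ
  κ_pos : 0 < κ
  b : ℤ

/-- The form `ω(f, g) = ∫ ⟨f, dg/dθ⟩_τ dθ`. Here `⟨v, w⟩_τ = κ v w / (2π)²` is the bilinear form on
`Lie(T) = ℝ` whose value at the generator `2π` of `Π_T = ker exp = 2πℤ` is `κ`. -/
def omega (τ : Level) (f g : U) : ℝ :=
  τ.κ / (2 * π) ^ 2 * ∫ θ in (0 : ℝ)..2 * π, (f : ℝ → ℝ) θ * deriv (g : ℝ → ℝ) θ

theorem omega_add_left (τ : Level) (f f' g : U) :
    omega τ (f + f') g = omega τ f g + omega τ f' g := by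
  have hg := (contDiff_infty_iff_deriv.1 g.smooth).2.continuous
  have h : ∫ θ in (0 : ℝ)..2 * π, ((f : ℝ → ℝ) θ + (f' : ℝ → ℝ) θ) * deriv (g : ℝ → ℝ) θ =
      (∫ θ in (0 : ℝ)..2 * π, (f : ℝ → ℝ) θ * deriv (g : ℝ → ℝ) θ) +
      ∫ θ in (0 : ℝ)..2 * π, (f' : ℝ → ℝ) θ * deriv (g : ℝ → ℝ) θ := by
    have h1 : Continuous fun θ => (f : ℝ → ℝ) θ * deriv (g : ℝ → ℝ) θ := f.smooth.continuous.mul hg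
    have h2 : Continuous fun θ => (f' : ℝ → ℝ) θ * deriv (g : ℝ → ℝ) θ := f'.smooth.continuous.mul hg
    simp only [add_mul]
    exact intervalIntegral.integral_add (h1.intervalIntegrable _ _) (h2.intervalIntegrable _ _)
  unfold omega
  rw [← mul_add, ← h]; rfl

theorem omega_add_right (τ : Level) (f g g' : U) :
    omega τ f (g + g') = omega τ f g + omega τ f g' := by
  have hg := (contDiff_infty_iff_deriv.1 g.smooth).2.continuous
  have hg' := (contDiff_infty_iff_deriv.1 g'.smooth).2.continuous
  have hd : ∀ θ, deriv ((g + g' : U) : ℝ → ℝ) θ = deriv (g : ℝ → ℝ) θ + deriv (g' : ℝ → ℝ) θ :=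
    fun θ => deriv_add (g.smooth.differentiable (by simp)).differentiableAt
      (g'.smooth.differentiable (by simp)).differentiableAt
  have h1 : Continuous fun θ => (f : ℝ → ℝ) θ * deriv (g : ℝ → ℝ) θ := f.smooth.continuous.mul hg
  have h2 : Continuous fun θ => (f : ℝ → ℝ) θ * deriv (g' : ℝ → ℝ) θ := f.smooth.continuous.mul hg'
  unfold omega
  simp only [hd, mul_add]
  rw [intervalIntegral.integral_add (h1.intervalIntegrable _ _) (h2.intervalIntegrable _ _),
    mul_add]

@[simp] theorem omega_zero_left (τ : Level) (g : U) : omega τ 0 g = 0 := by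
  have := omega_add_left τ 0 0 g
  rw [add_zero] at this; linarith

@[simp] theorem omega_zero_right (τ : Level) (f : U) : omega τ f 0 = 0 := by
  have := omega_add_right τ f 0 0
  rw [add_zero] at this; linarith

/-- The cocycle `τ((t₁,n₁,f₁),(t₂,n₂,f₂)) = κ^τ(n₁)(t₂) · exp (i ω(f₁,f₂))`. -/
def cocycle (τ : Level) (a b : LoopGp) : Circle :=
  b.t ^ (τ.κ * a.n) * Circle.exp (omega τ a.f b.f)

theorem cocycle_assoc (τ : Level) (a b c : LoopGp) :
    cocycle τ a b * cocycle τ (a * b) c = cocycle τ b c * cocycle τ a (b * c) := by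
  simp only [cocycle, LoopGp.t_mul, LoopGp.n_mul, LoopGp.f_mul, omega_add_left, omega_add_right,
    Circle.exp_add, mul_add, zpow_add, mul_zpow]
  simp only [mul_assoc, mul_comm, mul_left_comm]

@[simp] theorem cocycle_one_left (τ : Level) (a : LoopGp) : cocycle τ 1 a = 1 := by simp [cocycle]
@[simp] theorem cocycle_one_right (τ : Level) (a : LoopGp) : cocycle τ a 1 = 1 := by simp [cocycle]

/-- The central extension `LT^τ`, the set `LT × U(1)` with the product twisted by the cocycle. -/
@[ext]
structure LTτ (τ : Level) where
  loop : LoopGp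
  z : Circle

namespace LTτ
variable {τ : Level}

instance : Group (LTτ τ) where
  mul g h := ⟨g.loop * h.loop, g.z * h.z * cocycle τ g.loop h.loop⟩
  one := ⟨1, 1⟩
  inv g := ⟨g.loop⁻¹, (g.z * cocycle τ g.loop⁻¹ g.loop)⁻¹⟩
  mul_assoc a b c := LTτ.ext (mul_assoc _ _ _) (by
    show a.z * b.z * cocycle τ a.loop b.loop * c.z * cocycle τ (a.loop * b.loop) c.loop =
      a.z * (b.z * c.z * cocycle τ b.loop c.loop) * cocycle τ a.loop (b.loop * c.loop)
    calc _ = a.z * b.z * c.z * (cocycle τ a.loop b.loop * cocycle τ (a.loop * b.loop) c.loop) := by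
          simp only [mul_assoc, mul_comm, mul_left_comm]
      _ = _ := by rw [cocycle_assoc]; simp only [mul_assoc])
  one_mul a := LTτ.ext (one_mul _) (by
    show 1 * a.z * cocycle τ 1 a.loop = a.z
    simp)
  mul_one a := LTτ.ext (mul_one _) (by
    show a.z * 1 * cocycle τ a.loop 1 = a.z
    simp)
  inv_mul_cancel a := LTτ.ext (inv_mul_cancel _) (by
    show (a.z * cocycle τ a.loop⁻¹ a.loop)⁻¹ * a.z * cocycle τ a.loop⁻¹ a.loop = 1
    rw [mul_assoc, inv_mul_cancel])

theorem mul_loop (g h : LTτ τ) : (g * h).loop = g.loop * h.loop := rfl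
theorem mul_z (g h : LTτ τ) : (g * h).z = g.z * h.z * cocycle τ g.loop h.loop := rfl
theorem one_loop : (1 : LTτ τ).loop = 1 := rfl
theorem inv_loop (g : LTτ τ) : (g⁻¹).loop = g.loop⁻¹ := rfl

instance : TopologicalSpace (LTτ τ) :=
  TopologicalSpace.induced (fun g => (g.loop, g.z)) inferInstance

end LTτ

namespace U

/-- Rotation of mean-zero functions. -/
def rot (s : ℝ) (f : U) : U :=
  ⟨fun θ => (f : ℝ → ℝ) (θ + s), f.smooth.comp (contDiff_id.add contDiff_const),
    fun θ => by
      show (f : ℝ → ℝ) (θ + 2 * π + s) = (f : ℝ → ℝ) (θ + s)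
      rw [add_right_comm, f.periodic], by
      rw [intervalIntegral.integral_comp_add_right, zero_add, add_comm (2 * π) s]
      exact (Function.Periodic.intervalIntegral_add_eq f.periodic s 0).trans
        (by rw [zero_add]; exact f.mean)⟩

theorem rot_add (s : ℝ) (f g : U) : rot s (f + g) = rot s f + rot s g := rfl

end U

theorem ofCoord_rot (s : ℝ) (t : Circle) (n : ℤ) (f : U) :
    (ofCoord t n f).rot s = ofCoord (t * Circle.exp (-(n * s))) n (f.rot s) := by
  refine LoopGp.ext (funext fun θ => ?_)
  show t * Circle.exp (-(n * (θ + s))) * Circle.exp ((f : ℝ → ℝ) (θ + s)) =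
    t * Circle.exp (-(n * s)) * Circle.exp (-(n * θ)) * Circle.exp ((f : ℝ → ℝ) (θ + s))
  rw [mul_assoc t (Circle.exp (-(n * s))), ← Circle.exp_add (-(n * s)),
    show -((n : ℝ) * (θ + s)) = -(n * s) + -(n * θ) by ring]

theorem rot_eq (s : ℝ) (l : LoopGp) :
    l.rot s = ofCoord (l.t * Circle.exp (-(l.n * s))) l.n (l.f.rot s) := by
  rw [← ofCoord_rot, LoopGp.ofCoord_eq]

theorem rot_mul (s : ℝ) (a b : LoopGp) : (a * b).rot s = a.rot s * b.rot s := rfl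

theorem omega_rot (τ : Level) (s : ℝ) (f g : U) : omega τ (f.rot s) (g.rot s) = omega τ f g := by
  have hd : ∀ θ, deriv ((g.rot s : U) : ℝ → ℝ) θ = deriv (g : ℝ → ℝ) (θ + s) := fun θ =>
    deriv_comp_add_const (g : ℝ → ℝ) s θ
  have hp : Function.Periodic (fun θ => (f : ℝ → ℝ) θ * deriv (g : ℝ → ℝ) θ) (2 * π) := fun θ => by
    have h1 : deriv (g : ℝ → ℝ) (θ + 2 * π) = deriv (g : ℝ → ℝ) θ := by
      rw [← deriv_comp_add_const (g : ℝ → ℝ) (2 * π) θ]; simp only [g.periodic]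
    simp only [f.periodic, h1]
  unfold omega
  congr 1
  simp only [hd]
  refine (intervalIntegral.integral_comp_add_right
    (fun θ => (f : ℝ → ℝ) θ * deriv (g : ℝ → ℝ) θ) s).trans ?_
  rw [zero_add, add_comm (2 * π) s]
  exact (hp.intervalIntegral_add_eq s 0).trans (by rw [zero_add])

/-- The phase by which the rotation through `s` is lifted to the central extension. The cocycle is
not rotation invariant on `T × Π_T`, which forces the quadratic term in `n`; the linear term is
free and is the choice recorded by `Level.b`. -/
def rotPhase (τ : Level) (s : ℝ) (l : LoopGp) : Circle :=
  Circle.exp (s * (τ.b * l.n - τ.κ * (l.n * (l.n + 1) / 2)))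

/-- The lift of the rigid rotations to automorphisms of `LT^τ`, which defines `𝕋_rot ⋉ LT^τ`. -/
def LTτ.rot {τ : Level} (s : ℝ) : LTτ τ →* LTτ τ where
  toFun g := ⟨g.loop.rot s, g.z * rotPhase τ s g.loop⟩
  map_one' := LTτ.ext rfl (by
    show 1 * rotPhase τ s 1 = 1
    simp [rotPhase])
  map_mul' g h := LTτ.ext rfl (by
    show g.z * h.z * cocycle τ g.loop h.loop * rotPhase τ s (g.loop * h.loop) =
      g.z * rotPhase τ s g.loop * (h.z * rotPhase τ s h.loop) *
        cocycle τ (g.loop.rot s) (h.loop.rot s)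
    have h1 : rotPhase τ s (g.loop * h.loop) = rotPhase τ s g.loop * rotPhase τ s h.loop *
        Circle.exp (-(h.loop.n * s)) ^ (τ.κ * g.loop.n) := by
      rw [← Circle.exp_zsmul]
      unfold rotPhase
      rw [← Circle.exp_add, ← Circle.exp_add, LoopGp.n_mul]
      congr 1
      simp only [zsmul_eq_mul]
      push_cast; ring
    rw [h1, rot_eq s g.loop, rot_eq s h.loop]
    simp only [cocycle, LoopGp.t_ofCoord, LoopGp.n_ofCoord, LoopGp.f_ofCoord, omega_rot, mul_zpow]
    simp only [mul_assoc, mul_comm, mul_left_comm])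

/-- The restriction `T^τ` of the central extension to the constant loops. -/
def Tτ (τ : Level) : Subgroup (LTτ τ) where
  carrier := {g | ∀ θ, g.loop θ = g.loop 0}
  mul_mem' {g h} hg hh θ := by
    change ∀ θ, _ = _ at hg hh
    rw [LTτ.mul_loop, LoopGp.mul_apply, LoopGp.mul_apply, hg, hh]
  one_mem' _ := rfl
  inv_mem' {g} hg θ := by
    change ∀ θ, _ = _ at hg
    rw [LTτ.inv_loop, LoopGp.inv_apply, LoopGp.inv_apply, hg]

theorem mem_Tτ {τ : Level} {g : LTτ τ} : g ∈ Tτ τ ↔ g.loop.n = 0 ∧ g.loop.f = 0 :=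
  LoopGp.const_iff g.loop

/-- The element of `T^τ` over the constant loop `t` with central coordinate `z`. -/
def tElem (τ : Level) (t z : Circle) : Tτ τ :=
  ⟨⟨ofCoord t 0 0, z⟩, mem_Tτ.2 (by simp)⟩

/-- A character of `T^τ` on which the added centre `U(1)` acts by scalar multiplication. -/
structure TwistedChar (τ : Level) where
  toHom : Tτ τ →* Circle
  continuous' : Continuous toHom
  central' : ∀ z : Circle, toHom (tElem τ 1 z) = z

/-- The flag manifold `ΩT = LT^τ / T^τ`. -/
abbrev FlagManifold (τ : Level) : Type := LTτ τ ⧸ Tτ τ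

variable {τ : Level}

/-- The point of the flag manifold with coordinates `(n, f) ∈ Π_T × ΩT₀`. -/
def point (n : ℤ) (f : U) : FlagManifold τ := (⟨ofCoord 1 n f, 1⟩ : LTτ τ)

theorem coord_of_mk_eq {g h : LTτ τ} (e : (g : FlagManifold τ) = h) :
    g.loop.n = h.loop.n ∧ g.loop.f = h.loop.f := by
  obtain ⟨h1, h2⟩ := mem_Tτ.1 (QuotientGroup.eq.1 e)
  have h3 : h.loop = g.loop * (g⁻¹ * h).loop := by
    rw [← LTτ.mul_loop, mul_inv_cancel_left]
  rw [h3]; simp [h1, h2]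

/-- The canonical section `(n, f) ↦ ((1, n, f), 1)` of `LT^τ → ΩT`. -/
def sect (x : FlagManifold τ) : LTτ τ :=
  Quotient.liftOn' x (fun g => ⟨ofCoord 1 g.loop.n g.loop.f, 1⟩) fun g h e => by
    obtain ⟨h1, h2⟩ := coord_of_mk_eq (Quotient.sound' e : (g : FlagManifold τ) = h)
    rw [h1, h2]

theorem mk_section (x : FlagManifold τ) : (sect x : FlagManifold τ) = x := by
  induction x using QuotientGroup.induction_on with
  | H g =>
    rw [QuotientGroup.eq, mem_Tτ]
    have h3 : g.loop = (sect (g : FlagManifold τ)).loop *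
        ((sect (g : FlagManifold τ))⁻¹ * g).loop := by
      rw [← LTτ.mul_loop, mul_inv_cancel_left]
    have h1 : (sect (g : FlagManifold τ)).loop = ofCoord 1 g.loop.n g.loop.f := rfl
    have h4 := congrArg LoopGp.n h3
    have h5 := congrArg LoopGp.f h3
    rw [LoopGp.n_mul, h1, LoopGp.n_ofCoord] at h4
    rw [LoopGp.f_mul, h1, LoopGp.f_ofCoord] at h5
    exact ⟨by omega, by simpa using h5⟩

theorem mult_mem (g : LTτ τ) (x : FlagManifold τ) :
    (sect (g • x))⁻¹ * (g * sect x) ∈ Tτ τ := by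
  rw [← QuotientGroup.eq, mk_section]
  show g • x = ((g • (sect x) : LTτ τ) : FlagManifold τ)
  rw [← MulAction.Quotient.smul_coe, mk_section]

/-- The multiplier of the action of `LT^τ` on the line bundle in the trivialization given by
`sect`: see `LineBundle.smul_triv`. -/
def mult (χ : TwistedChar τ) (g : LTτ τ) (x : FlagManifold τ) : Circle :=
  χ.toHom ⟨(sect (g • x))⁻¹ * (g * sect x), mult_mem g x⟩

/-- The relation `(g h, v) ∼ (g, χ(h) v)` for `h ∈ T^τ`. -/
def bundleSetoid (χ : TwistedChar τ) : Setoid (LTτ τ × ℂ) where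
  r p q := ∃ h : Tτ τ, q = (p.1 * h, (χ.toHom h : ℂ)⁻¹ * p.2)
  iseqv := by
    refine ⟨fun p => ⟨1, by simp⟩, ?_, ?_⟩
    · rintro ⟨g, v⟩ q ⟨h, rfl⟩
      exact ⟨h⁻¹, by simp [Circle.coe_ne_zero]⟩
    · rintro ⟨g, v⟩ q r ⟨h, rfl⟩ ⟨k, rfl⟩
      exact ⟨h * k, by simp [mul_assoc, mul_comm]⟩

/-- The total space of `𝓛_χ = LT^τ ×_{T^τ} ℂ_χ`. -/
def LineBundle (χ : TwistedChar τ) : Type := Quotient (bundleSetoid χ)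

namespace LineBundle
variable {χ : TwistedChar τ}

instance : TopologicalSpace (LineBundle χ) :=
  inferInstanceAs (TopologicalSpace (Quotient (bundleSetoid χ)))

def mk (χ : TwistedChar τ) (g : LTτ τ) (v : ℂ) : LineBundle χ := Quotient.mk (bundleSetoid χ) (g, v)

theorem mk_mul (g : LTτ τ) (h : Tτ τ) (v : ℂ) : mk χ (g * h) v = mk χ g (χ.toHom h * v) :=
  (Quotient.sound (s := bundleSetoid χ) ⟨h, by simp [Circle.coe_ne_zero]⟩).symm

/-- The projection to the flag manifold. -/
def proj (e : LineBundle χ) : FlagManifold τ :=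
  Quotient.liftOn e (fun p => (p.1 : FlagManifold τ)) (by
    rintro ⟨g, v⟩ q ⟨h, rfl⟩
    exact (QuotientGroup.mk_mul_of_mem g h.2).symm)

/-- The left action `g • [g', v] = [g g', v]`. -/
instance : SMul (LTτ τ) (LineBundle χ) where
  smul g := Quotient.map (fun p => (g * p.1, p.2)) (by
    rintro ⟨g', v⟩ q ⟨h, rfl⟩
    exact ⟨h, by simp [mul_assoc]⟩)

theorem smul_mk (g g' : LTτ τ) (v : ℂ) : g • mk χ g' v = mk χ (g * g') v := rfl

/-- The complex structure of the fibres, `c • [g, v] = [g, c v]`. -/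
instance : SMul ℂ (LineBundle χ) where
  smul c := Quotient.map (fun p => (p.1, c * p.2)) (by
    rintro ⟨g', v⟩ q ⟨h, rfl⟩
    exact ⟨h, by simp only [mul_left_comm]⟩)

/-- The trivialization `ΩT × ℂ → 𝓛_χ`, `(x, v) ↦ [sect x, v]`. -/
def triv (χ : TwistedChar τ) (p : FlagManifold τ × ℂ) : LineBundle χ := mk χ (sect p.1) p.2

theorem smul_triv (g : LTτ τ) (x : FlagManifold τ) (v : ℂ) :
    g • triv χ (x, v) = triv χ (g • x, mult χ g x * v) := by
  show mk χ (g * sect x) v = mk χ (sect (g • x)) _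
  unfold mult
  rw [← mk_mul, mul_inv_cancel_left]

theorem proj_triv (x : FlagManifold τ) (v : ℂ) : proj (triv χ (x, v)) = x := mk_section x

/-- `𝓛_χ` is an `LT^τ`-equivariant complex line bundle: a continuous bundle over the flag manifold
with a fibrewise linear (global) trivialization, on which `LT^τ` acts continuously, over its
action on the flag manifold and linearly on the fibres; the added centre acts by scalars. -/
structure IsEquivariantLineBundle (χ : TwistedChar τ) : Prop where
  homeo : IsHomeomorph (triv χ)
  proj_triv : ∀ x v, proj (triv χ (x, v)) = x
  smul_triv : ∀ (c : ℂ) x v, c • triv χ (x, v) = triv χ (x, c * v)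
  act_triv : ∀ (g : LTτ τ) x v, g • triv χ (x, v) = triv χ (g • x, mult χ g x * v)
  one_act : ∀ e : LineBundle χ, (1 : LTτ τ) • e = e
  mul_act : ∀ (g h : LTτ τ) (e : LineBundle χ), (g * h) • e = g • (h • e)
  centre_act : ∀ (z : Circle) (e : LineBundle χ), (tElem τ 1 z : LTτ τ) • e = (z : ℂ) • e
  continuous_act : Continuous fun p : LTτ τ × LineBundle χ => p.1 • p.2

end LineBundle

/-- The subset `Π_T` of the flag manifold is preserved by `T × Π_T`, which acts by translation. -/
theorem smul_point (l : LoopGp) (n : ℤ) :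
    (⟨ofCoord l.t l.n 0, 1⟩ : LTτ τ) • (point (n - l.n) 0 : FlagManifold τ) = point n 0 := by
  show (((⟨ofCoord l.t l.n 0, 1⟩ : LTτ τ) * (⟨ofCoord 1 (n - l.n) 0, 1⟩ : LTτ τ) : LTτ τ) :
    FlagManifold τ) = ((⟨ofCoord 1 n 0, 1⟩ : LTτ τ) : FlagManifold τ)
  rw [eq_comm, QuotientGroup.eq, mem_Tτ]
  have h3 : ∀ a b : LTτ τ, b.loop = a.loop * (a⁻¹ * b).loop := fun a b => by
    rw [← LTτ.mul_loop, mul_inv_cancel_left]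
  have h4 := h3 ⟨ofCoord 1 n 0, 1⟩ (⟨ofCoord l.t l.n 0, 1⟩ * ⟨ofCoord 1 (n - l.n) 0, 1⟩)
  have h5 := congrArg LoopGp.n h4
  have h6 := congrArg LoopGp.f h4
  simp only [LTτ.mul_loop, LoopGp.n_mul, LoopGp.f_mul, LoopGp.n_ofCoord, LoopGp.f_ofCoord] at h5 h6 ⊢
  exact ⟨by omega, by simpa using h6.symm⟩



/-- Exponents of monomials in the variables `z₁, z₂, …`. -/
abbrev MultiIndex : Type := ℕ+ →₀ ℕ
/-- The Hilbert space with orthonormal basis `z₁, z₂, …`. -/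
abbrev OneParticle : Type := lp (fun _ : ℕ+ => ℂ) 2
/-- The completed symmetric algebra on `z₁, z₂, …` for the inner product in which monomials are
orthogonal and `z^m` has square norm `∏ m_k!`, written in the orthonormal basis
`z^m / √(∏ m_k!)`. It carries the irreducible positive energy representation of `ΩT₀`. -/
abbrev Fock : Type := lp (fun _ : MultiIndex => ℂ) 2

/-- The coordinates of the exponential vector `∑ βⁿ / n!` of the symmetric algebra. -/
def coherentCoeff (β : ℕ+ → ℂ) (m : MultiIndex) : ℂ :=
  m.prod fun k j => β k ^ j / (Real.sqrt (Nat.factorial j) : ℂ)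

theorem coherent_memℓp (β : OneParticle) : Memℓp (coherentCoeff β) 2 := by
  classical
  have hβ : Summable fun k => ‖β k‖ ^ 2 := by
    have := (lp.memℓp β).summable (by norm_num)
    simpa using this
  refine memℓp_gen' (C := Real.exp (∑' k, ‖β k‖ ^ 2)) fun s => ?_
  set K : Finset ℕ+ := s.biUnion fun m => m.support
  set N : ℕ := s.sup fun m => K.sup m
  let g : ℕ+ → ℕ → ℝ := fun k j => (‖β k‖ ^ 2) ^ j / (Nat.factorial j : ℝ)
  have hg : ∀ k j, 0 ≤ g k j := fun k j => by positivity
  have hcoef : ∀ m ∈ s, ‖coherentCoeff β m‖ ^ (2 : ENNReal).toReal =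
      ∏ k ∈ K.attach, g k.1 (m k.1) := fun m hm => by
    have h1 : coherentCoeff β m = ∏ k ∈ K, β k ^ m k / (Real.sqrt (Nat.factorial (m k)) : ℂ) :=
      Finsupp.prod_of_support_subset m (Finset.subset_biUnion_of_mem (fun m => m.support) hm) _
        (by simp)
    rw [Finset.prod_attach K fun k => g k (m k), h1, norm_prod]
    simp only [ENNReal.toReal_ofNat, Real.rpow_ofNat]
    rw [← Finset.prod_pow]
    refine Finset.prod_congr rfl fun k _ => ?_
    rw [norm_div, div_pow, norm_pow, Complex.norm_real, Real.norm_of_nonneg (Real.sqrt_nonneg _),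
      Real.sq_sqrt (by positivity), ← pow_mul, mul_comm, pow_mul]
  calc ∑ m ∈ s, ‖coherentCoeff β m‖ ^ (2 : ENNReal).toReal
      = ∑ m ∈ s, ∏ k ∈ K.attach, g k.1 (m k.1) := Finset.sum_congr rfl hcoef
    _ ≤ ∑ p ∈ K.pi fun _ => Finset.range (N + 1), ∏ k ∈ K.attach, g k.1 (p k.1 k.2) := by
        rw [← Finset.sum_image (s := s) (g := fun (m : MultiIndex) (k : ℕ+) (_ : k ∈ K) => m k)
          (f := fun p => ∏ k ∈ K.attach, g k.1 (p k.1 k.2))]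
        · refine Finset.sum_le_sum_of_subset_of_nonneg ?_ fun p _ _ =>
            Finset.prod_nonneg fun k _ => hg _ _
          intro p hp
          obtain ⟨m, hm, rfl⟩ := Finset.mem_image.1 hp
          rw [Finset.mem_pi]
          intro k hk
          rw [Finset.mem_range, Nat.lt_succ_iff]
          exact (Finset.le_sup (f := m) hk).trans (Finset.le_sup (f := fun m : MultiIndex => K.sup m) hm)
        · intro m hm m' hm' h
          ext k
          by_cases hk : k ∈ K
          · exact congrFun (congrFun h k) hk
          · have h0 : ∀ q ∈ s, q k = 0 := fun q hq => by
              by_contra hne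
              exact hk (Finset.mem_biUnion.2 ⟨q, hq, Finsupp.mem_support_iff.2 hne⟩)
            rw [h0 m hm, h0 m' hm']
    _ = ∏ k ∈ K, ∑ j ∈ Finset.range (N + 1), g k j := (Finset.prod_sum _ _ _).symm
    _ ≤ ∏ k ∈ K, Real.exp (‖β k‖ ^ 2) :=
        Finset.prod_le_prod (fun k _ => Finset.sum_nonneg fun j _ => hg k j)
          fun k _ => Real.sum_le_exp_of_nonneg (by positivity) _
    _ = Real.exp (∑ k ∈ K, ‖β k‖ ^ 2) := (Real.exp_sum _ _).symm
    _ ≤ Real.exp (∑' k, ‖β k‖ ^ 2) :=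
        Real.exp_le_exp.2 (hβ.sum_le_tsum K fun k _ => by positivity)

/-- The exponential vector of `β`. -/
def coherent (β : OneParticle) : Fock := ⟨coherentCoeff β, coherent_memℓp β⟩

/-- The unitary operator `exp (∑ α_k M_{z_k} - conj α_k ∂/∂z_k)`, which is the continuous linear
extension of its values `exp(β) ↦ exp(-‖α‖²/2 - ⟨α, β⟩) exp(α + β)` on exponential vectors. -/
def weyl (α : OneParticle) : Fock →L[ℂ] Fock :=
  (Finsupp.linearCombination ℂ fun β : OneParticle =>
      Complex.exp (-(‖α‖ ^ 2 / 2 : ℝ) - inner ℂ α β) • coherent (α + β)).extendOfNorm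
    (Finsupp.linearCombination ℂ coherent)

/-- The coordinates of `f ∈ ΩT₀`. If `f = ∑ x_k e_k + y_k e'_k` in the symplectic basis
`e_k = cos(kθ)/√(kπ) 𝟏`, `e'_k = sin(kθ)/√(kπ) 𝟏`, with `𝟏 = 2π/√κ` a unit vector for `⟨·,·⟩_τ`, this
is `-x_k + i y_k`. The infinitesimal representation `dρ(z_k) = -√2 M_{z_k}`,
`dρ(conj z_k) = √2 ∂/∂z_k`, where `z_k = (e_k + i e'_k)/√2`, has
`dρ(f) = ∑ (-x_k + i y_k) M_{z_k} + (x_k + i y_k) ∂/∂z_k`. -/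
def alphaCoeff (τ : Level) (f : U) (k : ℕ+) : ℂ :=
  -((Real.sqrt (k / π) * (Real.sqrt τ.κ / (2 * π)) : ℝ) : ℂ) *
    ∫ θ in (0 : ℝ)..2 * π, ((f : ℝ → ℝ) θ : ℂ) * Complex.exp (-(k * θ * Complex.I))

theorem U.fourier_parts (F : ℝ → ℝ) (hF : ContDiff ℝ ∞ F) (hp : ∀ θ, F (θ + 2 * π) = F θ)
    (k : ℕ+) : ∫ θ in (0 : ℝ)..2 * π, (F θ : ℂ) * Complex.exp (-(k * θ * Complex.I)) =
      (k * Complex.I)⁻¹ *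
        ∫ θ in (0 : ℝ)..2 * π, ((deriv F θ : ℝ) : ℂ) * Complex.exp (-(k * θ * Complex.I)) := by
  have hk : ((k : ℂ) * Complex.I) ≠ 0 := by simp
  have h1 : ∀ θ : ℝ, HasDerivAt (fun θ : ℝ => (F θ : ℂ)) ((deriv F θ : ℝ) : ℂ) θ := fun θ =>
    ((hF.differentiable (by simp)).differentiableAt.hasDerivAt (x := θ)).ofReal_comp
  have h2 : ∀ θ : ℝ, HasDerivAt
      (fun θ : ℝ => -(k * Complex.I : ℂ)⁻¹ * Complex.exp (-(k * θ * Complex.I)))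
      (Complex.exp (-(k * θ * Complex.I))) θ := fun θ => by
    have h3 : HasDerivAt (fun θ : ℝ => -((k : ℂ) * θ * Complex.I)) (-((k : ℂ) * 1 * Complex.I)) θ :=
      (((Complex.ofRealCLM.hasDerivAt (x := θ)).const_mul (k : ℂ)).mul_const Complex.I).neg
    refine (h3.cexp.const_mul (-(k * Complex.I : ℂ)⁻¹)).congr_deriv ?_
    field_simp
  have hdc : Continuous (deriv F) := (contDiff_infty_iff_deriv.1 hF).2.continuous
  have h4 := intervalIntegral.integral_mul_deriv_eq_deriv_mul (a := 0) (b := 2 * π)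
    (fun θ _ => h1 θ) (fun θ _ => h2 θ)
    ((Complex.continuous_ofReal.comp hdc).intervalIntegrable _ _)
    (Continuous.intervalIntegrable (by fun_prop) _ _)
  have hF0 : F (2 * π) = F 0 := by simpa using hp 0
  have he : Complex.exp (-(k * ((2 * π : ℝ) : ℂ) * Complex.I)) = 1 := by
    rw [Complex.exp_eq_one_iff]
    exact ⟨-(k : ℤ), by push_cast; ring⟩
  rw [h4, hF0, he]
  simp only [Complex.ofReal_zero, mul_zero, zero_mul, neg_zero, Complex.exp_zero, sub_self,
    zero_sub]
  rw [← intervalIntegral.integral_neg, ← intervalIntegral.integral_const_mul]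
  congr 1
  funext θ
  ring

theorem alpha_memℓp (τ : Level) (f : U) : Memℓp (alphaCoeff τ f) 2 := by
  have hf1 := (contDiff_infty_iff_deriv.1 f.smooth).2
  have hf2 := (contDiff_infty_iff_deriv.1 hf1).2
  have hp1 : ∀ θ, deriv (f : ℝ → ℝ) (θ + 2 * π) = deriv (f : ℝ → ℝ) θ := fun θ => by
    rw [← deriv_comp_add_const (f : ℝ → ℝ) (2 * π) θ]; simp only [f.periodic]
  obtain ⟨C, hC⟩ : ∃ C : ℝ, ∀ k : ℕ+,
      ‖∫ θ in (0 : ℝ)..2 * π, ((f : ℝ → ℝ) θ : ℂ) * Complex.exp (-(k * θ * Complex.I))‖ ≤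
        C / (k : ℝ) ^ 2 := by
    refine ⟨∫ θ in (0 : ℝ)..2 * π, ‖deriv (deriv (f : ℝ → ℝ)) θ‖, fun k => ?_⟩
    rw [U.fourier_parts _ f.smooth f.periodic, U.fourier_parts _ hf1 hp1, norm_mul, norm_mul,
      ← mul_assoc, div_eq_inv_mul]
    have h0 : ‖((k : ℂ) * Complex.I)⁻¹‖ = (k : ℝ)⁻¹ := by simp
    rw [h0, ← mul_inv, ← sq]
    refine mul_le_mul_of_nonneg_left ?_ (by positivity)
    refine (intervalIntegral.norm_integral_le_integral_norm (by positivity)).trans (le_of_eq ?_)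
    congr 1
    funext θ
    rw [norm_mul, Complex.norm_real, show -((k : ℂ) * θ * Complex.I) =
      ((-(k * θ) : ℝ) : ℂ) * Complex.I by push_cast; ring, Complex.norm_exp_ofReal_mul_I, mul_one]
  have hs : Summable fun k : ℕ+ => τ.κ / (4 * π ^ 3) * C ^ 2 * (1 / (k : ℝ) ^ 3) := by
    refine Summable.mul_left _ ?_
    exact (Real.summable_one_div_nat_pow.2 (by norm_num : 1 < 3)).comp_injective PNat.coe_injective
  refine memℓp_gen (Summable.of_nonneg_of_le (fun k => by positivity) (fun k => ?_) hs)
  have hκ : (0 : ℝ) ≤ τ.κ := by exact_mod_cast τ.κ_pos.le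
  have hk : (0 : ℝ) < k := by exact_mod_cast k.pos
  have hpi := Real.pi_pos
  simp only [ENNReal.toReal_ofNat, Real.rpow_ofNat, alphaCoeff]
  rw [norm_mul, norm_neg, Complex.norm_real, Real.norm_of_nonneg (by positivity), mul_pow, mul_pow,
    div_pow, Real.sq_sqrt (by positivity), Real.sq_sqrt hκ]
  calc _ ≤ (k : ℝ) / π * (τ.κ / (2 * π) ^ 2) * (C / (k : ℝ) ^ 2) ^ 2 := by
        gcongr; exact hC k
    _ = _ := by field_simp; ring

/-- The sequence `alphaCoeff` as a vector; `f ↦ weyl (alpha τ f)` is the representation `ρ` of `ΩT₀`. -/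
def alpha (τ : Level) (f : U) : OneParticle := ⟨alphaCoeff τ f, alpha_memℓp τ f⟩

/-- The operator `(ψ_j) ↦ (c_j A ψ_{σ j})` on `ℓ²(J; F) = ℓ²(J) ⊗ F`. -/
def lpOp {J F : Type} [NormedAddCommGroup F] [InnerProductSpace ℂ F] (σ : J ≃ J) (c : J → Circle)
    (A : F →L[ℂ] F) : lp (fun _ : J => F) 2 →L[ℂ] lp (fun _ : J => F) 2 :=
  have hs : ∀ ψ : lp (fun _ : J => F) 2, ∀ j, ‖(c j : ℂ) • A (ψ (σ j))‖ ^ 2 ≤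
      ‖A‖ ^ 2 * ‖ψ (σ j)‖ ^ 2 := fun ψ j => by
    rw [norm_smul, Circle.norm_coe, one_mul, ← mul_pow]
    exact pow_le_pow_left₀ (norm_nonneg _) (A.le_opNorm _) 2
  have hψ : ∀ ψ : lp (fun _ : J => F) 2, Summable fun j => ‖ψ j‖ ^ 2 := fun ψ => by
    simpa using (lp.memℓp ψ).summable (by norm_num)
  LinearMap.mkContinuous
    { toFun := fun ψ => ⟨fun j => (c j : ℂ) • A (ψ (σ j)), memℓp_gen (by
        simp only [ENNReal.toReal_ofNat, Real.rpow_ofNat]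
        exact Summable.of_nonneg_of_le (fun j => by positivity) (hs ψ)
          (((σ.summable_iff).2 (hψ ψ)).mul_left _))⟩
      map_add' := fun ψ φ => lp.ext (funext fun j => by
        show (c j : ℂ) • A (ψ (σ j) + φ (σ j)) = (c j : ℂ) • A (ψ (σ j)) + (c j : ℂ) • A (φ (σ j))
        rw [map_add, smul_add])
      map_smul' := fun a ψ => lp.ext (funext fun j => by
        show (c j : ℂ) • A (a • ψ (σ j)) = a • (c j : ℂ) • A (ψ (σ j))
        rw [map_smul, smul_comm]) }
    ‖A‖ (fun ψ => by
      refine lp.norm_le_of_tsum_le (by norm_num) (by positivity) ?_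
      simp only [ENNReal.toReal_ofNat, Real.rpow_ofNat, LinearMap.coe_mk, AddHom.coe_mk]
      have h2 := lp.norm_rpow_eq_tsum (p := 2) (by norm_num) ψ
      simp only [ENNReal.toReal_ofNat, Real.rpow_ofNat] at h2
      rw [mul_pow, h2, ← tsum_mul_left, ← σ.tsum_eq fun j => ‖A‖ ^ 2 * ‖ψ j‖ ^ 2]
      exact Summable.tsum_le_tsum (hs ψ)
        (Summable.of_nonneg_of_le (fun j => by positivity) (hs ψ)
          (((σ.summable_iff).2 (hψ ψ)).mul_left _)) (((σ.summable_iff).2 (hψ ψ)).mul_left _))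

theorem lpOp_apply {J F : Type} [NormedAddCommGroup F] [InnerProductSpace ℂ F] (σ : J ≃ J)
    (c : J → Circle) (A : F →L[ℂ] F) (ψ : lp (fun _ : J => F) 2) (j : J) :
    lpOp σ c A ψ j = (c j : ℂ) • A (ψ (σ j)) := rfl

/-- The space `⨁_{n ∈ Π_T} V` with `V` the completed symmetric algebra. -/
abbrev VSpace : Type := lp (fun _ : ℤ => Fock) 2

/-- The representation `V_[χ] = ⨁_{n ∈ Π_T} V ⊗ ℂ_{χ + κ^τ(n)}` of `LT` at level `τ`: on the summand
with index `n` the torus `T` acts by `χ + κ^τ(n)` and `ΩT₀` by `ρ`, and `Π_T` permutes the summands,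
`m ∈ Π_T` taking the one with index `n` to the one with index `n - m`. -/
def rhoV (χ : TwistedChar τ) (l : LoopGp) : VSpace →L[ℂ] VSpace :=
  lpOp (Equiv.addRight l.n) (fun n => χ.toHom (tElem τ l.t 1) * l.t ^ (τ.κ * n))
    (weyl (alpha τ l.f))

/-- Labels `(n, m, A)` of the orthonormal basis `δ_n ⊗ e_m^* ⊗ e_A` of `L²(Π_T) ⊗ V^* ⊗ S`. Here
`δ_n` is the section over `Π_T` of the line bundle that is supported at `n`, where its value is `1`
in the trivialization `LineBundle.triv`; `(e_m^*)` is the dual basis of the basis of `V`; and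
`e_A = conj z_{a₁} ∧ conj z_{a₂} ∧ …`, for `A = {a₁ < a₂ < …}`, is the basis of the spinor space
`S`, the completed exterior algebra on the `conj z_k`. -/
abbrev Index : Type := ℤ × MultiIndex × Finset ℕ+

/-- The Hilbert space `L²(ΩT, 𝓛_χ ⊗ 𝓢) = L²(Π_T, 𝓛_χ) ⊗ L²(ΩT₀) ⊗ S`, where
`L²(ΩT₀) = V^* ⊗ V`, as the space `ℓ²(Index) ⊗ V = ℓ²(Index; V)`. -/
abbrev HSpace : Type := lp (fun _ : Index => Fock) 2

/-- The action of `LT` on `L²(ΩT, 𝓛_χ ⊗ 𝓢)`. The group `T × Π_T` acts on sections over `Π_T` of the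
equivariant line bundle by `(g s)(x) = g (s(g⁻¹ x))`, and `ΩT₀` acts on `L²(ΩT₀) = V^* ⊗ V` by the left
regular representation `id ⊗ ρ`. -/
def rhoH (χ : TwistedChar τ) (l : LoopGp) : HSpace →L[ℂ] HSpace :=
  lpOp ((Equiv.subRight l.n).prodCongr (Equiv.refl _))
    (fun j => mult χ ⟨ofCoord l.t l.n 0, 1⟩ (point (j.1 - l.n) 0)) (weyl (alpha τ l.f))

/-- The operator `dρ^*(z_k)` of the adjoint representation on finite energy vectors of `V^*`. Since
`dρ^*(X)` is minus the transpose of `dρ(X)`, it is `√2` times the transpose of `M_{z_k}`. -/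
def dRhoStarZ (k : ℕ+) : (MultiIndex →₀ ℂ) →ₗ[ℂ] (MultiIndex →₀ ℂ) :=
  (Real.sqrt 2 : ℂ) • Finsupp.linearCombination ℂ fun m : MultiIndex =>
    Finsupp.single (m - Finsupp.single k 1) (Real.sqrt (m k) : ℂ)

/-- The operator `dρ^*(conj z_k)`: minus `√2` times the transpose of `∂/∂z_k`. -/
def dRhoStarZbar (k : ℕ+) : (MultiIndex →₀ ℂ) →ₗ[ℂ] (MultiIndex →₀ ℂ) :=
  (-(Real.sqrt 2) : ℂ) • Finsupp.linearCombination ℂ fun m : MultiIndex =>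
    Finsupp.single (m + Finsupp.single k 1) (Real.sqrt (m k + 1) : ℂ)

/-- The sign of moving `conj z_k` past the factors of `e_A` with smaller index. -/
def wedgeSign (k : ℕ+) (A : Finset ℕ+) : ℂ := (-1) ^ (A.filter (· < k)).card

/-- Clifford multiplication `γ(conj z_k) = √2 conj z_k ∧`. -/
def gammaZbar (k : ℕ+) : (Finset ℕ+ →₀ ℂ) →ₗ[ℂ] (Finset ℕ+ →₀ ℂ) :=
  (Real.sqrt 2 : ℂ) • Finsupp.linearCombination ℂ fun A : Finset ℕ+ =>
    if k ∈ A then 0 else Finsupp.single (insert k A) (wedgeSign k A)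

/-- Clifford multiplication `γ(z_k) = -√2 conj z_k ⌟`. -/
def gammaZ (k : ℕ+) : (Finset ℕ+ →₀ ℂ) →ₗ[ℂ] (Finset ℕ+ →₀ ℂ) :=
  (-(Real.sqrt 2) : ℂ) • Finsupp.linearCombination ℂ fun A : Finset ℕ+ =>
    if k ∈ A then Finsupp.single (A.erase k) (wedgeSign k A) else 0

/-- The map `φ ↦ δ_n ⊗ u ⊗ w ⊗ φ`. -/
def tens (n : ℤ) (u : MultiIndex →₀ ℂ) (w : Finset ℕ+ →₀ ℂ) : Fock →ₗ[ℂ] (Index →₀ Fock) :=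
  u.sum fun m a => w.sum fun A c => (a * c) • Finsupp.lsingle (n, m, A)

/-- The Dirac operator `∑_k √k (dρ^*(z_k) ⊗ γ(conj z_k) + dρ^*(conj z_k) ⊗ γ(z_k))` on finite
combinations of basis vectors. At `δ_n ⊗ e_m^* ⊗ e_A` only the terms with `m_k ≠ 0` or `k ∈ A` are
not zero. There is no contribution of `Π_T`, which has dimension zero. -/
def diracFin : (Index →₀ Fock) →ₗ[ℂ] (Index →₀ Fock) :=
  Finsupp.lsum ℂ fun j : Index => ∑ k ∈ j.2.1.support ∪ j.2.2, (Real.sqrt k : ℂ) •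
    (tens j.1 (dRhoStarZ k (Finsupp.single j.2.1 1)) (gammaZbar k (Finsupp.single j.2.2 1)) +
      tens j.1 (dRhoStarZbar k (Finsupp.single j.2.1 1)) (gammaZ k (Finsupp.single j.2.2 1)))

/-- Finite combinations of basis vectors as elements of the Hilbert space. -/
def finToH : (Index →₀ Fock) →ₗ[ℂ] HSpace :=
  Finsupp.lsum ℂ fun j : Index => lp.lsingle (E := fun _ : Index => Fock) (𝕜 := ℂ) 2 j

/-- The dense subspace of finite combinations of basis vectors. -/
def finDomain : Submodule ℂ HSpace where
  carrier := {ψ | (Function.support ψ).Finite}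
  zero_mem' := by
    show (Function.support (fun _ : Index => (0 : Fock))).Finite
    simp
  add_mem' {ψ φ} hψ hφ := (Set.Finite.union hψ hφ).subset (Function.support_add _ _)
  smul_mem' c ψ hψ := Set.Finite.subset hψ (Function.support_const_smul_subset c _)

/-- The Dirac operator `𝓓_χ` as a densely defined operator on `L²(ΩT, 𝓛_χ ⊗ 𝓢)`. -/
def dirac (_χ : TwistedChar τ) : HSpace →ₗ.[ℂ] HSpace where
  domain := finDomain
  toFun :=
    { toFun := fun ψ => finToH (diracFin (Finsupp.ofSupportFinite ψ.1 ψ.2))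
      map_add' := fun ψ φ => by
        rw [← map_add, ← map_add]; congr 2; exact Finsupp.ext fun _ => rfl
      map_smul' := fun c ψ => by
        rw [RingHom.id_apply, ← map_smul, ← map_smul]; congr 2; exact Finsupp.ext fun _ => rfl }

/-- The kernel of the closure of `𝓓_χ` on the part of degree `p` for the grading of `S` by the parity
of the exterior degree. -/
def gradedKer (χ : TwistedChar τ) (p : ZMod 2) : Submodule ℂ HSpace where
  carrier := {ψ | (∀ j : Index, (j.2.2.card : ZMod 2) ≠ p → ψ j = 0) ∧
    (ψ, (0 : HSpace)) ∈ (dirac χ).closure.graph}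
  zero_mem' := ⟨fun _ _ => rfl, Submodule.zero_mem _⟩
  add_mem' {ψ φ} hψ hφ := ⟨fun j hj => by
    rw [lp.coeFn_add, Pi.add_apply, hψ.1 j hj, hφ.1 j hj, add_zero], by
      simpa using Submodule.add_mem _ hψ.2 hφ.2⟩
  smul_mem' c ψ hψ := ⟨fun j hj => by
    rw [lp.coeFn_smul, Pi.smul_apply, hψ.1 j hj, smul_zero], by
      simpa using Submodule.smul_mem _ c hψ.2⟩

section Rep
variable {H : Type} [NormedAddCommGroup H] [InnerProductSpace ℂ H]

/-- A strongly continuous unitary `τ`-projective representation of `LT`; that is, a unitary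
representation of `LT^τ` on which the added centre acts by scalars. (Surjectivity of `ρ l` follows
from the other conditions.) -/
structure IsTauRep (τ : Level) (ρ : LoopGp → H →L[ℂ] H) : Prop where
  norm_map : ∀ l v, ‖ρ l v‖ = ‖v‖
  mul : ∀ a b v, ρ a (ρ b v) = (cocycle τ a b : ℂ) • ρ (a * b) v
  continuous : ∀ v, Continuous fun l => ρ l v

/-- The representation of `LT^τ` that corresponds to a `τ`-projective representation. -/
def hat {τ : Level} (ρ : LoopGp → H →L[ℂ] H) (g : LTτ τ) : H →L[ℂ] H := (g.z : ℂ) • ρ g.loop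

/-- The subspace where the rotation through `s` acts by `exp (i j s)`. -/
def weightSpace (R : ℝ → H →L[ℂ] H) (j : ℤ) : Submodule ℂ H where
  carrier := {v | ∀ s, R s v = (Circle.exp (j * s) : ℂ) • v}
  zero_mem' s := by rw [map_zero, smul_zero]
  add_mem' {v w} hv hw s := by rw [map_add, hv s, hw s, smul_add]
  smul_mem' c v hv s := by rw [map_smul, hv s, smul_comm]

/-- `R` is a strongly continuous unitary representation of `𝕋_rot = ℝ / 2πℤ` that extends `ρ` to
`𝕋_rot ⋉ LT^τ`. -/
structure IsRotationLift (τ : Level) (ρ : LoopGp → H →L[ℂ] H) (R : ℝ → H →L[ℂ] H) : Prop where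
  zero : R 0 = ContinuousLinearMap.id ℂ H
  add : ∀ s s', R (s + s') = (R s).comp (R s')
  period : R (2 * π) = ContinuousLinearMap.id ℂ H
  norm_map : ∀ s v, ‖R s v‖ = ‖v‖
  continuous : ∀ v, Continuous fun s => R s v
  semidirect : ∀ s (g : LTτ τ) v, R s (hat ρ g v) = hat ρ (LTτ.rot s g) (R s v)

/-- Positive energy representations of `LT` at level `τ`. -/
structure IsPER (τ : Level) (ρ : LoopGp → H →L[ℂ] H) : Prop where
  rep : IsTauRep τ ρ
  positive : ∃ R : ℝ → H →L[ℂ] H, IsRotationLift τ ρ R ∧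
    (∀ j, FiniteDimensional ℂ (weightSpace R j)) ∧ ∃ N : ℤ, ∀ j < N, weightSpace R j = ⊥

/-- Irreducibility: there is no proper non-zero closed invariant subspace. -/
def IsIrreducibleRep (ρ : LoopGp → H →L[ℂ] H) : Prop :=
  Nontrivial H ∧ ∀ W : Submodule ℂ H, IsClosed (W : Set H) → (∀ l, ∀ v ∈ W, ρ l v ∈ W) →
    W = ⊥ ∨ W = ⊤

end Rep

/-- An irreducible positive energy representation of `LT` at level `τ` on a Hilbert space. -/
structure IrrPER (τ : Level) where
  H : Type
  [normed : NormedAddCommGroup H]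
  [inner : InnerProductSpace ℂ H]
  [complete : CompleteSpace H]
  ρ : LoopGp → H →L[ℂ] H
  per : IsPER τ ρ
  irr : IsIrreducibleRep ρ

attribute [instance] IrrPER.normed IrrPER.inner IrrPER.complete

/-- Unitary equivalence. -/
instance IrrPER.setoid (τ : Level) : Setoid (IrrPER τ) where
  r P Q := ∃ e : P.H ≃ₗᵢ[ℂ] Q.H, ∀ l v, e (P.ρ l v) = Q.ρ l (e v)
  iseqv :=
    { refl := fun P => ⟨LinearIsometryEquiv.refl ℂ P.H, fun _ _ => rfl⟩
      symm := fun {P Q} ⟨e, he⟩ => ⟨e.symm, fun l v => by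
        rw [LinearIsometryEquiv.symm_apply_eq, he, e.apply_symm_apply]⟩
      trans := fun {P Q R} ⟨e, he⟩ ⟨e', he'⟩ => ⟨e.trans e', fun l v => by
        simp [he, he']⟩ }

/-- The group `R^τ(LT)`: the free abelian group on the isomorphism classes of irreducible positive
energy representations at level `τ`. -/
abbrev Rτ (τ : Level) : Type 1 := Quotient (IrrPER.setoid τ) →₀ ℤ

/-- The class of an irreducible representation. -/
def IrrPER.cls (P : IrrPER τ) : Rτ τ := Finsupp.single (Quotient.mk (IrrPER.setoid τ) P) 1

/-- The subspace `W` is invariant and is a finite orthogonal sum of irreducible positive energy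
representations, with class `x`. -/
def HasClass {H : Type} [NormedAddCommGroup H] [InnerProductSpace ℂ H] (ρ : LoopGp → H →L[ℂ] H)
    (W : Submodule ℂ H) (x : Rτ τ) : Prop :=
  ∃ (r : ℕ) (P : Fin r → IrrPER τ) (ι : ∀ i, (P i).H →ₗᵢ[ℂ] H),
    (∀ i l v, ι i ((P i).ρ l v) = ρ l (ι i v)) ∧
    OrthogonalFamily ℂ (fun i => (P i).H) ι ∧
    ⨆ i, LinearMap.range (ι i).toLinearMap = W ∧
    x = ∑ i, (P i).cls

/-- `x = [ker 𝓓_χ on even spinors] - [ker 𝓓_χ on odd spinors]` in `R^τ(LT)`. -/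
def HasAnalyticIndex (χ : TwistedChar τ) (x : Rτ τ) : Prop :=
  ∃ x₀ x₁ : Rτ τ, HasClass (rhoH χ) (gradedKer χ 0) x₀ ∧
    HasClass (rhoH χ) (gradedKer χ 1) x₁ ∧ x = x₀ - x₁

end
end BorelWeilLT
open BorelWeilLT

namespace BorelWeilLT
open Filter Topology
open scoped InnerProductSpace ComplexConjugate

section General
variable {H : Type*} [NormedAddCommGroup H] [InnerProductSpace ℂ H]

/-- Contractions that depend continuously on a parameter on a total set of vectors are strongly
continuous. -/
theorem continuous_apply_of_dense {X : Type*} [TopologicalSpace X] {U : X → H →L[ℂ] H}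
    (hU : ∀ x v, ‖U x v‖ ≤ ‖v‖) {S : Set H} (hS : Dense (Submodule.span ℂ S : Set H))
    (h : ∀ v ∈ S, Continuous fun x => U x v) (v : H) : Continuous fun x => U x v := by
  have hspan : ∀ w ∈ Submodule.span ℂ S, Continuous fun x => U x w := fun w hw => by
    induction hw using Submodule.span_induction with
    | mem w hw => exact h w hw
    | zero => simpa using continuous_const
    | add w w' _ _ h1 h2 => simp only [map_add]; exact h1.add h2
    | smul c w _ h1 => simp only [map_smul]; exact h1.const_smul c
  rw [continuous_iff_continuousAt]
  intro x₀
  rw [Metric.continuousAt_iff']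
  intro ε hε
  obtain ⟨w, hw, hwv⟩ := Metric.dense_iff.1 hS v (ε / 3) (by positivity)
  rw [Metric.mem_ball, dist_comm, dist_eq_norm] at hw
  filter_upwards [Metric.continuousAt_iff'.1 (hspan w hwv).continuousAt (ε / 3) (by positivity)]
    with x hx
  rw [dist_eq_norm] at hx ⊢
  have h1 : U x v - U x₀ v = U x (v - w) + (U x w - U x₀ w) - U x₀ (v - w) := by
    simp only [map_sub]; abel
  have h2 := hU x (v - w)
  have h3 := hU x₀ (v - w)
  have h4 := norm_sub_le (U x (v - w) + (U x w - U x₀ w)) (U x₀ (v - w))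
  have h5 := norm_add_le (U x (v - w)) (U x w - U x₀ w)
  rw [h1]; linarith

/-- Two continuous operators that agree on a total set are equal. -/
theorem clm_ext_of_dense {F : Type*} [NormedAddCommGroup F] [InnerProductSpace ℂ F]
    {A B : H →L[ℂ] F} {S : Set H} (hS : Dense (Submodule.span ℂ S : Set H))
    (h : ∀ v ∈ S, A v = B v) : A = B :=
  ContinuousLinearMap.ext_on hS h

/-- The orthogonal projection to a subspace that is invariant under `U` and its adjoint commutes
with `U`. -/
theorem starProjection_comm (W : Submodule ℂ H) [W.HasOrthogonalProjection] {U U' : H →L[ℂ] H}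
    (hadj : ∀ x y, ⟪U x, y⟫_ℂ = ⟪x, U' y⟫_ℂ) (hU : ∀ w ∈ W, U w ∈ W) (hU' : ∀ w ∈ W, U' w ∈ W)
    (x : H) : W.starProjection (U x) = U (W.starProjection x) := by
  refine Submodule.eq_starProjection_of_mem_of_inner_eq_zero
    (hU _ (W.starProjection_apply_mem x)) fun w hw => ?_
  rw [← map_sub, hadj]
  exact W.starProjection_inner_eq_zero x _ (hU' w hw)

/-- The only closed subspaces whose orthogonal projection is a scalar are the trivial ones. -/
theorem eq_bot_or_top_of_starProjection (W : Submodule ℂ H) [W.HasOrthogonalProjection] {c : ℂ}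
    (h : ∀ x, W.starProjection x = c • x) : W = ⊥ ∨ W = ⊤ := by
  by_cases hc : c = 0
  · left
    rw [Submodule.eq_bot_iff]
    intro x hx
    rw [← Submodule.starProjection_eq_self_iff.2 hx, h, hc, zero_smul]
  · right
    rw [Submodule.eq_top_iff']
    intro x
    have h1 := W.smul_mem c⁻¹ (W.starProjection_apply_mem x)
    rwa [h, smul_smul, inv_mul_cancel₀ hc, one_smul] at h1

end General

section Lp

theorem lp_hasSum_norm_sq {J F : Type} [NormedAddCommGroup F] (ψ : lp (fun _ : J => F) 2) :
    HasSum (fun j => ‖ψ j‖ ^ 2) (‖ψ‖ ^ 2) := by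
  simpa using lp.hasSum_norm (p := 2) (by norm_num) ψ

variable {J F : Type} [NormedAddCommGroup F] [InnerProductSpace ℂ F]

theorem lpOp_norm (σ : J ≃ J) (c : J → Circle) {A : F →L[ℂ] F} (hA : ∀ v, ‖A v‖ = ‖v‖)
    (ψ : lp (fun _ : J => F) 2) : ‖lpOp σ c A ψ‖ = ‖ψ‖ := by
  have h1 := lp_hasSum_norm_sq (lpOp σ c A ψ)
  simp only [lpOp_apply, norm_smul, Circle.norm_coe, one_mul, hA] at h1
  have h2 : HasSum (fun j => ‖ψ (σ j)‖ ^ 2) (‖ψ‖ ^ 2) := σ.hasSum_iff.2 (lp_hasSum_norm_sq ψ)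
  exact (pow_left_inj₀ (norm_nonneg _) (norm_nonneg _) two_ne_zero).1 (h1.unique h2)

theorem lpOp_single [DecidableEq J] (σ : J ≃ J) (c : J → Circle) (A : F →L[ℂ] F) (j : J) (v : F) :
    lpOp σ c A (lp.single 2 j v) = (c (σ.symm j) : ℂ) • lp.single 2 (σ.symm j) (A v) := by
  refine lp.ext (funext fun i => ?_)
  rw [lpOp_apply, lp.coeFn_smul, Pi.smul_apply]
  by_cases h : i = σ.symm j
  · subst h; simp
  · have h' : σ i ≠ j := fun e => h (by rw [← e, σ.symm_apply_apply])
    rw [lp.single_apply_ne _ _ _ h', lp.single_apply_ne _ _ _ h, map_zero, smul_zero, smul_zero]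

/-- Vectors supported at one index are total. -/
theorem lp_dense_single [DecidableEq J] {S : Set F} (hS : Dense (Submodule.span ℂ S : Set F)) :
    Dense (Submodule.span ℂ {ψ : lp (fun _ : J => F) 2 | ∃ j, ∃ v ∈ S, ψ = lp.single 2 j v} :
      Set (lp (fun _ : J => F) 2)) := by
  set N := Submodule.span ℂ {ψ : lp (fun _ : J => F) 2 | ∃ j, ∃ v ∈ S, ψ = lp.single 2 j v}
  have h1 : ∀ j (v : F), lp.single 2 j v ∈ N.topologicalClosure := fun j v => by
    have h2 : Set.MapsTo (lp.singleContinuousLinearMap ℂ (fun _ : J => F) 2 j)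
        (Submodule.span ℂ S : Set F) (N : Set (lp (fun _ : J => F) 2)) := fun w hw => by
      have h3 : Submodule.span ℂ S ≤
          N.comap (lp.singleContinuousLinearMap ℂ (fun _ : J => F) 2 j).toLinearMap :=
        Submodule.span_le.2 fun w hw => Submodule.subset_span ⟨j, w, hw, rfl⟩
      exact h3 hw
    exact map_mem_closure (lp.singleContinuousLinearMap ℂ (fun _ : J => F) 2 j).continuous
      (hS v) h2
  intro ψ
  have h2 := lp.hasSum_single (p := 2) (by norm_num) ψ
  have h3 : ψ ∈ N.topologicalClosure := by
    refine N.isClosed_topologicalClosure.mem_of_tendsto h2 (Eventually.of_forall fun s => ?_)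
    exact Submodule.sum_mem _ fun j _ => h1 j _
  exact h3

theorem lp_dense_single_univ [DecidableEq J] :
    Dense (Submodule.span ℂ {ψ : lp (fun _ : J => F) 2 | ∃ j, ∃ v, ψ = lp.single 2 j v} :
      Set (lp (fun _ : J => F) 2)) := by
  have := lp_dense_single (J := J) (F := F) (S := Set.univ) (by simp)
  simpa using this

/-- Strong continuity of `lpOp` in its parameters, for permutations that are locally constant. -/
theorem lpOp_continuous {X : Type*} [TopologicalSpace X] {σ : X → J ≃ J} {c : X → J → Circle}
    {A : X → F →L[ℂ] F} (hσ : ∀ j, IsLocallyConstant fun x => (σ x).symm j)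
    (hc : ∀ j, Continuous fun x => c x j) (hA : ∀ x v, ‖A x v‖ = ‖v‖)
    (hA' : ∀ v, Continuous fun x => A x v) (ψ : lp (fun _ : J => F) 2) :
    Continuous fun x => lpOp (σ x) (c x) (A x) ψ := by
  classical
  refine continuous_apply_of_dense (fun x v => (lpOp_norm _ _ (hA x) v).le) lp_dense_single_univ
    ?_ ψ
  rintro _ ⟨j, v, rfl⟩
  rw [continuous_iff_continuousAt]
  intro x₀
  have h1 : ∀ᶠ x in 𝓝 x₀, (σ x).symm j = (σ x₀).symm j := (hσ j).eventually_eq x₀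
  have h2 : Continuous fun x => (c x ((σ x₀).symm j) : ℂ) • (lp.single 2 ((σ x₀).symm j) (A x v) :
      lp (fun _ : J => F) 2) :=
    (continuous_subtype_val.comp (hc _)).smul
      ((lp.singleContinuousLinearMap ℂ (fun _ : J => F) 2 _).continuous.comp (hA' v))
  refine h2.continuousAt.congr (h1.mono fun x hx => ?_)
  simp only
  rw [lpOp_single, hx]

/-- The adjoint of a diagonal unitary operator. -/
theorem lpOp_refl_adjoint (c : J → Circle) {A A' : F →L[ℂ] F}
    (hA : ∀ v w, ⟪A v, w⟫_ℂ = ⟪v, A' w⟫_ℂ) (ψ φ : lp (fun _ : J => F) 2) :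
    ⟪lpOp (Equiv.refl J) c A ψ, φ⟫_ℂ = ⟪ψ, lpOp (Equiv.refl J) (fun j => (c j)⁻¹) A' φ⟫_ℂ := by
  rw [lp.inner_eq_tsum, lp.inner_eq_tsum]
  congr 1; funext j
  simp only [lpOp_apply, Equiv.refl_apply, inner_smul_left, inner_smul_right, hA,
    Circle.coe_inv_eq_conj]

end Lp

/-- The exponential of a sum, expanded over multi-indices. -/
theorem hasSum_multiIndex_exp {x : ℕ+ → ℂ} (hx : Summable x)
    (hs : Summable fun m : MultiIndex => m.prod fun k j => x k ^ j / (j.factorial : ℂ)) :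
    HasSum (fun m : MultiIndex => m.prod fun k j => x k ^ j / (j.factorial : ℂ))
      (Complex.exp (∑' k, x k)) := by
  classical
  set F : MultiIndex → ℂ := fun m => m.prod fun k j => x k ^ j / (j.factorial : ℂ) with hF
  let E : Finset ℕ+ × ℕ → Finset MultiIndex := fun p => (p.1.pi fun _ => Finset.range p.2).map
    ⟨Finsupp.indicator p.1, Finsupp.indicator_injective p.1⟩
  have hE : ∀ p, ∑ m ∈ E p, F m =
      ∏ k ∈ p.1, ∑ j ∈ Finset.range p.2, x k ^ j / (j.factorial : ℂ) := fun p => by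
    rw [Finset.prod_sum, Finset.sum_map]
    refine Finset.sum_congr rfl fun q hq => ?_
    simp only [Function.Embedding.coeFn_mk, hF]
    rw [Finsupp.prod_of_support_subset _ (Finsupp.support_indicator_subset _ _) _ (by simp),
      ← Finset.prod_attach]
    refine Finset.prod_congr rfl fun k _ => ?_
    rw [Finsupp.indicator_of_mem k.2]
  have hEt : Tendsto E atTop atTop := by
    refine tendsto_atTop.2 fun s => ?_
    filter_upwards [eventually_ge_atTop (s.biUnion fun m => m.support,
      (s.biUnion fun m => m.support).sup (fun k => s.sup fun m => m k) + 1)] with p hp m hm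
    have h1 : m.support ⊆ s.biUnion fun m => m.support :=
      Finset.subset_biUnion_of_mem (fun m : MultiIndex => m.support) hm
    refine Finset.mem_map.2 ⟨fun k _ => m k, Finset.mem_pi.2 fun k _ =>
      Finset.mem_range.2 (lt_of_lt_of_le (Nat.lt_succ_iff.2 ?_) hp.2), ?_⟩
    · by_cases hk : k ∈ m.support
      · exact (Finset.le_sup (f := fun m : MultiIndex => m k) hm).trans
          (Finset.le_sup (f := fun k => s.sup fun m => m k) (h1 hk))
      · rw [Finsupp.notMem_support_iff.1 hk]; exact Nat.zero_le _
    · ext k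
      by_cases hk : k ∈ p.1
      · exact Finsupp.indicator_of_mem hk fun k _ => m k
      · exact (Finsupp.indicator_of_notMem hk fun k _ => m k).trans
          (Finsupp.notMem_support_iff.1 fun h => hk (hp.1 (h1 h))).symm
  have h1 := hs.hasSum.comp hEt
  simp only [Function.comp_def, hE] at h1
  have h2 : ∀ K : Finset ℕ+, Tendsto (fun N : ℕ =>
      ∏ k ∈ K, ∑ j ∈ Finset.range N, x k ^ j / (j.factorial : ℂ)) atTop
      (𝓝 (Complex.exp (∑ k ∈ K, x k))) := fun K => by
    rw [Complex.exp_sum]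
    refine tendsto_finsetProd _ fun k _ => ?_
    rw [Complex.exp_eq_exp_ℂ]
    exact (NormedSpace.expSeries_div_hasSum_exp (x k)).tendsto_sum_nat
  have h3 : Tendsto (fun K : Finset ℕ+ => Complex.exp (∑ k ∈ K, x k)) atTop
      (𝓝 (Complex.exp (∑' k, x k))) := (Complex.continuous_exp.tendsto _).comp hx.hasSum
  have h4 : Tendsto (fun K : Finset ℕ+ => Complex.exp (∑ k ∈ K, x k)) atTop (𝓝 (∑' m, F m)) := by
    rw [Metric.tendsto_nhds]
    intro ε hε
    rw [← prod_atTop_atTop_eq] at h1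
    filter_upwards [(Metric.tendsto_nhds.1 h1 (ε / 2) (by positivity)).curry] with K hK
    refine (le_of_tendsto ((h2 K).dist tendsto_const_nhds)
      (hK.mono fun N hN => hN.le)).trans_lt (by linarith)
  rw [← tendsto_nhds_unique h4 h3]
  exact hs.hasSum

theorem coherent_apply (β : OneParticle) (m : MultiIndex) :
    coherent β m = coherentCoeff β m := rfl

theorem inner_coherent (α β : OneParticle) :
    ⟪coherent α, coherent β⟫_ℂ = Complex.exp ⟪α, β⟫_ℂ := by
  have h1 : ∀ m : MultiIndex, ⟪coherent α m, coherent β m⟫_ℂ =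
      m.prod fun k j => ⟪α k, β k⟫_ℂ ^ j / (j.factorial : ℂ) := fun m => by
    rw [RCLike.inner_apply, coherent_apply, coherent_apply, coherentCoeff, coherentCoeff,
      Finsupp.prod, Finsupp.prod, Finsupp.prod, map_prod, ← Finset.prod_mul_distrib]
    refine Finset.prod_congr rfl fun k _ => ?_
    rw [RCLike.inner_apply, map_div₀, map_pow, Complex.conj_ofReal, div_mul_div_comm, ← mul_pow,
      ← Complex.ofReal_mul, Real.mul_self_sqrt (by positivity), Complex.ofReal_natCast]
  have h2 := lp.hasSum_inner (𝕜 := ℂ) (coherent α) (coherent β)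
  simp only [h1] at h2
  rw [h2.unique (hasSum_multiIndex_exp (lp.summable_inner α β) h2.summable), lp.inner_eq_tsum]

theorem exists_zpow_ne {a b : ℤ} (h : a ≠ b) : ∃ z : Circle, z ^ a ≠ z ^ b := by
  refine ⟨Circle.exp (π / ((a - b : ℤ) : ℝ)), fun e => ?_⟩
  have h0 : ((a - b : ℤ) : ℝ) ≠ 0 := by exact_mod_cast sub_ne_zero.2 h
  have h1 : Circle.exp (π / ((a - b : ℤ) : ℝ)) ^ (a - b) = 1 := by rw [zpow_sub, e, mul_inv_cancel]
  rw [← Circle.exp_zsmul, zsmul_eq_mul, mul_div_cancel₀ _ h0] at h1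
  have h2 := congrArg (fun z : Circle => (z : ℂ)) h1
  simp only [Circle.coe_exp, Complex.exp_pi_mul_I, Circle.coe_one] at h2
  norm_num at h2

theorem circle_coe_prod {ι : Type*} (s : Finset ι) (f : ι → Circle) :
    ((∏ i ∈ s, f i : Circle) : ℂ) = ∏ i ∈ s, (f i : ℂ) :=
  map_prod Circle.coeHom f s

/-- The phases of the gauge transformation `z_k ↦ u_k z_k` on monomials. -/
noncomputable def gaugePhase (u : ℕ+ → Circle) (m : MultiIndex) : Circle := m.prod fun k j => u k ^ j

/-- The gauge transformation `z_k ↦ u_k z_k` of the Fock space. -/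
noncomputable def gauge (u : ℕ+ → Circle) : Fock →L[ℂ] Fock :=
  lpOp (Equiv.refl _) (gaugePhase u) (ContinuousLinearMap.id ℂ ℂ)

/-- The gauge transformation `z_k ↦ u_k z_k` of the one particle space. -/
noncomputable def gaugeOne (u : ℕ+ → Circle) : OneParticle →L[ℂ] OneParticle :=
  lpOp (Equiv.refl _) u (ContinuousLinearMap.id ℂ ℂ)

theorem gauge_apply (u : ℕ+ → Circle) (v : Fock) (m : MultiIndex) :
    gauge u v m = gaugePhase u m * v m := rfl

theorem gaugeOne_apply (u : ℕ+ → Circle) (v : OneParticle) (k : ℕ+) :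
    gaugeOne u v k = u k * v k := rfl

theorem gauge_norm (u : ℕ+ → Circle) (v : Fock) : ‖gauge u v‖ = ‖v‖ :=
  lpOp_norm _ _ (fun _ => rfl) v

theorem gaugeOne_norm (u : ℕ+ → Circle) (v : OneParticle) : ‖gaugeOne u v‖ = ‖v‖ :=
  lpOp_norm _ _ (fun _ => rfl) v

theorem gauge_coherent (u : ℕ+ → Circle) (β : OneParticle) :
    gauge u (coherent β) = coherent (gaugeOne u β) := by
  refine lp.ext (funext fun m => ?_)
  rw [gauge_apply, coherent_apply, coherent_apply, coherentCoeff, coherentCoeff, gaugePhase,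
    Finsupp.prod, Finsupp.prod, Finsupp.prod, circle_coe_prod,
    ← Finset.prod_mul_distrib]
  refine Finset.prod_congr rfl fun k _ => ?_
  rw [Circle.coe_pow, gaugeOne_apply, mul_pow, mul_div_assoc]

theorem gaugePhase_inv (u : ℕ+ → Circle) (m : MultiIndex) :
    gaugePhase (fun k => (u k)⁻¹) m = (gaugePhase u m)⁻¹ := by
  simp [gaugePhase, Finsupp.prod]

theorem gauge_adjoint (u : ℕ+ → Circle) (v w : Fock) :
    ⟪gauge u v, w⟫_ℂ = ⟪v, gauge (fun k => (u k)⁻¹) w⟫_ℂ := by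
  rw [gauge, lpOp_refl_adjoint _ (A' := ContinuousLinearMap.id ℂ ℂ) (fun _ _ => rfl), gauge]
  rw [show (fun m => (gaugePhase u m)⁻¹) = gaugePhase fun k => (u k)⁻¹ from
    funext fun m => (gaugePhase_inv u m).symm]

/-- Gauge transformations separate the monomials. -/
theorem exists_gaugePhase_ne {m m' : MultiIndex} (h : m ≠ m') :
    ∃ u, gaugePhase u m ≠ gaugePhase u m' := by
  classical
  obtain ⟨k, hk⟩ := Finsupp.ne_iff.1 h
  obtain ⟨z, hz⟩ := exists_zpow_ne (a := m k) (b := m' k) (by exact_mod_cast hk)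
  have h1 : ∀ m : MultiIndex, gaugePhase (Function.update 1 k z) m = z ^ m k := fun m => by
    rw [gaugePhase, Finsupp.prod, Finset.prod_eq_single k]
    · simp
    · intro j _ hj; simp [hj]
    · intro hk; simp [Finsupp.notMem_support_iff.1 hk]
  refine ⟨Function.update 1 k z, ?_⟩
  rw [h1, h1]; exact_mod_cast hz

theorem dense_span_coherent :
    Dense (Submodule.span ℂ (Set.range coherent) : Set Fock) := by
  classical
  set W := (Submodule.span ℂ (Set.range coherent)).topologicalClosure with hW
  have hmem : ∀ β, coherent β ∈ W := fun β =>
    Submodule.le_topologicalClosure _ (Submodule.subset_span ⟨β, rfl⟩)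
  have hinv : ∀ u, ∀ w ∈ W, gauge u w ∈ W := fun u w hw => by
    refine map_mem_closure (gauge u).continuous hw fun x hx => ?_
    have h3 : Submodule.span ℂ (Set.range coherent) ≤
        (Submodule.span ℂ (Set.range coherent)).comap (gauge u).toLinearMap :=
      Submodule.span_le.2 (by
        rintro _ ⟨β, rfl⟩
        exact Submodule.subset_span ⟨gaugeOne u β, (gauge_coherent u β).symm⟩)
    exact h3 hx
  have hcomm : ∀ u x, W.starProjection (gauge u x) = gauge u (W.starProjection x) := fun u =>
    starProjection_comm W (gauge_adjoint u) (hinv u) (hinv _)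
  have hdiag : ∀ m : MultiIndex, W.starProjection (lp.single 2 m 1) =
      (W.starProjection (lp.single 2 m 1) m) • lp.single 2 m (1 : ℂ) := fun m => by
    refine lp.ext (funext fun m' => ?_)
    rw [lp.coeFn_smul, Pi.smul_apply]
    by_cases h : m' = m
    · subst h; simp
    · rw [lp.single_apply_ne _ _ _ h, smul_zero]
      obtain ⟨u, hu⟩ := exists_gaugePhase_ne h
      have h1 : gauge u (lp.single 2 m 1) = (gaugePhase u m : ℂ) • lp.single 2 m (1 : ℂ) :=
        lpOp_single _ _ _ _ _
      have h2 := congrArg (fun v : Fock => v m') (hcomm u (lp.single 2 m 1))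
      simp only [h1, map_smul, gauge_apply] at h2
      rw [lp.coeFn_smul, Pi.smul_apply, smul_eq_mul, ← sub_eq_zero, ← sub_mul] at h2
      refine (mul_eq_zero.1 h2).resolve_left (sub_ne_zero.2 fun e => hu (Circle.ext e.symm))
  have hbasis : ∀ m : MultiIndex, lp.single 2 m (1 : ℂ) ∈ W := fun m => by
    by_contra hne
    have h0 : W.starProjection (lp.single 2 m 1) m = 0 := by
      by_contra h
      refine hne ?_
      have h1 := W.smul_mem (W.starProjection (lp.single 2 m 1) m)⁻¹
        (W.starProjection_apply_mem (lp.single 2 m 1))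
      rw [hdiag m, smul_smul] at h1
      simpa [h] using h1
    have h1 := hdiag m
    rw [h0, zero_smul] at h1
    set β : OneParticle := ∑ k ∈ m.support, lp.single 2 k (1 : ℂ)
    have hβ : ∀ k ∈ m.support, β k = 1 := fun k hk => by
      simp only [β, lp.coeFn_sum, Finset.sum_apply, lp.single_apply]
      rw [Finset.sum_eq_single k]
      · simp
      · intro j _ hj; simp [hj.symm]
      · exact fun h => absurd hk h
    have h2 := W.starProjection_inner_eq_zero (lp.single 2 m 1) (coherent β) (hmem β)
    rw [h1, sub_zero, lp.inner_single_left, RCLike.inner_apply, coherent_apply, coherentCoeff,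
      map_one, mul_one, Finsupp.prod, Finset.prod_eq_zero_iff] at h2
    obtain ⟨k, hk, hk'⟩ := h2
    rw [hβ k hk, one_pow, div_eq_zero_iff] at hk'
    rcases hk' with hk' | hk'
    · exact one_ne_zero hk'
    · exact absurd hk' (by exact_mod_cast (Real.sqrt_pos.2 (by positivity)).ne')
  intro v
  have h2 := lp.hasSum_single (p := 2) (by norm_num) v
  have h3 : v ∈ W := by
    refine (Submodule.isClosed_topologicalClosure _).mem_of_tendsto h2
      (Eventually.of_forall fun s => Submodule.sum_mem _ fun m _ => ?_)
    have h4 := W.smul_mem (v m) (hbasis m)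
    rwa [← lp.single_smul, smul_eq_mul, mul_one] at h4
  exact h3

theorem denseRange_linearCombination_coherent :
    DenseRange (Finsupp.linearCombination ℂ coherent) := by
  have h := dense_span_coherent
  rw [← Finsupp.range_linearCombination] at h
  exact h

/-- Linear combinations of two families with the same Gram matrix have the same norm. -/
theorem norm_linearCombination_eq {ι H F : Type*} [NormedAddCommGroup H] [InnerProductSpace ℂ H]
    [NormedAddCommGroup F] [InnerProductSpace ℂ F] {v : ι → H} {w : ι → F}
    (h : ∀ i j, ⟪v i, v j⟫_ℂ = ⟪w i, w j⟫_ℂ) (x : ι →₀ ℂ) :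
    ‖Finsupp.linearCombination ℂ v x‖ = ‖Finsupp.linearCombination ℂ w x‖ := by
  have h1 : ⟪Finsupp.linearCombination ℂ v x, Finsupp.linearCombination ℂ v x⟫_ℂ =
      ⟪Finsupp.linearCombination ℂ w x, Finsupp.linearCombination ℂ w x⟫_ℂ := by
    simp only [Finsupp.linearCombination_apply, Finsupp.sum, sum_inner, inner_sum,
      inner_smul_left, inner_smul_right, h]
  rw [@norm_eq_sqrt_re_inner ℂ, @norm_eq_sqrt_re_inner ℂ F, h1]

theorem weyl_bound (α : OneParticle) (x : OneParticle →₀ ℂ) :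
    ‖Finsupp.linearCombination ℂ (fun β : OneParticle =>
      Complex.exp (-(‖α‖ ^ 2 / 2 : ℝ) - inner ℂ α β) • coherent (α + β)) x‖ =
      ‖Finsupp.linearCombination ℂ coherent x‖ := by
  refine norm_linearCombination_eq (fun β γ => ?_) x
  rw [inner_smul_left, inner_smul_right, inner_coherent, inner_coherent, ← Complex.exp_conj,
    ← Complex.exp_add, ← Complex.exp_add, map_sub, map_neg, Complex.conj_ofReal, inner_conj_symm,
    inner_add_left, inner_add_right, inner_add_right, inner_self_eq_norm_sq_to_K]
  congr 1
  simp only [Complex.coe_algebraMap]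
  push_cast
  ring

theorem weyl_coherent (α β : OneParticle) : weyl α (coherent β) =
    Complex.exp (-(‖α‖ ^ 2 / 2 : ℝ) - ⟪α, β⟫_ℂ) • coherent (α + β) := by
  have h : coherent β = Finsupp.linearCombination ℂ coherent (Finsupp.single β 1) := by simp
  rw [h, weyl, LinearMap.extendOfNorm_eq denseRange_linearCombination_coherent
    ⟨1, fun x => by rw [one_mul]; exact (weyl_bound α x).le⟩, Finsupp.linearCombination_single,
    one_smul]

theorem weyl_norm (α : OneParticle) (v : Fock) : ‖weyl α v‖ = ‖v‖ := by
  refine denseRange_linearCombination_coherent.induction_on (p := fun v => ‖weyl α v‖ = ‖v‖) v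
    (isClosed_eq (weyl α).continuous.norm continuous_norm) fun x => ?_
  rw [weyl, LinearMap.extendOfNorm_eq denseRange_linearCombination_coherent
    ⟨1, fun x => by rw [one_mul]; exact (weyl_bound α x).le⟩, weyl_bound]

theorem weyl_mul (α β : OneParticle) (v : Fock) :
    weyl α (weyl β v) = (Circle.exp (-(⟪α, β⟫_ℂ).im) : ℂ) • weyl (α + β) v := by
  have h : (weyl α).comp (weyl β) = (Circle.exp (-(⟪α, β⟫_ℂ).im) : ℂ) • weyl (α + β) := by
    refine clm_ext_of_dense dense_span_coherent ?_
    rintro _ ⟨γ, rfl⟩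
    rw [ContinuousLinearMap.comp_apply, _root_.smul_apply, weyl_coherent, map_smul,
      weyl_coherent, weyl_coherent, smul_smul, smul_smul, ← Complex.exp_add, Circle.coe_exp,
      ← Complex.exp_add, add_assoc]
    congr 2
    have h1 : ‖α + β‖ ^ 2 = ‖α‖ ^ 2 + 2 * (⟪α, β⟫_ℂ).re + ‖β‖ ^ 2 :=
      norm_add_sq (𝕜 := ℂ) α β
    rw [h1, inner_add_right, inner_add_left]
    have h2 := Complex.re_add_im ⟪α, β⟫_ℂ
    push_cast
    linear_combination h2
  exact congrArg (fun A : Fock →L[ℂ] Fock => A v) h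

theorem coherent_zero_smul_weyl (β : OneParticle) :
    coherent β = Complex.exp ((‖β‖ ^ 2 / 2 : ℝ)) • weyl β (coherent 0) := by
  rw [weyl_coherent, smul_smul, ← Complex.exp_add, inner_zero_right, add_zero]
  simp

theorem weyl_zero : weyl 0 = ContinuousLinearMap.id ℂ Fock := by
  refine clm_ext_of_dense dense_span_coherent ?_
  rintro _ ⟨γ, rfl⟩
  rw [weyl_coherent]; simp

theorem weyl_adjoint (α : OneParticle) (v w : Fock) : ⟪weyl α v, w⟫_ℂ = ⟪v, weyl (-α) w⟫_ℂ := by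
  have h1 : weyl α (weyl (-α) w) = w := by
    rw [weyl_mul, inner_neg_right, Complex.neg_im, add_neg_cancel, weyl_zero]
    have h2 : (⟪α, α⟫_ℂ).im = 0 := inner_self_im (𝕜 := ℂ) α
    rw [h2]; simp
  have h2 := (⟨(weyl α).toLinearMap, weyl_norm α⟩ : Fock →ₗᵢ[ℂ] Fock).inner_map_map v (weyl (-α) w)
  rw [← h2]
  exact congrArg (fun x => ⟪weyl α v, x⟫_ℂ) h1.symm

theorem continuous_coherent : Continuous coherent := by
  have h1 : ∀ α β : OneParticle, ‖coherent α - coherent β‖ ^ 2 =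
      (Complex.exp ⟪α, α⟫_ℂ).re - 2 * (Complex.exp ⟪α, β⟫_ℂ).re + (Complex.exp ⟪β, β⟫_ℂ).re :=
    fun α β => by
      have h3 : ∀ γ, ‖coherent γ‖ ^ 2 = (Complex.exp ⟪γ, γ⟫_ℂ).re := fun γ => by
        rw [← inner_coherent]; exact norm_sq_eq_re_inner (𝕜 := ℂ) _
      have h2 := norm_sub_sq (𝕜 := ℂ) (coherent α) (coherent β)
      rw [inner_coherent, h3, h3] at h2
      rw [h2]; rfl
  rw [continuous_iff_continuousAt]
  intro β
  rw [ContinuousAt, tendsto_iff_norm_sub_tendsto_zero]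
  have h2 : Continuous fun α : OneParticle => (Complex.exp ⟪α, α⟫_ℂ).re -
      2 * (Complex.exp ⟪α, β⟫_ℂ).re + (Complex.exp ⟪β, β⟫_ℂ).re := by fun_prop
  have h3 := h2.tendsto β
  simp only [← h1, sub_self, norm_zero] at h3
  have h4 := (Real.continuous_sqrt.tendsto _).comp h3
  simpa [Function.comp_def, Real.sqrt_sq (norm_nonneg _)] using h4

theorem weyl_continuous (v : Fock) : Continuous fun α => weyl α v := by
  refine continuous_apply_of_dense (fun α v => (weyl_norm α v).le) dense_span_coherent ?_ v
  rintro _ ⟨β, rfl⟩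
  simp only [weyl_coherent]
  have h : Continuous fun α : OneParticle => coherent (α + β) :=
    continuous_coherent.comp (continuous_add_const β)
  fun_prop

theorem gauge_weyl (u : ℕ+ → Circle) (α : OneParticle) (v : Fock) :
    gauge u (weyl α v) = weyl (gaugeOne u α) (gauge u v) := by
  have h : (gauge u).comp (weyl α) = (weyl (gaugeOne u α)).comp (gauge u) := by
    refine clm_ext_of_dense dense_span_coherent ?_
    rintro _ ⟨γ, rfl⟩
    have h1 := (⟨(gaugeOne u).toLinearMap, gaugeOne_norm u⟩ :
      OneParticle →ₗᵢ[ℂ] OneParticle).inner_map_map α γ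
    change ⟪gaugeOne u α, gaugeOne u γ⟫_ℂ = _ at h1
    rw [ContinuousLinearMap.comp_apply, ContinuousLinearMap.comp_apply, gauge_coherent,
      weyl_coherent, weyl_coherent, map_smul, gauge_coherent, gaugeOne_norm, h1, map_add]
  exact congrArg (fun A : Fock →L[ℂ] Fock => A v) h

theorem coherentCoeff_smul (t : ℂ) (γ : OneParticle) (m : MultiIndex) :
    coherentCoeff (t • γ : OneParticle) m = t ^ m.degree * coherentCoeff γ m := by
  rw [coherentCoeff, coherentCoeff, Finsupp.prod, Finsupp.prod, Finsupp.degree_apply,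
    ← Finset.prod_pow_eq_pow_sum, ← Finset.prod_mul_distrib]
  refine Finset.prod_congr rfl fun k _ => ?_
  rw [lp.coeFn_smul, Pi.smul_apply, smul_eq_mul, mul_pow, mul_div_assoc]

/-- Exponential vectors depend holomorphically on their argument. -/
theorem differentiable_inner_coherent (u : Fock) (γ : OneParticle) :
    Differentiable ℂ fun t : ℂ => ⟪u, coherent (t • γ)⟫_ℂ := by
  intro t₀
  set R : ℝ := ‖t₀‖ + 1
  have hR : 0 ≤ R := by positivity
  have h1 : Summable fun m => ‖u m‖ * ‖coherentCoeff ((R : ℂ) • γ : OneParticle) m‖ := by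
    refine (lp.summable_inner (𝕜 := ℂ) u (coherent ((R : ℂ) • γ))).norm.congr fun m => ?_
    rw [RCLike.inner_apply, norm_mul, RCLike.norm_conj, mul_comm]; rfl
  have h2 : DifferentiableOn ℂ (fun t : ℂ =>
      ∑' m, conj (u m) * (t ^ m.degree * coherentCoeff γ m)) (Metric.ball 0 R) := by
    refine Complex.differentiableOn_tsum_of_summable_norm h1
      (fun m => Differentiable.differentiableOn (by fun_prop)) Metric.isOpen_ball fun m t ht => ?_
    rw [mem_ball_zero_iff] at ht
    rw [coherentCoeff_smul, norm_mul, norm_mul, norm_mul, RCLike.norm_conj, norm_pow, norm_pow,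
      Complex.norm_real, Real.norm_of_nonneg hR]
    gcongr
  have h3 : (fun t : ℂ => ⟪u, coherent (t • γ)⟫_ℂ) = fun t : ℂ =>
      ∑' m, conj (u m) * (t ^ m.degree * coherentCoeff γ m) := funext fun t => by
    rw [lp.inner_eq_tsum]
    refine tsum_congr fun m => ?_
    rw [RCLike.inner_apply, coherent_apply, coherentCoeff_smul, mul_comm]
  rw [h3]
  refine h2.differentiableAt (Metric.isOpen_ball.mem_nhds ?_)
  rw [mem_ball_zero_iff]; simp [R]

/-- A function that is holomorphic and antiholomorphic is constant. -/
theorem eq_of_differentiable_of_conj {f g : ℂ → ℂ} (hf : Differentiable ℂ f)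
    (hg : Differentiable ℂ g) (h : ∀ z, f z = conj (g z)) (z w : ℂ) : f z = f w := by
  refine is_const_of_deriv_eq_zero hf (fun z => ?_) z w
  have h1 : ∀ v : ℂ, deriv f z * v = conj (deriv g z * v) := fun v => by
    have hl : HasDerivAt (fun s : ℝ => z + (s : ℂ) * v) v 0 := by
      simpa using ((Complex.ofRealCLM.hasDerivAt (x := (0 : ℝ))).mul_const v).const_add z
    have hf' : HasDerivAt f (deriv f z) (z + ((0 : ℝ) : ℂ) * v) := by
      simpa using (hf z).hasDerivAt
    have hg' : HasDerivAt g (deriv g z) (z + ((0 : ℝ) : ℂ) * v) := by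
      simpa using (hg z).hasDerivAt
    have h2 := HasDerivAt.comp (0 : ℝ) hf' hl
    have h3 := (HasDerivAt.comp (0 : ℝ) hg' hl).star_conj
    refine h2.unique (h3.congr_of_eventuallyEq (Eventually.of_forall fun s => ?_))
    exact h _
  have h2 := h1 1
  have h3 := h1 Complex.I
  rw [mul_one, mul_one] at h2
  rw [map_mul, ← h2, Complex.conj_I] at h3
  have h4 : deriv f z * (2 * Complex.I) = 0 := by linear_combination h3
  simpa using h4

/-- Schur's lemma for the Weyl operators. -/
theorem weyl_schur {A : Fock →L[ℂ] Fock} (hA : ∀ α v, A (weyl α v) = weyl α (A v)) :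
    ∃ c : ℂ, ∀ v, A v = c • v := by
  set Ω := coherent 0
  have hK : ∀ α β, ⟪coherent α, A (coherent β)⟫_ℂ =
      Complex.exp ⟪α, β⟫_ℂ * ⟪coherent (α - β), A Ω⟫_ℂ := fun α β => by
    rw [coherent_zero_smul_weyl β, map_smul, hA, inner_smul_right, ← inner_conj_symm,
      weyl_adjoint, inner_conj_symm, weyl_coherent, inner_smul_left, ← Complex.exp_conj, ← mul_assoc,
      ← Complex.exp_add, neg_add_eq_sub, norm_neg, map_sub, map_neg, Complex.conj_ofReal,
      inner_conj_symm, inner_neg_right]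
    congr 2
    ring
  have hc : ∀ γ, ⟪coherent γ, A Ω⟫_ℂ = ⟪Ω, A Ω⟫_ℂ := fun γ => by
    have h1 := eq_of_differentiable_of_conj
      (f := fun t : ℂ => ⟪ContinuousLinearMap.adjoint A Ω, coherent (t • γ)⟫_ℂ)
      (g := fun t : ℂ => ⟪A Ω, coherent (t • (-γ))⟫_ℂ)
      (differentiable_inner_coherent _ _) (differentiable_inner_coherent _ _) (fun t => by
        rw [ContinuousLinearMap.adjoint_inner_left, hK, inner_zero_left, Complex.exp_zero, one_mul,
          zero_sub, inner_conj_symm, smul_neg]) (-1) 0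
    simp only [ContinuousLinearMap.adjoint_inner_left] at h1
    rw [zero_smul, hK] at h1
    simpa using h1
  refine ⟨⟪Ω, A Ω⟫_ℂ, fun v => ?_⟩
  have h : A = ⟪Ω, A Ω⟫_ℂ • ContinuousLinearMap.id ℂ Fock := by
    refine clm_ext_of_dense dense_span_coherent ?_
    rintro _ ⟨β, rfl⟩
    rw [_root_.smul_apply, ContinuousLinearMap.id_apply]
    have h2 : innerSL ℂ (A (coherent β)) = innerSL ℂ (⟪Ω, A Ω⟫_ℂ • coherent β) := by
      refine clm_ext_of_dense dense_span_coherent ?_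
      rintro _ ⟨α, rfl⟩
      rw [innerSL_apply_apply, innerSL_apply_apply, ← inner_conj_symm, hK, hc, ← inner_coherent,
        inner_smul_left, map_mul, inner_conj_symm, mul_comm]
    exact (innerSL_inj (𝕜 := ℂ)).1 h2
  exact congrArg (fun B : Fock →L[ℂ] Fock => B v) h

/-- The `j`-th derivative of a loop. -/
noncomputable def LoopGp.der (j : ℕ) (l : LoopGp) (θ : ℝ) : ℂ := iteratedDeriv j (fun θ => (l θ : ℂ)) θ

namespace LoopGp

theorem der_zero (l : LoopGp) (θ : ℝ) : l.der 0 θ = l θ := by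
  simp [der, iteratedDeriv_zero]

theorem continuous_der (j : ℕ) : Continuous fun p : LoopGp × ℝ => p.1.der j p.2 := by
  have h1 : Continuous fun (l : LoopGp) (j : ℕ) =>
      (⟨iteratedDeriv j (fun θ => (l θ : ℂ)),
        l.smooth'.continuous_iteratedDeriv j (mod_cast le_top)⟩ : C(ℝ, ℂ)) :=
    continuous_induced_dom
  have h2 := (continuous_apply j).comp h1
  exact ContinuousEval.continuous_eval.comp (h2.prodMap continuous_id)

theorem continuous_of_der {X : Type*} [TopologicalSpace X] {g : X → LoopGp}
    (h : ∀ j, Continuous fun p : X × ℝ => (g p.1).der j p.2) : Continuous g :=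
  continuous_induced_rng.2 (continuous_pi fun j =>
    ContinuousMap.continuous_of_continuous_uncurry _ (h j))

theorem hasDerivAt_der (l : LoopGp) (j : ℕ) (θ : ℝ) : HasDerivAt (l.der j) (l.der (j + 1) θ) θ := by
  have h1 : ContDiff ℝ ((1 + j : ℕ) : WithTop ℕ∞) (fun θ => (l θ : ℂ)) :=
    l.smooth'.of_le (mod_cast le_top)
  have h0 := ContDiff.iterate_deriv' 1 j h1
  rw [← iteratedDeriv_eq_iterate] at h0
  have h2 := (h0.differentiable (by simp)).differentiableAt (x := θ) |>.hasDerivAt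
  rwa [← iteratedDeriv_succ] at h2

theorem der_mul (a b : LoopGp) (j : ℕ) (θ : ℝ) : (a * b).der j θ =
    ∑ i ∈ Finset.range (j + 1), (j.choose i : ℂ) * a.der i θ * b.der (j - i) θ := by
  have ha : ContDiffWithinAt ℝ j (fun θ => (a θ : ℂ)) Set.univ θ :=
    ((a.smooth'.of_le (mod_cast le_top)).contDiffAt).contDiffWithinAt
  have hb : ContDiffWithinAt ℝ j (fun θ => (b θ : ℂ)) Set.univ θ :=
    ((b.smooth'.of_le (mod_cast le_top)).contDiffAt).contDiffWithinAt
  have h := iteratedDerivWithin_mul (Set.mem_univ θ) uniqueDiffOn_univ ha hb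
  simp only [iteratedDerivWithin_univ] at h
  exact h

theorem der_inv (a : LoopGp) (j : ℕ) (θ : ℝ) : (a⁻¹).der j θ = conj (a.der j θ) := by
  induction j generalizing θ with
  | zero => rw [der_zero, der_zero, inv_apply, Circle.coe_inv_eq_conj]
  | succ j ih =>
    have h1 := (a.hasDerivAt_der j θ).star_conj
    refine ((a⁻¹).hasDerivAt_der j θ).unique (h1.congr_of_eventuallyEq (Eventually.of_forall ?_))
    exact ih

instance : IsTopologicalGroup LoopGp where
  continuous_mul := continuous_of_der fun j => by
    simp only [der_mul]
    have h1 : ∀ i, Continuous fun p : (LoopGp × LoopGp) × ℝ => p.1.1.der i p.2 := fun i =>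
      (continuous_der i).comp ((continuous_fst.comp continuous_fst).prodMk continuous_snd)
    have h2 : ∀ i, Continuous fun p : (LoopGp × LoopGp) × ℝ => p.1.2.der i p.2 := fun i =>
      (continuous_der i).comp ((continuous_snd.comp continuous_fst).prodMk continuous_snd)
    exact continuous_finsetSum _ fun i _ => (continuous_const.mul (h1 i)).mul (h2 _)
  continuous_inv := continuous_of_der fun j => by
    simp only [der_inv]
    exact Complex.continuous_conj.comp (continuous_der j)

theorem continuous_const_loop : Continuous fun t : Circle => ofCoord t 0 0 := by
  have h0 : ∀ t θ, (ofCoord t 0 0) θ = t := fun t θ => by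
    show t * Circle.exp (-(((0 : ℤ) : ℝ) * θ)) * Circle.exp (((0 : U) : ℝ → ℝ) θ) = t
    simp
  refine continuous_of_der fun j => ?_
  simp only [der, h0, iteratedDeriv_const]
  by_cases hj : j = 0
  · simp only [hj, if_true]; exact continuous_subtype_val.comp continuous_fst
  · simp only [hj, if_false]; exact continuous_const

theorem f_hasDerivAt (l : LoopGp) (θ : ℝ) : HasDerivAt (l.f : ℝ → ℝ) (deriv (l.f : ℝ → ℝ) θ) θ :=
  (l.f.smooth.differentiable (by simp)).differentiableAt.hasDerivAt

theorem continuous_deriv_f (l : LoopGp) : Continuous (deriv (l.f : ℝ → ℝ)) :=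
  (contDiff_infty_iff_deriv.1 l.f.smooth).2.continuous

theorem apply_eq (l : LoopGp) (θ : ℝ) :
    (l θ : ℂ) = l.t * Complex.exp (((l.f : ℝ → ℝ) θ - l.n * θ : ℝ) * Complex.I) := by
  have h1 : l θ = l.t * Circle.exp (-(l.n * θ)) * Circle.exp ((l.f : ℝ → ℝ) θ) :=
    congrFun (congrArg LoopGp.toFun (ofCoord_eq l).symm) θ
  rw [h1, mul_assoc, ← Circle.exp_add, Circle.coe_mul, Circle.coe_exp]
  congr 4; ring

theorem conj_mul_self (l : LoopGp) (θ : ℝ) : conj (l.der 0 θ) * l.der 0 θ = 1 := by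
  rw [der_zero, mul_comm, Complex.mul_conj, Circle.normSq_coe]; simp

theorem der_one (l : LoopGp) (θ : ℝ) :
    l.der 1 θ = ((deriv (l.f : ℝ → ℝ) θ - l.n : ℝ) : ℂ) * Complex.I * l.der 0 θ := by
  have h1 := ((((l.f_hasDerivAt θ).sub ((hasDerivAt_id θ).const_mul (l.n : ℝ))).ofReal_comp.mul_const
      Complex.I).cexp).const_mul (l.t : ℂ)
  refine (l.hasDerivAt_der 0 θ).unique ((h1.congr_of_eventuallyEq
    (Eventually.of_forall fun θ => ?_)).congr_deriv ?_)
  · rw [der_zero, apply_eq]; rfl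
  · rw [der_zero, apply_eq]; simp only [Pi.sub_apply, id, mul_one]; ring

theorem deriv_f (l : LoopGp) (θ : ℝ) :
    deriv (l.f : ℝ → ℝ) θ = (conj (l.der 0 θ) * l.der 1 θ).im + l.n := by
  rw [der_one, mul_left_comm, conj_mul_self, mul_one]
  simp

theorem deriv_deriv_f (l : LoopGp) (θ : ℝ) :
    deriv (deriv (l.f : ℝ → ℝ)) θ = (conj (l.der 0 θ) * l.der 2 θ).im := by
  have h1 : HasDerivAt (fun θ => conj (l.der 0 θ) * l.der 1 θ)
      (conj (l.der 1 θ) * l.der 1 θ + conj (l.der 0 θ) * l.der 2 θ) θ :=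
    (l.hasDerivAt_der 0 θ).star_conj.mul (l.hasDerivAt_der 1 θ)
  have h2 := (Complex.imCLM.hasFDerivAt.comp_hasDerivAt θ h1).add_const (l.n : ℝ)
  rw [show deriv (l.f : ℝ → ℝ) = fun θ => (conj (l.der 0 θ) * l.der 1 θ).im + l.n from
    funext l.deriv_f]
  refine h2.deriv.trans ?_
  simp only [Complex.imCLM_apply, Complex.add_im, Complex.mul_im, Complex.conj_re, Complex.conj_im]
  ring

theorem integral_deriv_f (l : LoopGp) : ∫ θ in (0 : ℝ)..2 * π, deriv (l.f : ℝ → ℝ) θ = 0 := by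
  rw [intervalIntegral.integral_eq_sub_of_hasDerivAt (fun θ _ => l.f_hasDerivAt θ)
    (l.continuous_deriv_f.intervalIntegrable _ _)]
  have := l.f.periodic 0
  rw [zero_add] at this
  rw [this, sub_self]

theorem integral_mul_deriv_f (l : LoopGp) :
    ∫ θ in (0 : ℝ)..2 * π, θ * deriv (l.f : ℝ → ℝ) θ = 2 * π * (l.f : ℝ → ℝ) 0 := by
  rw [intervalIntegral.integral_mul_deriv_eq_deriv_mul (u := fun θ => θ) (u' := fun _ => 1)
    (fun θ _ => hasDerivAt_id θ) (fun θ _ => l.f_hasDerivAt θ)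
    (continuous_const.intervalIntegrable _ _) (l.continuous_deriv_f.intervalIntegrable _ _)]
  have := l.f.periodic 0
  rw [zero_add] at this
  simp only [one_mul, l.f.mean, this]
  ring

theorem continuous_logDeriv (j : ℕ) :
    Continuous fun p : LoopGp × ℝ => (conj (p.1.der 0 p.2) * p.1.der j p.2).im :=
  Complex.continuous_im.comp ((Complex.continuous_conj.comp (continuous_der 0)).mul
    (continuous_der j))

theorem continuous_n : Continuous LoopGp.n := by
  have h1 : ∀ l : LoopGp, (l.n : ℝ) =
      -(2 * π)⁻¹ * ∫ θ in (0 : ℝ)..2 * π, (conj (l.der 0 θ) * l.der 1 θ).im := fun l => by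
    have h2 : ∀ θ, (conj (l.der 0 θ) * l.der 1 θ).im = deriv (l.f : ℝ → ℝ) θ - l.n := fun θ => by
      rw [deriv_f]; ring
    simp only [h2]
    rw [intervalIntegral.integral_sub (l.continuous_deriv_f.intervalIntegrable _ _)
      (continuous_const.intervalIntegrable _ _), integral_deriv_f,
      intervalIntegral.integral_const, smul_eq_mul]
    have := Real.pi_pos
    field_simp
    ring
  rw [Int.isClosedEmbedding_coe_real.isInducing.continuous_iff]
  have h3 : Continuous fun l : LoopGp => -(2 * π)⁻¹ *
      ∫ θ in (0 : ℝ)..2 * π, (conj (l.der 0 θ) * l.der 1 θ).im :=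
    continuous_const.mul (intervalIntegral.continuous_parametric_intervalIntegral_of_continuous'
      (f := fun (l : LoopGp) θ => (conj (l.der 0 θ) * l.der 1 θ).im) (continuous_logDeriv 1) _ _)
  exact h3.congr fun l => (h1 l).symm

theorem continuous_deriv_f_uncurry :
    Continuous fun p : LoopGp × ℝ => deriv (p.1.f : ℝ → ℝ) p.2 := by
  simp only [deriv_f]
  exact (continuous_logDeriv 1).add
    ((continuous_of_discreteTopology (f := fun n : ℤ => (n : ℝ))).comp
      (continuous_n.comp continuous_fst))

theorem continuous_t : Continuous LoopGp.t := by
  have h1 : Continuous fun l : LoopGp => (l.f : ℝ → ℝ) 0 := by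
    have h2 : Continuous fun l : LoopGp => (2 * π)⁻¹ *
        ∫ θ in (0 : ℝ)..2 * π, θ * deriv (l.f : ℝ → ℝ) θ :=
      continuous_const.mul (intervalIntegral.continuous_parametric_intervalIntegral_of_continuous'
        (f := fun (l : LoopGp) θ => θ * deriv (l.f : ℝ → ℝ) θ)
        (continuous_snd.mul continuous_deriv_f_uncurry) _ _)
    refine h2.congr fun l => ?_
    rw [integral_mul_deriv_f, inv_mul_cancel_left₀ (by positivity)]
  have h3 : Continuous fun l : LoopGp => l 0 := by
    refine continuous_induced_rng.2 ?_
    have := (continuous_der 0).comp (continuous_id.prodMk continuous_const : Continuous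
      fun l : LoopGp => (l, (0 : ℝ)))
    exact this.congr fun l => l.der_zero 0
  have h4 : Continuous fun l : LoopGp => l 0 * Circle.exp (-(l.f : ℝ → ℝ) 0) :=
    h3.mul (Circle.exp.continuous.comp h1.neg)
  refine h4.congr fun l => ?_
  have h5 : l 0 = l.t * Circle.exp (-(l.n * 0)) * Circle.exp ((l.f : ℝ → ℝ) 0) :=
    congrFun (congrArg LoopGp.toFun (ofCoord_eq l).symm) 0
  rw [h5, mul_zero, neg_zero, Circle.exp_zero, mul_one, Circle.exp_neg, mul_inv_cancel_right]

theorem ofCoord_one_n_f (l : LoopGp) : ofCoord 1 l.n l.f = (ofCoord l.t 0 0)⁻¹ * l := by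
  rw [eq_inv_mul_iff_mul_eq, ofCoord_mul, mul_one, zero_add, zero_add, ofCoord_eq]

theorem continuous_ofCoord_one_n_f : Continuous fun l : LoopGp => ofCoord 1 l.n l.f := by
  simp only [ofCoord_one_n_f]
  exact (continuous_const_loop.comp continuous_t).inv.mul continuous_id

end LoopGp

end BorelWeilLT

namespace BorelWeilLT
open Filter Topology MeasureTheory
open scoped InnerProductSpace ComplexConjugate

/-- Parseval's identity for continuous `2π`-periodic real functions. -/
theorem hasSum_parseval {F G : ℝ → ℝ} (hF : Continuous F) (hG : Continuous G)
    (hF' : ∀ θ, F (θ + 2 * π) = F θ) (hG' : ∀ θ, G (θ + 2 * π) = G θ) :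
    HasSum (fun n : ℤ => conj (∫ θ in (0 : ℝ)..2 * π, (F θ : ℂ) * Complex.exp (-(n * θ * Complex.I)))
        * ∫ θ in (0 : ℝ)..2 * π, (G θ : ℂ) * Complex.exp (-(n * θ * Complex.I)))
      ((2 * π * ∫ θ in (0 : ℝ)..2 * π, F θ * G θ : ℝ) : ℂ) := by
  have : Fact (0 < 2 * π) := ⟨Real.two_pi_pos⟩
  have hpi := Real.pi_pos
  have hlift : ∀ H : ℝ → ℝ, Continuous H → (∀ θ, H (θ + 2 * π) = H θ) →
      ∃ L : C(AddCircle (2 * π), ℂ), ∀ θ : ℝ, L θ = (H θ : ℂ) := fun H hH hH' => by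
    have hp : Function.Periodic (fun θ => (H θ : ℂ)) (2 * π) := fun θ => by simp only [hH']
    exact ⟨⟨hp.lift, continuous_coinduced_dom.2 (Complex.continuous_ofReal.comp hH)⟩,
      fun θ => hp.lift_coe θ⟩
  obtain ⟨f, hf⟩ := hlift F hF hF'
  obtain ⟨g, hg⟩ := hlift G hG hG'
  have hcoef : ∀ (H : ℝ → ℝ) (L : C(AddCircle (2 * π), ℂ)), (∀ θ : ℝ, L θ = (H θ : ℂ)) → ∀ n : ℤ,
      fourierCoeff L n = (2 * π : ℂ)⁻¹ *
        ∫ θ in (0 : ℝ)..2 * π, (H θ : ℂ) * Complex.exp (-(n * θ * Complex.I)) := fun H L hL n => by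
    rw [fourierCoeff_eq_intervalIntegral _ n 0, zero_add, Complex.real_smul]
    congr 1
    · push_cast; rw [one_div]
    · refine intervalIntegral.integral_congr fun θ _ => ?_
      simp only [fourier_coe_apply, hL, smul_eq_mul]
      rw [mul_comm]
      congr 2
      push_cast
      field_simp
  have h1 := (fourierBasis (T := 2 * π)).hasSum_inner_mul_inner
    (ContinuousMap.toLp 2 AddCircle.haarAddCircle ℂ f)
    (ContinuousMap.toLp 2 AddCircle.haarAddCircle ℂ g)
  have h2 : ⟪ContinuousMap.toLp 2 AddCircle.haarAddCircle ℂ f,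
      ContinuousMap.toLp 2 AddCircle.haarAddCircle ℂ g⟫_ℂ =
      (2 * π : ℂ)⁻¹ * ((∫ θ in (0 : ℝ)..2 * π, F θ * G θ : ℝ) : ℂ) := by
    rw [ContinuousMap.inner_toLp, AddCircle.integral_haarAddCircle,
      ← AddCircle.intervalIntegral_preimage (2 * π) 0, zero_add, Complex.real_smul,
      ← intervalIntegral.integral_ofReal]
    congr 1
    · push_cast; rfl
    · refine intervalIntegral.integral_congr fun θ _ => ?_
      simp only [hf, hg, Complex.conj_ofReal, Complex.ofReal_mul]
      ring
  rw [h2] at h1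
  have h3 := h1.mul_left ((2 * π : ℂ) ^ 2)
  have hne : (π : ℂ) ≠ 0 := by exact_mod_cast hpi.ne'
  convert! h3 using 1
  · funext n
    rw [← HilbertBasis.repr_apply_apply, fourierBasis_repr, ← inner_conj_symm,
      ← HilbertBasis.repr_apply_apply, fourierBasis_repr, fourierCoeff_toLp, fourierCoeff_toLp,
      hcoef F f hf, hcoef G g hg, map_mul, map_inv₀, map_mul, Complex.conj_ofReal]
    simp only [map_ofNat]
    generalize conj (∫ θ in (0 : ℝ)..2 * π, (F θ : ℂ) * Complex.exp (-(n * θ * Complex.I))) = A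
    generalize (∫ θ in (0 : ℝ)..2 * π, (G θ : ℂ) * Complex.exp (-(n * θ * Complex.I))) = B
    field_simp
  · push_cast
    field_simp

/-- The `k`-th Fourier coefficient, without normalization. -/
noncomputable def fourierInt (F : ℝ → ℝ) (n : ℤ) : ℂ :=
  ∫ θ in (0 : ℝ)..2 * π, (F θ : ℂ) * Complex.exp (-(n * θ * Complex.I))

/-- The normalization constant of `alphaCoeff`. -/
noncomputable def alphaConst (τ : Level) (k : ℕ+) : ℝ :=
  Real.sqrt (k / π) * (Real.sqrt τ.κ / (2 * π))

theorem alphaConst_sq (τ : Level) (k : ℕ+) : alphaConst τ k ^ 2 = τ.κ * k / (4 * π ^ 3) := by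
  have hκ : (0 : ℝ) ≤ τ.κ := by exact_mod_cast τ.κ_pos.le
  have hpi := Real.pi_pos
  rw [alphaConst, mul_pow, div_pow, Real.sq_sqrt (by positivity), Real.sq_sqrt hκ]
  field_simp
  ring

theorem alphaConst_ne_zero (τ : Level) (k : ℕ+) : alphaConst τ k ≠ 0 := by
  have hκ : (0 : ℝ) < τ.κ := by exact_mod_cast τ.κ_pos
  have hk : (0 : ℝ) < k := by exact_mod_cast k.pos
  have hpi := Real.pi_pos
  have h : 0 < alphaConst τ k ^ 2 := by rw [alphaConst_sq]; positivity
  exact fun h0 => by simp [h0] at h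

theorem alpha_apply (τ : Level) (f : U) (k : ℕ+) :
    alpha τ f k = -(alphaConst τ k : ℂ) * fourierInt f k := by
  simp only [alpha, alphaCoeff, fourierInt, alphaConst]
  rfl

theorem fourierInt_neg (F : ℝ → ℝ) (n : ℤ) : fourierInt F (-n) = conj (fourierInt F n) := by
  have hpi : (0 : ℝ) ≤ 2 * π := by positivity
  rw [fourierInt, fourierInt, intervalIntegral.integral_of_le hpi,
    intervalIntegral.integral_of_le hpi, ← integral_conj]
  rw [← intervalIntegral.integral_of_le hpi, ← intervalIntegral.integral_of_le hpi]
  refine intervalIntegral.integral_congr fun θ _ => ?_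
  simp only [map_mul, Complex.conj_ofReal, ← Complex.exp_conj, map_neg, Complex.conj_I, map_intCast]
  congr 2
  push_cast; ring

theorem fourierInt_add {F G : ℝ → ℝ} (hF : Continuous F) (hG : Continuous G) (n : ℤ) :
    fourierInt (F + G) n = fourierInt F n + fourierInt G n := by
  rw [fourierInt, fourierInt, fourierInt, ← intervalIntegral.integral_add
    (Continuous.intervalIntegrable (by fun_prop) _ _)
    (Continuous.intervalIntegrable (by fun_prop) _ _)]
  refine intervalIntegral.integral_congr fun θ _ => ?_
  simp only [Pi.add_apply, Complex.ofReal_add, add_mul]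

theorem fourierInt_deriv (f : U) (k : ℕ+) :
    fourierInt (deriv (f : ℝ → ℝ)) k = k * Complex.I * fourierInt f k := by
  have h := U.fourier_parts f f.smooth f.periodic k
  have hk : ((k : ℂ) * Complex.I) ≠ 0 := by simp
  simp only [fourierInt]
  rw [eq_inv_mul_iff_mul_eq₀ hk] at h
  exact_mod_cast h.symm

theorem U.deriv_periodic (f : U) (θ : ℝ) :
    deriv (f : ℝ → ℝ) (θ + 2 * π) = deriv (f : ℝ → ℝ) θ := by
  rw [← deriv_comp_add_const (f : ℝ → ℝ) (2 * π) θ]; simp only [f.periodic]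

theorem U.integral_deriv (f : U) : ∫ θ in (0 : ℝ)..2 * π, deriv (f : ℝ → ℝ) θ = 0 := by
  rw [intervalIntegral.integral_eq_sub_of_hasDerivAt
    (fun θ _ => (f.smooth.differentiable (by simp)).differentiableAt.hasDerivAt)
    ((contDiff_infty_iff_deriv.1 f.smooth).2.continuous.intervalIntegrable _ _)]
  have := f.periodic 0
  rw [zero_add] at this
  rw [this, sub_self]

/-- The cocycle of `ΩT₀` is that of the Weyl operators. -/
theorem omega_eq (τ : Level) (f g : U) : omega τ f g = -(⟪alpha τ f, alpha τ g⟫_ℂ).im := by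
  have hpi := Real.pi_pos
  have h1 := hasSum_parseval f.smooth.continuous
    (contDiff_infty_iff_deriv.1 g.smooth).2.continuous f.periodic g.deriv_periodic
  change HasSum (fun n : ℤ => conj (fourierInt f n) * fourierInt (deriv (g : ℝ → ℝ)) n) _ at h1
  have h0 : fourierInt (deriv (g : ℝ → ℝ)) 0 = 0 := by
    rw [fourierInt]
    simp [intervalIntegral.integral_ofReal, g.integral_deriv]
  have h2 := h1.nat_add_neg
  rw [h0, mul_zero, add_zero] at h2
  have h3 := (PNat.coe_injective.hasSum_iff (by
    intro n hn
    have : n = 0 := by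
      by_contra h
      exact hn ⟨⟨n, Nat.pos_of_ne_zero h⟩, rfl⟩
    subst this
    simp [h0])).2 h2
  have h4 := (Complex.hasSum_re h3).mul_left (τ.κ / (2 * π) ^ 2 * (2 * π)⁻¹)
  have h5 := (Complex.hasSum_im (lp.hasSum_inner (𝕜 := ℂ) (alpha τ f) (alpha τ g))).neg
  have h6 : τ.κ / (2 * π) ^ 2 * (2 * π)⁻¹ * (((2 * π * ∫ θ in (0 : ℝ)..2 * π,
      (f : ℝ → ℝ) θ * deriv (g : ℝ → ℝ) θ : ℝ) : ℂ)).re = omega τ f g := by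
    rw [Complex.ofReal_re, omega]; field_simp
  rw [h6] at h4
  refine h4.unique ?_
  convert! h5 using 1
  funext k
  symm
  have hc : alphaConst τ k ^ 2 = τ.κ / (2 * π) ^ 2 * (2 * π)⁻¹ * k * 2 := by
    rw [alphaConst_sq]; field_simp; ring
  simp only [Function.comp_apply, alpha_apply, RCLike.inner_apply]
  rw [show (((k : ℕ) : ℤ)) = ((k : ℕ+) : ℤ) from rfl, fourierInt_neg, fourierInt_neg,
    fourierInt_deriv]
  simp only [map_mul, map_neg, Complex.conj_ofReal, Complex.conj_conj, Complex.add_re,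
    Complex.mul_re, Complex.mul_im, Complex.neg_re, Complex.neg_im, Complex.ofReal_re,
    Complex.ofReal_im, Complex.conj_re, Complex.conj_im, Complex.I_re, Complex.I_im,
    Complex.natCast_re, Complex.natCast_im]
  linear_combination ((fourierInt f k).im * (fourierInt g k).re -
    (fourierInt f k).re * (fourierInt g k).im) * hc

theorem alpha_add (τ : Level) (f g : U) : alpha τ (f + g) = alpha τ f + alpha τ g := by
  refine lp.ext (funext fun k => ?_)
  rw [lp.coeFn_add, Pi.add_apply, alpha_apply, alpha_apply, alpha_apply, ← mul_add]
  exact congrArg _ (fourierInt_add f.smooth.continuous g.smooth.continuous k)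

/-- `f ↦ alpha τ f` as a homomorphism of groups. -/
noncomputable def alphaHom (τ : Level) : U →+ OneParticle := AddMonoidHom.mk' (alpha τ) (alpha_add τ)

theorem alpha_neg (τ : Level) (f : U) : alpha τ (-f) = -alpha τ f := map_neg (alphaHom τ) f

theorem alpha_zero (τ : Level) : alpha τ 0 = 0 := map_zero (alphaHom τ)

theorem alpha_rot (τ : Level) (s : ℝ) (f : U) :
    alpha τ (f.rot s) = gaugeOne (fun k => Circle.exp (k * s)) (alpha τ f) := by
  refine lp.ext (funext fun k => ?_)
  rw [gaugeOne_apply, alpha_apply, alpha_apply, mul_left_comm]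
  congr 1
  have hp : Function.Periodic
      (fun θ : ℝ => ((f : ℝ → ℝ) θ : ℂ) * Complex.exp (-(((k : ℤ) : ℂ) * θ * Complex.I))) (2 * π) :=
    fun θ => by
      have h : Complex.exp (-(((k : ℤ) : ℂ) * ((θ + 2 * π : ℝ) : ℂ) * Complex.I)) =
          Complex.exp (-(((k : ℤ) : ℂ) * θ * Complex.I)) :=
        Complex.exp_eq_exp_iff_exists_int.2 ⟨-(k : ℤ), by push_cast; ring⟩
      simp only [f.periodic, h]
  have h1 := intervalIntegral.integral_comp_add_right (a := 0) (b := 2 * π)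
    (fun θ : ℝ => ((f : ℝ → ℝ) θ : ℂ) * Complex.exp (-(((k : ℤ) : ℂ) * θ * Complex.I))) s
  have h2 := hp.intervalIntegral_add_eq s 0
  rw [zero_add, add_comm (2 * π) s, h2, zero_add] at h1
  rw [fourierInt, fourierInt, ← h1, ← intervalIntegral.integral_const_mul]
  refine intervalIntegral.integral_congr fun θ _ => ?_
  show ((f : ℝ → ℝ) (θ + s) : ℂ) * _ = _ * (((f : ℝ → ℝ) (θ + s) : ℂ) * _)
  rw [mul_left_comm, Circle.coe_exp, ← Complex.exp_add]
  congr 2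
  push_cast; ring

theorem exists_norm_alpha_le (τ : Level) : ∃ M : ℝ, ∀ f : U,
    ‖alpha τ f‖ ≤ M * ∫ θ in (0 : ℝ)..2 * π, ‖deriv (deriv (f : ℝ → ℝ)) θ‖ := by
  have hs : Summable fun k : ℕ+ => τ.κ / (4 * π ^ 3) * (1 / (k : ℝ) ^ 3) := by
    refine Summable.mul_left _ ?_
    exact (Real.summable_one_div_nat_pow.2 (by norm_num : 1 < 3)).comp_injective PNat.coe_injective
  have hκ : (0 : ℝ) ≤ τ.κ := by exact_mod_cast τ.κ_pos.le
  have hpi := Real.pi_pos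
  refine ⟨Real.sqrt (∑' k : ℕ+, τ.κ / (4 * π ^ 3) * (1 / (k : ℝ) ^ 3)), fun f => ?_⟩
  set C := ∫ θ in (0 : ℝ)..2 * π, ‖deriv (deriv (f : ℝ → ℝ)) θ‖ with hC
  have hC0 : 0 ≤ C := intervalIntegral.integral_nonneg (by positivity) fun _ _ => norm_nonneg _
  have hf1 := (contDiff_infty_iff_deriv.1 f.smooth).2
  have hb : ∀ k : ℕ+, ‖fourierInt f k‖ ≤ C / (k : ℝ) ^ 2 := fun k => by
    have h1 : fourierInt f k = (k * Complex.I)⁻¹ * ((k * Complex.I)⁻¹ *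
        fourierInt (deriv (deriv (f : ℝ → ℝ))) k) := by
      have h2 := U.fourier_parts f f.smooth f.periodic k
      have h3 := U.fourier_parts _ hf1 f.deriv_periodic k
      simp only [fourierInt]
      rw [h3] at h2
      exact_mod_cast h2
    have h0 : ‖((k : ℂ) * Complex.I)⁻¹‖ = (k : ℝ)⁻¹ := by simp
    rw [h1, norm_mul, norm_mul, h0, ← mul_assoc, ← mul_inv, ← sq, div_eq_inv_mul]
    refine mul_le_mul_of_nonneg_left ?_ (by positivity)
    refine (intervalIntegral.norm_integral_le_integral_norm (by positivity)).trans (le_of_eq ?_)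
    refine intervalIntegral.integral_congr fun θ _ => ?_
    rw [norm_mul, Complex.norm_real, show -(((k : ℤ) : ℂ) * θ * Complex.I) =
      ((-(k * θ) : ℝ) : ℂ) * Complex.I by push_cast; ring, Complex.norm_exp_ofReal_mul_I, mul_one]
  refine lp.norm_le_of_tsum_le (p := 2) (by norm_num) (by positivity) ?_
  simp only [ENNReal.toReal_ofNat, Real.rpow_ofNat]
  rw [mul_pow, Real.sq_sqrt (tsum_nonneg fun k => by positivity), ← tsum_mul_right]
  refine Summable.tsum_le_tsum (fun k => ?_) (lp_hasSum_norm_sq _).summable (hs.mul_right _)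
  have hk : (0 : ℝ) < k := by exact_mod_cast k.pos
  rw [alpha_apply, norm_mul, norm_neg, Complex.norm_real, mul_pow, Real.norm_eq_abs, sq_abs,
    alphaConst_sq]
  calc _ ≤ τ.κ * k / (4 * π ^ 3) * (C / (k : ℝ) ^ 2) ^ 2 := by
        gcongr; exact hb k
    _ = _ := by field_simp

theorem continuous_alpha (τ : Level) : Continuous fun l : LoopGp => alpha τ l.f := by
  obtain ⟨M, hM⟩ := exists_norm_alpha_le τ
  have hg : Continuous fun l : LoopGp => M *
      ∫ θ in (0 : ℝ)..2 * π, ‖(conj (l.der 0 θ) * l.der 2 θ).im‖ :=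
    continuous_const.mul (intervalIntegral.continuous_parametric_intervalIntegral_of_continuous'
      (f := fun (l : LoopGp) θ => ‖(conj (l.der 0 θ) * l.der 2 θ).im‖)
      (LoopGp.continuous_logDeriv 2).norm _ _)
  rw [continuous_iff_continuousAt]
  intro l₀
  rw [ContinuousAt, tendsto_iff_norm_sub_tendsto_zero]
  have h1 := (hg.comp (continuous_mul_const l₀⁻¹)).tendsto l₀
  simp only [Function.comp_def, mul_inv_cancel, ← LoopGp.deriv_deriv_f, LoopGp.f_one] at h1
  have h0 : ∀ θ, deriv (deriv ((0 : U) : ℝ → ℝ)) θ = 0 := fun θ => by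
    simp
  simp only [h0, norm_zero, intervalIntegral.integral_zero, mul_zero] at h1
  refine squeeze_zero (fun _ => norm_nonneg _) (fun l => ?_) h1
  have h2 := hM (l * l₀⁻¹).f
  have h3 : (l₀⁻¹).f = -l₀.f := by
    rw [← add_eq_zero_iff_eq_neg, ← LoopGp.f_mul, inv_mul_cancel, LoopGp.f_one]
  have h4 : alpha τ (l * l₀⁻¹).f = alpha τ l.f - alpha τ l₀.f := by
    rw [LoopGp.f_mul, h3, alpha_add, alpha_neg, ← sub_eq_add_neg]
  rwa [h4] at h2

theorem integral_exp_int (n : ℤ) : ∫ θ in (0 : ℝ)..2 * π, Complex.exp (n * θ * Complex.I) =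
    if n = 0 then (2 * π : ℂ) else 0 := by
  split_ifs with h
  · subst h; simp
  · have hc : (n : ℂ) * Complex.I ≠ 0 := mul_ne_zero (by exact_mod_cast h) Complex.I_ne_zero
    have h1 := integral_exp_mul_complex (a := 0) (b := 2 * π) hc
    have h2 : Complex.exp ((n : ℂ) * Complex.I * ((2 * π : ℝ) : ℂ)) = 1 :=
      Complex.exp_eq_one_iff.2 ⟨n, by push_cast; ring⟩
    rw [h2, Complex.ofReal_zero, mul_zero, Complex.exp_zero, sub_self, zero_div] at h1
    simpa only [mul_right_comm] using h1

/-- Every vector of the one particle space with one coordinate comes from `ΩT₀`. -/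
theorem exists_alpha_eq_single (τ : Level) (k : ℕ+) (z : ℂ) :
    ∃ f : U, alpha τ f = lp.single 2 k z := by
  have hpi := Real.pi_pos
  set w : ℂ := -z / (alphaConst τ k * π) with hw
  set F : ℝ → ℝ := fun θ => (w * Complex.exp ((k : ℤ) * θ * Complex.I)).re with hF
  have hFs : ContDiff ℝ ∞ F := by
    refine Complex.reCLM.contDiff.comp (contDiff_const.mul (ContDiff.cexp ?_))
    exact (contDiff_const.mul Complex.ofRealCLM.contDiff).mul contDiff_const
  have hFp : ∀ θ, F (θ + 2 * π) = F θ := fun θ => by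
    have h : Complex.exp (((k : ℤ) : ℂ) * ((θ + 2 * π : ℝ) : ℂ) * Complex.I) =
        Complex.exp (((k : ℤ) : ℂ) * θ * Complex.I) :=
      Complex.exp_eq_exp_iff_exists_int.2 ⟨(k : ℤ), by push_cast; ring⟩
    simp only [hF, h]
  have hFc : ∀ n : ℤ, 0 ≤ n → fourierInt F n = if n = k then π * w else 0 := fun n hn => by
    have h1 : ∀ θ : ℝ, (F θ : ℂ) * Complex.exp (-(n * θ * Complex.I)) =
        w / 2 * Complex.exp (((k - n : ℤ) : ℂ) * θ * Complex.I) +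
        conj w / 2 * Complex.exp (((-(k + n) : ℤ) : ℂ) * θ * Complex.I) := fun θ => by
      rw [hF, Complex.re_eq_add_conj, map_mul, ← Complex.exp_conj,
        show (((k - n : ℤ) : ℂ) * θ * Complex.I) =
          ((k : ℤ) : ℂ) * θ * Complex.I + -(n * θ * Complex.I) by push_cast; ring,
        show (((-(k + n) : ℤ) : ℂ) * θ * Complex.I) =
          conj (((k : ℤ) : ℂ) * θ * Complex.I) + -(n * θ * Complex.I) by
          simp only [map_mul, Complex.conj_I, Complex.conj_ofReal, map_intCast]
          push_cast; ring, Complex.exp_add, Complex.exp_add]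
      ring
    rw [fourierInt]
    simp only [h1]
    rw [intervalIntegral.integral_add (Continuous.intervalIntegrable (by fun_prop) _ _)
      (Continuous.intervalIntegrable (by fun_prop) _ _), intervalIntegral.integral_const_mul,
      intervalIntegral.integral_const_mul, integral_exp_int, integral_exp_int,
      if_neg (by have := k.pos; omega : ¬(-((k : ℤ) + n) = 0)), mul_zero, add_zero]
    by_cases h : n = k
    · rw [if_pos (by omega), if_pos h]; ring
    · rw [if_neg (by omega), if_neg h, mul_zero]
  have hFm : ∫ θ in (0 : ℝ)..2 * π, F θ = 0 := by
    have h1 := hFc 0 le_rfl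
    rw [if_neg (by have := k.pos; omega), fourierInt] at h1
    simp only [Int.cast_zero, zero_mul, neg_zero, Complex.exp_zero, mul_one,
      intervalIntegral.integral_ofReal] at h1
    exact_mod_cast h1
  refine ⟨⟨F, hFs, hFp, hFm⟩, lp.ext (funext fun j => ?_)⟩
  have hne : (alphaConst τ k : ℂ) ≠ 0 := by exact_mod_cast alphaConst_ne_zero τ k
  have hpi' : (π : ℂ) ≠ 0 := by exact_mod_cast hpi.ne'
  rw [alpha_apply]
  show -(alphaConst τ j : ℂ) * fourierInt F j = _
  rw [hFc j (by positivity)]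
  by_cases h : j = k
  · subst h
    rw [if_pos rfl, lp.single_apply_self, hw]
    field_simp
  · rw [if_neg (by exact_mod_cast h), lp.single_apply_ne _ _ _ h, mul_zero]

theorem alpha_denseRange (τ : Level) : DenseRange (alpha τ) := by
  intro v
  have h2 := lp.hasSum_single (p := 2) (by norm_num) v
  have h3 : v ∈ (alphaHom τ).range.topologicalClosure := by
    refine (AddSubgroup.isClosed_topologicalClosure _).mem_of_tendsto h2
      (Eventually.of_forall fun s => AddSubgroup.sum_mem _ fun k _ => ?_)
    obtain ⟨f, hf⟩ := exists_alpha_eq_single τ k (v k)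
    exact AddSubgroup.le_topologicalClosure _ ⟨f, hf⟩
  exact h3

end BorelWeilLT

namespace BorelWeilLT
open Filter Topology MeasureTheory
open scoped InnerProductSpace ComplexConjugate

/-- Continuous characters of the circle are powers. -/
theorem circle_char_eq_zpow (φ : Circle →* Circle) (hφ : Continuous φ) :
    ∃ c : ℤ, ∀ t, φ t = t ^ c := by
  have : Fact (0 < 2 * π) := ⟨Real.two_pi_pos⟩
  let F : C(AddCircle (2 * π), ℂ) := ⟨fun x => (φ (AddCircle.toCircle x) : ℂ),
    continuous_subtype_val.comp (hφ.comp AddCircle.continuous_toCircle)⟩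
  have hF : ∀ x, F x = φ (AddCircle.toCircle x) := fun _ => rfl
  have hne : ∃ n, fourierCoeff F n ≠ 0 := by
    by_contra! h
    have h1 : fourierCoeff F = 0 := funext h
    have h2 := has_pointwise_sum_fourier_series_of_summable (f := F) (by rw [h1]; exact summable_zero) 0
    simp only [h, zero_smul] at h2
    exact Circle.coe_ne_zero _ ((hF 0).symm.trans (h2.unique hasSum_zero))
  obtain ⟨n, hn⟩ := hne
  refine ⟨n, fun t => ?_⟩
  set s : AddCircle (2 * π) := ((Circle.argEquiv t : ℝ) : AddCircle (2 * π)) with hs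
  have hst : AddCircle.toCircle s = t := by
    rw [hs, AddCircle.toCircle_apply_mk, div_self Real.two_pi_pos.ne', one_mul]
    exact Circle.argEquiv.symm_apply_apply t
  have h1 : fourierCoeff F n = fourier (-n) s * F s * fourierCoeff F n := by
    rw [fourierCoeff, ← integral_const_mul, ← integral_add_right_eq_self _ s]
    refine integral_congr_ae (Eventually.of_forall fun x => ?_)
    simp only [smul_eq_mul, hF, AddCircle.toCircle_add, map_mul, Circle.coe_mul]
    have h2 : fourier (-n) (x + s) = fourier (-n) x * fourier (-n) s := by
      simp only [fourier_apply, smul_add, AddCircle.toCircle_add, Circle.coe_mul]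
    rw [h2]; ring
  have h2 : fourier (-n) s * F s = 1 := by
    refine mul_right_cancel₀ hn ?_
    rw [← h1, one_mul]
  rw [hF, fourier_apply, AddCircle.toCircle_zsmul, hst] at h2
  have h3 : t ^ (-n) * φ t = 1 := Circle.ext (by rw [Circle.coe_mul, h2, Circle.coe_one])
  rw [zpow_neg, inv_mul_eq_one] at h3
  exact h3.symm

theorem continuous_circle_zpow : Continuous fun p : Circle × ℤ => p.1 ^ p.2 :=
  continuous_prod_of_discrete_right.2 fun n => continuous_zpow n

theorem continuous_cocycle (τ : Level) :
    Continuous fun p : LoopGp × LoopGp => cocycle τ p.1 p.2 := by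
  simp only [cocycle]
  refine Continuous.mul ?_ (Circle.exp.continuous.comp ?_)
  · exact continuous_circle_zpow.comp ((LoopGp.continuous_t.comp continuous_snd).prodMk
      ((continuous_of_discreteTopology (f := fun n : ℤ => τ.κ * n)).comp
        (LoopGp.continuous_n.comp continuous_fst)))
  · simp only [omega_eq]
    exact (Complex.continuous_im.comp (((continuous_alpha τ).comp continuous_fst).inner
      ((continuous_alpha τ).comp continuous_snd))).neg

theorem continuous_cocycle_comp (τ : Level) {X : Type*} [TopologicalSpace X] {a b : X → LoopGp}
    (ha : Continuous a) (hb : Continuous b) : Continuous fun x => cocycle τ (a x) (b x) := by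
  have h := (continuous_cocycle τ).comp (ha.prodMk hb)
  simpa only [Function.comp_def] using h

namespace LTτ
variable {τ : Level}

theorem continuous_loop : Continuous (LTτ.loop : LTτ τ → LoopGp) :=
  have h : Continuous fun g : LTτ τ => (g.loop, g.z) := continuous_induced_dom
  continuous_fst.comp h

theorem continuous_z : Continuous (LTτ.z : LTτ τ → Circle) :=
  have h : Continuous fun g : LTτ τ => (g.loop, g.z) := continuous_induced_dom
  continuous_snd.comp h

theorem continuous_mk {X : Type*} [TopologicalSpace X] {l : X → LoopGp} {z : X → Circle}
    (hl : Continuous l) (hz : Continuous z) : Continuous fun x => (⟨l x, z x⟩ : LTτ τ) :=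
  continuous_induced_rng.2 (hl.prodMk hz)

theorem continuous_mul_pair : Continuous fun p : LTτ τ × LTτ τ => p.1 * p.2 := by
  have h1 : Continuous fun p : LTτ τ × LTτ τ => p.1.loop := continuous_loop.comp continuous_fst
  have h2 : Continuous fun p : LTτ τ × LTτ τ => p.2.loop := continuous_loop.comp continuous_snd
  have h3 : Continuous fun p : LTτ τ × LTτ τ => cocycle τ p.1.loop p.2.loop :=
    continuous_cocycle_comp τ h1 h2
  have h4 : Continuous fun p : LTτ τ × LTτ τ => p.1.z := continuous_z.comp continuous_fst
  have h5 : Continuous fun p : LTτ τ × LTτ τ => p.2.z := continuous_z.comp continuous_snd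
  exact continuous_mk (h1.mul h2) ((h4.mul h5).mul h3)

theorem continuous_inv' : Continuous fun g : LTτ τ => g⁻¹ := by
  have h1 : Continuous fun g : LTτ τ => g.loop⁻¹ := continuous_loop.inv
  have h2 : Continuous fun g : LTτ τ => cocycle τ g.loop⁻¹ g.loop :=
    continuous_cocycle_comp τ h1 continuous_loop
  have h3 : Continuous fun g : LTτ τ => (g.z * cocycle τ g.loop⁻¹ g.loop)⁻¹ :=
    (continuous_z.mul h2).inv
  exact continuous_mk h1 h3

instance : IsTopologicalGroup (LTτ τ) where
  continuous_mul := continuous_mul_pair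
  continuous_inv := continuous_inv'

end LTτ

variable {τ : Level}

theorem continuous_sect : Continuous (sect : FlagManifold τ → LTτ τ) := by
  refine continuous_coinduced_dom.2 ?_
  exact LTτ.continuous_mk (LoopGp.continuous_ofCoord_one_n_f.comp LTτ.continuous_loop)
    continuous_const

theorem continuous_mult (χ : TwistedChar τ) :
    Continuous fun p : LTτ τ × FlagManifold τ => mult χ p.1 p.2 := by
  refine χ.continuous'.comp (Continuous.subtype_mk ?_ _)
  exact ((continuous_sect.comp continuous_smul).inv).mul
    (continuous_fst.mul (continuous_sect.comp continuous_snd))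

theorem sect_inv_mul_mem (g : LTτ τ) : (sect (g : FlagManifold τ))⁻¹ * g ∈ Tτ τ := by
  rw [← QuotientGroup.eq, mk_section]

theorem tElem_mul (τ : Level) (t t' z z' : Circle) :
    tElem τ t z * tElem τ t' z' = tElem τ (t * t') (z * z') := by
  refine Subtype.ext (LTτ.ext ?_ ?_)
  · show ofCoord t 0 0 * ofCoord t' 0 0 = ofCoord (t * t') 0 0
    rw [ofCoord_mul, add_zero, add_zero]
  · show z * z' * cocycle τ (ofCoord t 0 0) (ofCoord t' 0 0) = z * z'
    simp [cocycle]

theorem tElem_one_loop (z : Circle) : (tElem τ 1 z : LTτ τ).loop = 1 := LoopGp.one_eq.symm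

theorem tElem_central (z : Circle) (g : LTτ τ) : (tElem τ 1 z : LTτ τ) * g = g * tElem τ 1 z := by
  refine LTτ.ext ?_ ?_
  · rw [LTτ.mul_loop, LTτ.mul_loop, mul_comm]
  · rw [LTτ.mul_z, LTτ.mul_z, tElem_one_loop, cocycle_one_left, cocycle_one_right,
      mul_comm g.z]

theorem continuous_tElem (τ : Level) : Continuous fun p : Circle × Circle => tElem τ p.1 p.2 :=
  Continuous.subtype_mk (LTτ.continuous_mk
    (LoopGp.continuous_const_loop.comp continuous_fst) continuous_snd) _

/-- The restriction of a character of `T^τ` to `T` is a power. -/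
theorem TwistedChar.exists_zpow (χ : TwistedChar τ) :
    ∃ c : ℤ, ∀ t, χ.toHom (tElem τ t 1) = t ^ c := by
  refine circle_char_eq_zpow (MonoidHom.mk' (fun t => χ.toHom (tElem τ t 1)) fun t t' => ?_) ?_
  · rw [← map_mul, tElem_mul, one_mul]
  · exact χ.continuous'.comp ((continuous_tElem τ).comp (continuous_id.prodMk continuous_const))

theorem TwistedChar.apply (χ : TwistedChar τ) (t z : Circle) :
    χ.toHom (tElem τ t z) = χ.toHom (tElem τ t 1) * z := by
  conv_rhs => rw [← χ.central' z, ← map_mul, tElem_mul, mul_one, one_mul]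

namespace LineBundle
variable {χ : TwistedChar τ}

theorem mk_eq_triv (g : LTτ τ) (v : ℂ) : mk χ g v = triv χ
    ((g : FlagManifold τ), χ.toHom ⟨(sect (g : FlagManifold τ))⁻¹ * g, sect_inv_mul_mem g⟩ * v) := by
  show _ = mk χ (sect (g : FlagManifold τ)) _
  rw [← mk_mul, mul_inv_cancel_left]

theorem isHomeomorph_triv (χ : TwistedChar τ) : IsHomeomorph (triv χ) := by
  let F : LTτ τ × ℂ → FlagManifold τ × ℂ := fun p =>
    ((p.1 : FlagManifold τ),
      χ.toHom ⟨(sect (p.1 : FlagManifold τ))⁻¹ * p.1, sect_inv_mul_mem p.1⟩ * p.2)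
  have hF : ∀ p q, (bundleSetoid χ) p q → F p = F q := by
    rintro ⟨g, v⟩ q ⟨h, rfl⟩
    have h1 : ((g * h : LTτ τ) : FlagManifold τ) = g := QuotientGroup.mk_mul_of_mem g h.2
    have h2 : (⟨(sect ((g * h : LTτ τ) : FlagManifold τ))⁻¹ * (g * h), sect_inv_mul_mem _⟩ : Tτ τ) =
        ⟨(sect (g : FlagManifold τ))⁻¹ * g, sect_inv_mul_mem g⟩ * h :=
      Subtype.ext (by simp only [h1, mul_assoc, Subgroup.coe_mul])
    refine Prod.ext h1.symm ?_
    simp only [F, h2, map_mul, Circle.coe_mul]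
    rw [mul_assoc, mul_inv_cancel_left₀ (Circle.coe_ne_zero _)]
  have hFc : Continuous F := by
    have h1 : Continuous fun p : LTτ τ × ℂ => (p.1 : FlagManifold τ) :=
      QuotientGroup.continuous_mk.comp continuous_fst
    refine h1.prodMk (Continuous.mul (continuous_subtype_val.comp (χ.continuous'.comp
      (Continuous.subtype_mk ?_ _))) continuous_snd)
    exact (continuous_sect.comp h1).inv.mul continuous_fst
  rw [isHomeomorph_iff_exists_inverse]
  refine ⟨?_, Quotient.lift F hF, ?_, ?_, hFc.quotient_lift hF⟩
  · have h1 : Continuous fun p : FlagManifold τ × ℂ => (sect p.1, p.2) :=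
      (continuous_sect.comp continuous_fst).prodMk continuous_snd
    exact continuous_quotient_mk'.comp h1
  · rintro ⟨x, v⟩
    show F (sect x, v) = (x, v)
    refine Prod.ext (mk_section x) ?_
    have h2 : (⟨(sect (sect x : FlagManifold τ))⁻¹ * sect x, sect_inv_mul_mem _⟩ : Tτ τ) = 1 :=
      Subtype.ext (by simp only [mk_section, inv_mul_cancel, Subgroup.coe_one])
    simp only [F, h2, map_one, Circle.coe_one, one_mul]
  · intro e
    induction e using Quotient.inductionOn with
    | h p => exact (mk_eq_triv p.1 p.2).symm

theorem isEquivariantLineBundle (χ : TwistedChar τ) : IsEquivariantLineBundle χ where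
  homeo := isHomeomorph_triv χ
  proj_triv := proj_triv
  smul_triv _ _ _ := rfl
  act_triv := smul_triv
  one_act e := by
    induction e using Quotient.inductionOn with
    | h p => exact (smul_mk (χ := χ) 1 p.1 p.2).trans (by rw [one_mul]; rfl)
  mul_act g h e := by
    induction e using Quotient.inductionOn with
    | h p => exact (smul_mk (χ := χ) (g * h) p.1 p.2).trans (by rw [mul_assoc]; rfl)
  centre_act z e := by
    induction e using Quotient.inductionOn with
    | h p =>
      refine (smul_mk (χ := χ) _ p.1 p.2).trans ?_
      rw [tElem_central, mk_mul, χ.central']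
      rfl
  continuous_act := by
    have h1 := (isHomeomorph_triv χ)
    have h2 : IsHomeomorph (Prod.map id (triv χ) : LTτ τ × FlagManifold τ × ℂ → _) :=
      (IsHomeomorph.id).prodMap h1
    rw [h2.isQuotientMap.continuous_iff]
    have h3 : ((fun p : LTτ τ × LineBundle χ => p.1 • p.2) ∘ Prod.map id (triv χ)) =
        fun p : LTτ τ × FlagManifold τ × ℂ => triv χ (p.1 • p.2.1, mult χ p.1 p.2.1 * p.2.2) :=
      funext fun p => smul_triv p.1 p.2.1 p.2.2
    rw [h3]
    have h4 : Continuous fun p : LTτ τ × FlagManifold τ × ℂ => (p.1, p.2.1) :=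
      continuous_fst.prodMk (continuous_fst.comp continuous_snd)
    exact h1.continuous.comp ((continuous_smul.comp h4).prodMk
      ((continuous_subtype_val.comp ((continuous_mult χ).comp h4)).mul
        (continuous_snd.comp continuous_snd)))

end LineBundle

theorem weyl_alpha_mul (τ : Level) (f g : U) (v : Fock) : weyl (alpha τ f) (weyl (alpha τ g) v) =
    (Circle.exp (omega τ f g) : ℂ) • weyl (alpha τ (f + g)) v := by
  rw [weyl_mul, ← omega_eq, alpha_add]

/-- Projective representations of `LT` induced from those of `ΩT₀` by permutations and phases. -/
theorem isTauRep_lpOp (τ : Level) {J : Type} {σ : LoopGp → J ≃ J} {c : LoopGp → J → Circle}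
    (hσ : ∀ a b j, σ b (σ a j) = σ (a * b) j)
    (hc : ∀ a b j, c a j * c b (σ a j) = b.t ^ (τ.κ * a.n) * c (a * b) j)
    (hσ' : ∀ j, IsLocallyConstant fun l => (σ l).symm j) (hc' : ∀ j, Continuous fun l => c l j) :
    IsTauRep τ fun l => lpOp (σ l) (c l) (weyl (alpha τ l.f)) where
  norm_map l v := lpOp_norm _ _ (weyl_norm _) v
  mul a b v := by
    refine lp.ext (funext fun j => ?_)
    rw [lp.coeFn_smul, Pi.smul_apply, lpOp_apply, lpOp_apply, lpOp_apply, map_smul, weyl_alpha_mul,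
      hσ, smul_smul, smul_smul, smul_smul, LoopGp.f_mul, ← Circle.coe_mul, ← Circle.coe_mul,
      ← Circle.coe_mul, hc, cocycle, mul_right_comm]
  continuous v := lpOp_continuous hσ' hc' (fun _ => weyl_norm _)
    (fun v => (weyl_continuous v).comp (continuous_alpha τ)) v

theorem TwistedChar.continuous_t (χ : TwistedChar τ) :
    Continuous fun l : LoopGp => χ.toHom (tElem τ l.t 1) :=
  χ.continuous'.comp ((continuous_tElem τ).comp (LoopGp.continuous_t.prodMk continuous_const))

theorem TwistedChar.map_t_mul (χ : TwistedChar τ) (t t' : Circle) :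
    χ.toHom (tElem τ (t * t') 1) = χ.toHom (tElem τ t 1) * χ.toHom (tElem τ t' 1) := by
  rw [← map_mul, tElem_mul, one_mul]

theorem isTauRep_rhoV (χ : TwistedChar τ) : IsTauRep τ (rhoV χ) := by
  refine isTauRep_lpOp τ (σ := fun l => Equiv.addRight l.n)
    (c := fun l n => χ.toHom (tElem τ l.t 1) * l.t ^ (τ.κ * n)) (fun a b n => ?_) (fun a b n => ?_)
    (fun n => ?_) (fun n => χ.continuous_t.mul (LoopGp.continuous_t.zpow _))
  · simp only [Equiv.coe_addRight, LoopGp.n_mul, add_assoc]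
  · simp only [Equiv.coe_addRight, LoopGp.t_mul, χ.map_t_mul, mul_zpow, mul_add, zpow_add]
    simp only [mul_assoc, mul_comm, mul_left_comm]
  · refine (IsLocallyConstant.iff_continuous _).2 ?_
    exact continuous_const.add LoopGp.continuous_n.neg

theorem sect_point (n : ℤ) (f : U) :
    sect (point n f : FlagManifold τ) = ⟨ofCoord 1 n f, 1⟩ := by
  show (⟨ofCoord 1 (ofCoord 1 n f).n (ofCoord 1 n f).f, 1⟩ : LTτ τ) = _
  rw [LoopGp.n_ofCoord, LoopGp.f_ofCoord]

theorem mult_point (χ : TwistedChar τ) (l : LoopGp) (n : ℤ) :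
    mult χ ⟨ofCoord l.t l.n 0, 1⟩ (point (n - l.n) 0) =
      χ.toHom (tElem τ l.t 1) * l.t ^ (-(τ.κ * n)) := by
  rw [← χ.apply, mult]
  congr 1
  refine Subtype.ext ?_
  show (sect (_ • (point (n - l.n) 0 : FlagManifold τ)))⁻¹ * (_ * sect (point (n - l.n) 0)) =
    (tElem τ l.t (l.t ^ (-(τ.κ * n))) : LTτ τ)
  rw [smul_point, sect_point, sect_point, inv_mul_eq_iff_eq_mul]
  refine LTτ.ext ?_ ?_
  · show ofCoord l.t l.n 0 * ofCoord 1 (n - l.n) 0 = ofCoord 1 n 0 * ofCoord l.t 0 0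
    rw [ofCoord_mul, ofCoord_mul]
    simp
  · show 1 * 1 * cocycle τ (ofCoord l.t l.n 0) (ofCoord 1 (n - l.n) 0) =
      1 * l.t ^ (-(τ.κ * n)) * cocycle τ (ofCoord 1 n 0) (ofCoord l.t 0 0)
    simp [cocycle]

theorem isTauRep_rhoH (χ : TwistedChar τ) : IsTauRep τ (rhoH χ) := by
  refine isTauRep_lpOp τ (J := Index)
    (σ := fun l => (Equiv.subRight l.n).prodCongr (Equiv.refl _))
    (c := fun l j => mult χ ⟨ofCoord l.t l.n 0, 1⟩ (point (j.1 - l.n) 0))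
    (fun a b j => ?_) (fun a b j => ?_) (fun j => ?_) (fun j => ?_)
  · refine Prod.ext ?_ rfl
    show j.1 - a.n - b.n = j.1 - (a * b).n
    rw [LoopGp.n_mul]; ring
  · simp only [mult_point]
    show _ * (_ * b.t ^ (-(τ.κ * (j.1 - a.n)))) = _
    simp only [LoopGp.t_mul, χ.map_t_mul, mul_zpow]
    rw [show -(τ.κ * (j.1 - a.n)) = τ.κ * a.n + -(τ.κ * j.1) by ring, zpow_add b.t]
    simp only [mul_assoc, mul_comm, mul_left_comm]
  · exact ((IsLocallyConstant.iff_continuous _).2 LoopGp.continuous_n).comp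
      fun n => ((j.1 + n, j.2) : Index)
  · simp only [mult_point]
    exact χ.continuous_t.mul (LoopGp.continuous_t.zpow _)

section
variable {H : Type} [NormedAddCommGroup H] [InnerProductSpace ℂ H] {ρ : LoopGp → H →L[ℂ] H}

theorem IsTauRep.map_one (h : IsTauRep τ ρ) (v : H) : ρ 1 v = v := by
  have h1 := h.mul 1 1 v
  rw [cocycle_one_left, Circle.coe_one, one_smul, mul_one] at h1
  rw [← sub_eq_zero, ← norm_eq_zero, ← h.norm_map 1, map_sub, h1, sub_self, norm_zero]

theorem IsTauRep.adjoint (h : IsTauRep τ ρ) (l : LoopGp) (x y : H) :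
    ⟪ρ l x, y⟫_ℂ = ⟪x, ((cocycle τ l l⁻¹ : ℂ)⁻¹ • ρ l⁻¹) y⟫_ℂ := by
  have h1 : ρ l (((cocycle τ l l⁻¹ : ℂ)⁻¹ • ρ l⁻¹) y) = y := by
    rw [_root_.smul_apply, map_smul, h.mul, smul_smul, inv_mul_cancel₀ (Circle.coe_ne_zero _),
      one_smul, mul_inv_cancel, h.map_one]
  have h2 := (⟨(ρ l).toLinearMap, h.norm_map l⟩ : H →ₗᵢ[ℂ] H).inner_map_map x
    (((cocycle τ l l⁻¹ : ℂ)⁻¹ • ρ l⁻¹) y)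
  rw [← h2]
  exact congrArg (fun z => ⟪ρ l x, z⟫_ℂ) h1.symm

/-- A projective unitary representation whose commutant is trivial is irreducible. -/
theorem IsTauRep.isIrreducibleRep [CompleteSpace H] [Nontrivial H] (h : IsTauRep τ ρ)
    (hs : ∀ A : H →L[ℂ] H, (∀ l v, A (ρ l v) = ρ l (A v)) → ∃ c : ℂ, ∀ v, A v = c • v) :
    IsIrreducibleRep ρ := by
  refine ⟨inferInstance, fun W hW hinv => ?_⟩
  have : CompleteSpace W := hW.completeSpace_coe
  obtain ⟨c, hc⟩ := hs W.starProjection fun l => starProjection_comm W (h.adjoint l) (hinv l)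
    fun w hw => W.smul_mem _ (hinv _ w hw)
  exact eq_bot_or_top_of_starProjection W hc

end

/-- Schur's lemma for the representation of `ΩT₀` on the Fock space. -/
theorem weyl_alpha_schur (τ : Level) {A : Fock →L[ℂ] Fock}
    (hA : ∀ f v, A (weyl (alpha τ f) v) = weyl (alpha τ f) (A v)) : ∃ c : ℂ, ∀ v, A v = c • v := by
  refine weyl_schur fun α v => ?_
  exact (alpha_denseRange τ).induction_on
    (p := fun α => A (weyl α v) = weyl α (A v)) α
    (isClosed_eq (A.continuous.comp (weyl_continuous v)) (weyl_continuous _)) fun f => hA f v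

theorem rhoV_apply (χ : TwistedChar τ) (l : LoopGp) (ψ : VSpace) (n : ℤ) :
    rhoV χ l ψ n = ((χ.toHom (tElem τ l.t 1) * l.t ^ (τ.κ * n) : Circle) : ℂ) •
      weyl (alpha τ l.f) (ψ (n + l.n)) := rfl

theorem rhoV_single (χ : TwistedChar τ) (l : LoopGp) (n : ℤ) (v : Fock) :
    rhoV χ l (lp.single 2 n v) = ((χ.toHom (tElem τ l.t 1) * l.t ^ (τ.κ * (n - l.n)) : Circle) : ℂ) •
      lp.single 2 (n - l.n) (weyl (alpha τ l.f) v) := by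
  rw [rhoV, lpOp_single]; rfl

theorem rhoV_schur (χ : TwistedChar τ) (A : VSpace →L[ℂ] VSpace)
    (hA : ∀ l v, A (rhoV χ l v) = rhoV χ l (A v)) : ∃ c : ℂ, ∀ v, A v = c • v := by
  have hχ : χ.toHom (tElem τ 1 1) = 1 := χ.central' 1
  have h0 : ∀ v n, n ≠ 0 → A (lp.single 2 0 v) n = 0 := fun v n hn => by
    obtain ⟨t, ht⟩ := exists_zpow_ne (a := τ.κ * 0) (b := τ.κ * n)
      (fun h => hn (by simpa [τ.κ_pos.ne'] using h.symm))
    have h1 := congrArg (fun ψ : VSpace => ψ n) (hA (ofCoord t 0 0) (lp.single 2 0 v))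
    simp only [rhoV_apply] at h1
    rw [rhoV_single, map_smul, lp.coeFn_smul, Pi.smul_apply] at h1
    simp only [LoopGp.t_ofCoord, LoopGp.n_ofCoord, LoopGp.f_ofCoord, sub_zero, alpha_zero,
      weyl_zero, ContinuousLinearMap.id_apply, add_zero] at h1
    rw [← sub_eq_zero, ← sub_smul, smul_eq_zero] at h1
    refine h1.resolve_left (sub_ne_zero.2 fun e => ht ?_)
    exact mul_left_cancel (Circle.ext e)
  let A₀ : Fock →L[ℂ] Fock := (lp.evalCLM ℂ (fun _ : ℤ => Fock) 2 0).comp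
    (A.comp (lp.singleContinuousLinearMap ℂ (fun _ : ℤ => Fock) 2 0))
  have hA₀ : ∀ v, A (lp.single 2 0 v) = lp.single 2 0 (A₀ v) := fun v => by
    refine lp.ext (funext fun n => ?_)
    by_cases hn : n = 0
    · subst hn; rw [lp.single_apply_self]; rfl
    · rw [h0 v n hn, lp.single_apply_ne _ _ _ hn]
  obtain ⟨c, hc⟩ := weyl_alpha_schur τ (A := A₀) fun f v => by
    have h1 := hA (ofCoord 1 0 f) (lp.single 2 0 v)
    rw [hA₀, rhoV_single, rhoV_single] at h1
    simp only [LoopGp.t_ofCoord, LoopGp.n_ofCoord, LoopGp.f_ofCoord, sub_zero, hχ, one_zpow,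
      mul_one, Circle.coe_one, one_smul, hA₀] at h1
    have h2 := congrArg (fun ψ : VSpace => ψ 0) h1
    simpa only [lp.single_apply_self] using h2
  refine ⟨c, fun v => ?_⟩
  have h : A = c • ContinuousLinearMap.id ℂ VSpace := by
    refine clm_ext_of_dense lp_dense_single_univ ?_
    rintro _ ⟨n, v, rfl⟩
    have h1 := hA (ofCoord 1 (-n) 0) (lp.single 2 0 v)
    rw [hA₀, hc, lp.single_smul, map_smul, rhoV_single] at h1
    rw [_root_.smul_apply]
    simpa only [LoopGp.t_ofCoord, LoopGp.n_ofCoord, LoopGp.f_ofCoord, zero_sub, neg_neg, hχ,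
      one_zpow, mul_one, Circle.coe_one, one_smul, alpha_zero, weyl_zero,
      ContinuousLinearMap.id_apply] using h1
  rw [h]; rfl

theorem isIrreducibleRep_rhoV (χ : TwistedChar τ) : IsIrreducibleRep (rhoV χ) := by
  have : Nontrivial VSpace := by
    refine ⟨⟨lp.single 2 0 (lp.single 2 0 1), 0, fun h => ?_⟩⟩
    have h1 := congrArg (fun ψ : VSpace => ψ 0 0) h
    simp only [lp.single_apply_self] at h1
    exact one_ne_zero h1
  exact (isTauRep_rhoV χ).isIrreducibleRep (rhoV_schur χ)

/-- The energy of a monomial. -/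
noncomputable def energy (m : MultiIndex) : ℤ := m.sum fun k j => (k : ℤ) * j

theorem gaugePhase_rot (s : ℝ) (m : MultiIndex) :
    gaugePhase (fun k => Circle.exp (k * s)) m = Circle.exp (energy m * s) := by
  rw [gaugePhase, energy, Finsupp.prod, Finsupp.sum]
  push_cast
  rw [Finset.sum_mul]
  induction m.support using Finset.cons_induction with
  | empty => simp
  | cons k S hk ih =>
    rw [Finset.prod_cons, Finset.sum_cons, Circle.exp_add, ih, ← Circle.exp_nsmul, nsmul_eq_mul]
    congr 2; ring

/-- The energy of the vacuum of the `n`-th summand of `V_[χ]`, up to a shift of the linear term. -/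
def vacuumEnergy (κ d n : ℤ) : ℤ := κ * (n * (n + 1) / 2) + d * n

theorem two_mul_triangular (n : ℤ) : 2 * (n * (n + 1) / 2) = n * (n + 1) :=
  Int.mul_ediv_cancel' (Int.even_mul_succ_self n).two_dvd

theorem vacuumEnergy_cast (κ d n : ℤ) :
    (vacuumEnergy κ d n : ℝ) = κ * (n * (n + 1) / 2) + d * n := by
  have h : 2 * ((n * (n + 1) / 2 : ℤ) : ℝ) = n * (n + 1) := by exact_mod_cast two_mul_triangular n
  rw [vacuumEnergy]
  push_cast at h ⊢
  linear_combination (κ / 2 : ℝ) * h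

theorem sq_le_vacuumEnergy {κ : ℤ} (hκ : 0 < κ) (d n : ℤ) :
    n ^ 2 ≤ 4 * vacuumEnergy κ d n + (2 * d + 1) ^ 2 := by
  have h := two_mul_triangular n
  have h0 : 0 ≤ n * (n + 1) / 2 := by
    have : 0 ≤ n * (n + 1) := by
      rcases le_or_gt 0 n with h | h
      · positivity
      · nlinarith
    omega
  have h1 : n * (n + 1) / 2 ≤ κ * (n * (n + 1) / 2) := le_mul_of_one_le_left h0 hκ
  have h2 : 4 * vacuumEnergy κ d n ≥ 2 * (n * (n + 1)) + 4 * (d * n) := by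
    rw [vacuumEnergy]; linarith
  nlinarith [sq_nonneg (n + (2 * d + 1))]

theorem energy_nonneg (m : MultiIndex) : 0 ≤ energy m :=
  Finset.sum_nonneg fun _ _ => by positivity

theorem energy_finite (B : ℕ) : {m : MultiIndex | energy m ≤ B}.Finite := by
  refine Set.Finite.subset (Finset.finite_toSet
    (((Finset.range (B + 1)).image Nat.toPNat').finsupp fun _ => Finset.range (B + 1))) fun m hm => ?_
  rw [Finset.mem_coe, Finset.mem_finsupp_iff]
  have h1 : ∀ k ∈ m.support, (k : ℕ) * m k ≤ B := fun k hk => by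
    have h2 : ((k : ℤ) * m k) ≤ energy m := Finset.single_le_sum
      (f := fun k : ℕ+ => ((k : ℤ) * m k)) (fun _ _ => by positivity) hk
    exact_mod_cast h2.trans hm
  refine ⟨fun k hk => ?_, fun k _ => ?_⟩
  · refine Finset.mem_image.2 ⟨k, Finset.mem_range.2 (Nat.lt_succ_iff.2 ?_), PNat.coe_toPNat' k⟩
    exact (Nat.le_mul_of_pos_right _ (Nat.pos_of_ne_zero (Finsupp.mem_support_iff.1 hk))).trans
      (h1 k hk)
  · rw [Finset.mem_range, Nat.lt_succ_iff]
    by_cases hk : k ∈ m.support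
    · exact (Nat.le_mul_of_pos_left _ k.pos).trans (h1 k hk)
    · rw [Finsupp.notMem_support_iff.1 hk]; exact Nat.zero_le _

/-- The rotations of `V_[χ]`. -/
noncomputable def rotV (κ d : ℤ) (s : ℝ) : VSpace →L[ℂ] VSpace :=
  lpOp (Equiv.refl ℤ) (fun n => Circle.exp (vacuumEnergy κ d n * s))
    (gauge fun k => Circle.exp (k * s))

theorem rotV_apply (κ d : ℤ) (s : ℝ) (ψ : VSpace) (n : ℤ) : rotV κ d s ψ n =
    (Circle.exp (vacuumEnergy κ d n * s) : ℂ) • gauge (fun k => Circle.exp (k * s)) (ψ n) := rfl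

theorem rotV_apply_apply (κ d : ℤ) (s : ℝ) (ψ : VSpace) (n : ℤ) (m : MultiIndex) :
    rotV κ d s ψ n m = (Circle.exp (((vacuumEnergy κ d n + energy m : ℤ) : ℝ) * s) : ℂ) * ψ n m := by
  rw [rotV_apply, lp.coeFn_smul, Pi.smul_apply, gauge_apply, gaugePhase_rot, smul_eq_mul, ← mul_assoc,
    ← Circle.coe_mul, ← Circle.exp_add, ← add_mul]
  push_cast; rfl

theorem VSpace.ext' {ψ φ : VSpace} (h : ∀ n m, ψ n m = φ n m) : ψ = φ :=
  lp.ext (funext fun n => lp.ext (funext fun m => h n m))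

theorem mem_weightSpace_rotV {κ d j : ℤ} {ψ : VSpace} (h : ψ ∈ weightSpace (rotV κ d) j)
    {n : ℤ} {m : MultiIndex} (hne : vacuumEnergy κ d n + energy m ≠ j) : ψ n m = 0 := by
  obtain ⟨z, hz⟩ := exists_zpow_ne hne
  obtain ⟨s, rfl⟩ : ∃ s, Circle.exp s = z := ⟨Complex.arg z, Circle.exp_arg z⟩
  have h1 := congrArg (fun φ : VSpace => φ n m) (h s)
  simp only [rotV_apply_apply] at h1
  rw [lp.coeFn_smul, Pi.smul_apply, lp.coeFn_smul, Pi.smul_apply, smul_eq_mul, ← sub_eq_zero,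
    ← sub_mul, mul_eq_zero] at h1
  refine h1.resolve_left (sub_ne_zero.2 fun e => hz ?_)
  have h2 := Circle.ext e
  rwa [← zsmul_eq_mul, Circle.exp_zsmul, ← zsmul_eq_mul, Circle.exp_zsmul] at h2

theorem isRotationLift_rotV (χ : TwistedChar τ) {c : ℤ}
    (hc : ∀ t, χ.toHom (tElem τ t 1) = t ^ c) :
    IsRotationLift τ (rhoV χ) (rotV τ.κ (c - τ.b)) where
  zero := by
    refine ContinuousLinearMap.ext fun ψ => VSpace.ext' fun n m => ?_
    rw [rotV_apply_apply, mul_zero, Circle.exp_zero, Circle.coe_one, one_mul]; rfl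
  add s s' := by
    refine ContinuousLinearMap.ext fun ψ => VSpace.ext' fun n m => ?_
    rw [ContinuousLinearMap.comp_apply, rotV_apply_apply, rotV_apply_apply, rotV_apply_apply,
      mul_add, Circle.exp_add, Circle.coe_mul, mul_assoc]
  period := by
    refine ContinuousLinearMap.ext fun ψ => VSpace.ext' fun n m => ?_
    rw [rotV_apply_apply, circleExp_int_period, Circle.coe_one, one_mul]; rfl
  norm_map s v := lpOp_norm _ _ (gauge_norm _) v
  continuous v := by
    refine lpOp_continuous (fun j => IsLocallyConstant.const j)
      (fun n => Circle.exp.continuous.comp (continuous_const.mul continuous_id))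
      (fun s => gauge_norm _) (fun v => ?_) v
    refine lpOp_continuous (fun j => IsLocallyConstant.const j) (fun m => ?_) (fun _ _ => rfl)
      (fun _ => continuous_const) v
    simp only [gaugePhase_rot]
    exact Circle.exp.continuous.comp (continuous_const.mul continuous_id)
  semidirect s g ψ := by
    refine lp.ext (funext fun n => ?_)
    simp only [hat, LTτ.rot, MonoidHom.coe_mk, OneHom.coe_mk]
    rw [_root_.smul_apply, _root_.smul_apply, map_smul, lp.coeFn_smul, Pi.smul_apply,
      lp.coeFn_smul, Pi.smul_apply, rotV_apply, rhoV_apply, rhoV_apply, rotV_apply, map_smul,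
      map_smul, gauge_weyl, rot_eq, LoopGp.t_ofCoord, LoopGp.n_ofCoord, LoopGp.f_ofCoord, alpha_rot,
      smul_smul, smul_smul, smul_smul, smul_smul, hc, hc]
    simp only [← Circle.coe_mul]
    congr 2
    have h1 : ∀ a : ℤ, Circle.exp (-(g.loop.n * s)) ^ a = Circle.exp (a * -(g.loop.n * s)) :=
      fun a => by rw [← Circle.exp_zsmul, zsmul_eq_mul]
    rw [rotPhase, mul_zpow, mul_zpow, h1, h1, vacuumEnergy_cast, vacuumEnergy_cast]
    have h2 : Circle.exp ((τ.κ * (n * (n + 1) / 2) + ((c - τ.b : ℤ) : ℝ) * n) * s) =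
        Circle.exp (s * (τ.b * g.loop.n - τ.κ * (g.loop.n * (g.loop.n + 1) / 2))) *
        Circle.exp (c * -(g.loop.n * s)) * Circle.exp (((τ.κ * n : ℤ) : ℝ) * -(g.loop.n * s)) *
        Circle.exp ((τ.κ * (((n + g.loop.n : ℤ) : ℝ) * (((n + g.loop.n : ℤ) : ℝ) + 1) / 2) +
          ((c - τ.b : ℤ) : ℝ) * ((n + g.loop.n : ℤ) : ℝ)) * s) := by
      rw [← Circle.exp_add, ← Circle.exp_add, ← Circle.exp_add]
      congr 1
      push_cast; ring
    rw [h2]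
    simp only [mul_assoc, mul_comm, mul_left_comm]
    rfl

theorem isPER_rhoV (χ : TwistedChar τ) : IsPER τ (rhoV χ) := by
  obtain ⟨c, hc⟩ := χ.exists_zpow
  refine ⟨isTauRep_rhoV χ, rotV τ.κ (c - τ.b), isRotationLift_rotV χ hc, fun j => ?_,
    -(2 * (c - τ.b) + 1) ^ 2, fun j hj => ?_⟩
  · set d := c - τ.b
    set S : Set (ℤ × MultiIndex) := {p | vacuumEnergy τ.κ d p.1 + energy p.2 = j} with hS
    have hfin : S.Finite := by
      set B : ℕ := (4 * |j| + (2 * d + 1) ^ 2).toNat with hB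
      have hB' : (B : ℤ) = 4 * |j| + (2 * d + 1) ^ 2 := Int.toNat_of_nonneg (by positivity)
      refine Set.Finite.subset ((Set.finite_Icc (-(B : ℤ)) B).prod (energy_finite B)) ?_
      rintro ⟨n, m⟩ h
      change vacuumEnergy τ.κ d n + energy m = j at h
      have h1 := sq_le_vacuumEnergy τ.κ_pos d n
      have h2 := energy_nonneg m
      have h3 := le_abs_self j
      have h4 : n ^ 2 ≤ B := by linarith
      have h5 : |n| ≤ B := by
        have h6 : |n| ≤ n ^ 2 := by rw [← sq_abs]; exact Int.le_self_sq _
        exact h6.trans h4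
      refine Set.mem_prod.2 ⟨abs_le.1 h5, ?_⟩
      show energy m ≤ B
      nlinarith [sq_nonneg n, abs_nonneg j, sq_nonneg (2 * d + 1)]
    have : Finite S := hfin
    let ev : weightSpace (rotV τ.κ d) j →ₗ[ℂ] (S → ℂ) :=
      { toFun := fun ψ p => (ψ : VSpace) p.1.1 p.1.2
        map_add' := fun _ _ => rfl
        map_smul' := fun _ _ => rfl }
    refine FiniteDimensional.of_injective ev fun ψ φ h => Subtype.ext (VSpace.ext' fun n m => ?_)
    by_cases hp : vacuumEnergy τ.κ d n + energy m = j
    · exact congrFun h ⟨(n, m), hp⟩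
    · rw [mem_weightSpace_rotV ψ.2 hp, mem_weightSpace_rotV φ.2 hp]
  · rw [Submodule.eq_bot_iff]
    intro ψ hψ
    refine VSpace.ext' fun n m => mem_weightSpace_rotV hψ ?_
    have h1 := sq_le_vacuumEnergy τ.κ_pos (c - τ.b) n
    have h2 := energy_nonneg m
    intro h
    nlinarith [sq_nonneg n, sq_nonneg (2 * (c - τ.b) + 1)]

/-- The occupation numbers `m_k + [k ∈ A]` of a basis vector. -/
noncomputable def occ (j : Index) : MultiIndex := j.2.1 + Finsupp.indicator j.2.2 fun _ _ => 1

theorem occ_apply (j : Index) (k : ℕ+) : occ j k = j.2.1 k + if k ∈ j.2.2 then 1 else 0 := by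
  rw [occ, Finsupp.add_apply, Finsupp.indicator_apply]
  split_ifs <;> rfl

theorem occ_eq_zero {j : Index} : occ j = 0 ↔ j.2.1 = 0 ∧ j.2.2 = ∅ := by
  constructor
  · intro h
    have h1 : ∀ k, j.2.1 k = 0 ∧ k ∉ j.2.2 := fun k => by
      have h2 := DFunLike.congr_fun h k
      rw [occ_apply, Finsupp.zero_apply] at h2
      by_cases hk : k ∈ j.2.2
      · rw [if_pos hk] at h2; omega
      · rw [if_neg hk] at h2; exact ⟨by omega, hk⟩
    exact ⟨Finsupp.ext fun k => (h1 k).1, Finset.eq_empty_of_forall_notMem fun k => (h1 k).2⟩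
  · rintro ⟨h1, h2⟩
    ext k
    rw [occ_apply, h1, h2]; simp

/-- The basis vector obtained by exchanging a symmetric and an exterior factor with index `k`. -/
noncomputable def exch (k : ℕ+) (j : Index) : Index :=
  if k ∈ j.2.2 then (j.1, j.2.1 + Finsupp.single k 1, j.2.2.erase k)
  else (j.1, j.2.1 - Finsupp.single k 1, insert k j.2.2)

theorem exch_of_mem {k : ℕ+} {j : Index} (h : k ∈ j.2.2) :
    exch k j = (j.1, j.2.1 + Finsupp.single k 1, j.2.2.erase k) := if_pos h

theorem exch_of_notMem {k : ℕ+} {j : Index} (h : k ∉ j.2.2) :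
    exch k j = (j.1, j.2.1 - Finsupp.single k 1, insert k j.2.2) := if_neg h

theorem exch_fst (k : ℕ+) (j : Index) : (exch k j).1 = j.1 := by
  unfold exch; split_ifs <;> rfl

theorem mem_exch (k l : ℕ+) (j : Index) :
    l ∈ (exch k j).2.2 ↔ (if l = k then k ∉ j.2.2 else l ∈ j.2.2) := by
  unfold exch
  split_ifs with h1 h2 h2 <;> simp_all

theorem exch_snd_fst_apply (k l : ℕ+) (j : Index) : (exch k j).2.1 l =
    if l = k then (if k ∈ j.2.2 then j.2.1 k + 1 else j.2.1 k - 1) else j.2.1 l := by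
  unfold exch
  split_ifs with h1 h2 h2 <;>
    simp_all [Finsupp.tsub_apply, eq_comm]

theorem occ_exch {k : ℕ+} {j : Index} (h : occ j k ≠ 0) : occ (exch k j) = occ j := by
  ext l
  rw [occ_apply] at h
  rw [occ_apply, occ_apply, exch_snd_fst_apply]
  simp only [mem_exch]
  by_cases hl : l = k
  · subst hl
    by_cases hk : l ∈ j.2.2
    · simp [hk]
    · simp [hk] at h ⊢; omega
  · simp [hl]

theorem index_ext {i j : Index} (h1 : i.1 = j.1) (h2 : ∀ k, i.2.1 k = j.2.1 k)
    (h3 : ∀ k, k ∈ i.2.2 ↔ k ∈ j.2.2) : i = j :=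
  Prod.ext h1 (Prod.ext (Finsupp.ext h2) (Finset.ext h3))

theorem exch_exch {k : ℕ+} {j : Index} (h : occ j k ≠ 0) : exch k (exch k j) = j := by
  rw [occ_apply] at h
  refine index_ext (by rw [exch_fst, exch_fst]) (fun l => ?_) fun l => ?_
  · rw [exch_snd_fst_apply]
    simp only [exch_snd_fst_apply, mem_exch]
    by_cases hl : l = k
    · subst hl
      by_cases hk : l ∈ j.2.2
      · simp [hk]
      · simp [hk] at h ⊢; omega
    · simp [hl]
  · simp only [mem_exch]
    by_cases hl : l = k
    · subst hl; simp
    · simp [hl]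

theorem exch_comm (k l : ℕ+) (j : Index) : exch k (exch l j) = exch l (exch k j) := by
  by_cases hkl : k = l
  · rw [hkl]
  refine index_ext (by simp only [exch_fst]) (fun i => ?_) fun i => ?_
  · simp only [exch_snd_fst_apply, mem_exch, hkl, Ne.symm hkl, if_false]
    by_cases hi : i = k
    · subst hi; simp [hkl]
    · simp [hi]
  · simp only [mem_exch, hkl, Ne.symm hkl, if_false]
    by_cases hi : i = k
    · subst hi; simp [hkl]
    · simp [hi]

theorem wedgeSign_sq (k : ℕ+) (A : Finset ℕ+) : wedgeSign k A * wedgeSign k A = 1 := by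
  rw [wedgeSign, ← mul_pow]; simp

theorem wedgeSign_conj (k : ℕ+) (A : Finset ℕ+) : conj (wedgeSign k A) = wedgeSign k A := by
  simp [wedgeSign]

theorem wedgeSign_insert {k l : ℕ+} {A : Finset ℕ+} (h : l ∉ A) :
    wedgeSign k (insert l A) = if l < k then -wedgeSign k A else wedgeSign k A := by
  rw [wedgeSign, wedgeSign, Finset.filter_insert]
  split_ifs with hl
  · rw [Finset.card_insert_of_notMem (by simp [h]), pow_succ]; ring
  · rfl

theorem wedgeSign_erase {k l : ℕ+} {A : Finset ℕ+} (h : l ∈ A) :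
    wedgeSign k (A.erase l) = if l < k then -wedgeSign k A else wedgeSign k A := by
  conv_rhs => rw [← Finset.insert_erase h, wedgeSign_insert (Finset.notMem_erase l A)]
  split_ifs <;> simp

theorem wedgeSign_exch (k l : ℕ+) (j : Index) : wedgeSign k (exch l j).2.2 =
    if l < k then -wedgeSign k j.2.2 else wedgeSign k j.2.2 := by
  by_cases h : l ∈ j.2.2
  · rw [exch_of_mem h]; exact wedgeSign_erase h
  · rw [exch_of_notMem h]; exact wedgeSign_insert h

/-- The matrix coefficients of the Dirac operator. -/
noncomputable def diracCoeff (k : ℕ+) (j : Index) : ℂ :=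
  (2 * Real.sqrt (k * occ j k) : ℝ) * wedgeSign k j.2.2

theorem diracCoeff_conj (k : ℕ+) (j : Index) : conj (diracCoeff k j) = diracCoeff k j := by
  rw [diracCoeff, map_mul, Complex.conj_ofReal, wedgeSign_conj]

theorem diracCoeff_exch {k : ℕ+} {j : Index} (h : occ j k ≠ 0) :
    diracCoeff k (exch k j) = diracCoeff k j := by
  rw [diracCoeff, diracCoeff, occ_exch h, wedgeSign_exch, if_neg (lt_irrefl k)]

theorem diracCoeff_sq (k : ℕ+) (j : Index) :
    diracCoeff k j * diracCoeff k j = ((4 * (k * occ j k) : ℝ) : ℂ) := by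
  rw [diracCoeff, mul_mul_mul_comm, wedgeSign_sq, mul_one, ← Complex.ofReal_mul]
  congr 1
  rw [mul_mul_mul_comm, Real.mul_self_sqrt (by positivity)]; ring

theorem diracCoeff_anticomm {k l : ℕ+} {j : Index} (hkl : k ≠ l) (hk : occ j k ≠ 0)
    (hl : occ j l ≠ 0) : diracCoeff k j * diracCoeff l (exch k j) =
      -(diracCoeff l j * diracCoeff k (exch l j)) := by
  rw [diracCoeff, diracCoeff, diracCoeff, diracCoeff, occ_exch hk, occ_exch hl, wedgeSign_exch,
    wedgeSign_exch]
  rcases lt_or_gt_of_ne hkl with h | h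
  · rw [if_pos h, if_neg (not_lt_of_gt h)]; ring
  · rw [if_neg (not_lt_of_gt h), if_pos h]; ring

/-- The Dirac operator as a formal operator on all families of vectors. -/
noncomputable def diracFun (ψ : Index → Fock) (i : Index) : Fock :=
  ∑ k ∈ (occ i).support, diracCoeff k i • ψ (exch k i)

theorem tens_single (n : ℤ) (m : MultiIndex) (A : Finset ℕ+) (a c : ℂ) (v : Fock) :
    tens n (Finsupp.single m a) (Finsupp.single A c) v = Finsupp.single (n, m, A) ((a * c) • v) := by
  rw [tens, Finsupp.sum_single_index (by simp [Finsupp.sum]), Finsupp.sum_single_index (by simp)]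
  simp

theorem diracFin_single (j : Index) (v : Fock) : diracFin (Finsupp.single j v) =
    ∑ k ∈ (occ j).support, Finsupp.single (exch k j) (diracCoeff k j • v) := by
  have hs : j.2.1.support ∪ j.2.2 = (occ j).support := by
    ext k
    rw [Finset.mem_union, Finsupp.mem_support_iff, Finsupp.mem_support_iff, occ_apply]
    by_cases hk : k ∈ j.2.2 <;> simp [hk]
  have h2 : (Real.sqrt 2 : ℂ) * (Real.sqrt 2 : ℂ) = 2 := by
    rw [← Complex.ofReal_mul, Real.mul_self_sqrt (by norm_num)]; norm_num
  rw [diracFin, Finsupp.lsum_single, LinearMap.sum_apply, hs]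
  refine Finset.sum_congr rfl fun k _ => ?_
  rw [LinearMap.smul_apply, LinearMap.add_apply]
  by_cases hk : k ∈ j.2.2
  · have h1 : gammaZbar k (Finsupp.single j.2.2 1) = 0 := by simp [gammaZbar, hk]
    have h3 : gammaZ k (Finsupp.single j.2.2 1) =
        Finsupp.single (j.2.2.erase k) (-(Real.sqrt 2 : ℂ) * wedgeSign k j.2.2) := by
      simp [gammaZ, hk]
    have h4 : dRhoStarZbar k (Finsupp.single j.2.1 1) = Finsupp.single (j.2.1 + Finsupp.single k 1)
        (-(Real.sqrt 2 : ℂ) * (Real.sqrt (j.2.1 k + 1) : ℂ)) := by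
      simp [dRhoStarZbar]
    rw [h1, h3, h4, tens_single, exch_of_mem hk, diracCoeff, occ_apply, if_pos hk]
    simp only [tens, Finsupp.sum_zero_index, Finsupp.sum_fun_zero, LinearMap.zero_apply, zero_add,
      Finsupp.smul_single, smul_smul]
    congr 2
    rw [Real.sqrt_mul (by positivity)]
    push_cast
    linear_combination (Real.sqrt k : ℂ) * (Real.sqrt (j.2.1 k + 1) : ℂ) * wedgeSign k j.2.2 * h2
  · have h1 : gammaZ k (Finsupp.single j.2.2 1) = 0 := by simp [gammaZ, hk]
    have h3 : gammaZbar k (Finsupp.single j.2.2 1) =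
        Finsupp.single (insert k j.2.2) ((Real.sqrt 2 : ℂ) * wedgeSign k j.2.2) := by
      simp [gammaZbar, hk]
    have h4 : dRhoStarZ k (Finsupp.single j.2.1 1) = Finsupp.single (j.2.1 - Finsupp.single k 1)
        ((Real.sqrt 2 : ℂ) * (Real.sqrt (j.2.1 k) : ℂ)) := by
      simp [dRhoStarZ]
    rw [h1, h3, h4, tens_single, exch_of_notMem hk, diracCoeff, occ_apply, if_neg hk]
    simp only [tens, Finsupp.sum_zero_index, Finsupp.sum_fun_zero, LinearMap.zero_apply, add_zero,
      Finsupp.smul_single, smul_smul]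
    congr 2
    rw [Real.sqrt_mul (by positivity)]
    push_cast
    linear_combination (Real.sqrt k : ℂ) * (Real.sqrt (j.2.1 k) : ℂ) * wedgeSign k j.2.2 * h2

theorem diracFun_add (ψ φ : Index → Fock) (i : Index) :
    diracFun (ψ + φ) i = diracFun ψ i + diracFun φ i := by
  simp only [diracFun, Pi.add_apply, smul_add, Finset.sum_add_distrib]

theorem diracFin_apply (x : Index →₀ Fock) (i : Index) : diracFin x i = diracFun x i := by
  induction x using Finsupp.induction_linear with
  | zero => simp [diracFun]
  | add x y hx hy => rw [map_add, Finsupp.add_apply, hx, hy, Finsupp.coe_add, diracFun_add]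
  | single j v =>
    rw [diracFin_single, Finsupp.finsetSum_apply, diracFun]
    simp only [Finsupp.single_apply, smul_ite, smul_zero, ← Finset.sum_filter]
    by_cases hij : occ i = occ j
    · refine Finset.sum_congr ?_ fun k hk => ?_
      · ext k
        rw [Finset.mem_filter, Finset.mem_filter, hij]
        refine and_congr_right fun hk => ?_
        rw [Finsupp.mem_support_iff] at hk
        constructor
        · rintro rfl; rw [exch_exch hk]
        · rintro rfl; rw [exch_exch (hij ▸ hk)]
      · obtain ⟨hk1, hk2⟩ := Finset.mem_filter.1 hk
        rw [hk2, diracCoeff_exch (Finsupp.mem_support_iff.1 hk1)]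
    · rw [Finset.filter_false_of_mem, Finset.filter_false_of_mem]
      · rw [Finset.sum_empty, Finset.sum_empty]
      · rintro k hk rfl
        exact hij (occ_exch (Finsupp.mem_support_iff.1 hk)).symm
      · rintro k hk rfl
        exact hij (occ_exch (Finsupp.mem_support_iff.1 hk))

/-- The square of the Dirac operator is diagonal. -/
theorem diracFun_diracFun (ψ : Index → Fock) (i : Index) : diracFun (diracFun ψ) i =
    ((4 * ∑ k ∈ (occ i).support, (k * occ i k : ℝ) : ℝ) : ℂ) • ψ i := by
  have h1 : diracFun (diracFun ψ) i = ∑ k ∈ (occ i).support, ∑ l ∈ (occ i).support,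
      (diracCoeff k i * diracCoeff l (exch k i)) • ψ (exch l (exch k i)) := by
    refine Finset.sum_congr rfl fun k hk => ?_
    rw [diracFun, occ_exch (Finsupp.mem_support_iff.1 hk), Finset.smul_sum]
    simp only [smul_smul]
  set F : ℕ+ → ℕ+ → Fock := fun k l =>
    (diracCoeff k i * diracCoeff l (exch k i)) • ψ (exch l (exch k i)) with hF
  have hanti : ∀ k ∈ (occ i).support, ∀ l ∈ (occ i).support, k ≠ l → F k l = -F l k :=
    fun k hk l hl hkl => by
      rw [hF]
      simp only
      rw [diracCoeff_anticomm hkl (Finsupp.mem_support_iff.1 hk) (Finsupp.mem_support_iff.1 hl),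
        exch_comm, neg_smul]
  have hdiag : ∀ k ∈ (occ i).support, F k k = ((4 * (k * occ i k) : ℝ) : ℂ) • ψ i := fun k hk => by
    have hk' := Finsupp.mem_support_iff.1 hk
    rw [hF]
    simp only
    rw [diracCoeff_exch hk', diracCoeff_sq, exch_exch hk']
  have h2 : (2 : ℂ) • ∑ k ∈ (occ i).support, ∑ l ∈ (occ i).support, F k l =
      (2 : ℂ) • ∑ k ∈ (occ i).support, F k k := by
    rw [two_smul]
    conv_lhs => rhs; rw [Finset.sum_comm]
    rw [← Finset.sum_add_distrib, Finset.smul_sum]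
    refine Finset.sum_congr rfl fun k hk => ?_
    rw [← Finset.sum_add_distrib, Finset.sum_eq_single k, two_smul]
    · intro l hl hlk
      rw [hanti k hk l hl hlk.symm, neg_add_cancel]
    · exact fun h => absurd hk h
  rw [h1, smul_right_injective _ (two_ne_zero' ℂ) h2, Finset.sum_congr rfl hdiag, ← Finset.sum_smul]
  congr 1
  push_cast
  rw [Finset.mul_sum]

/-- Formal zero modes of the Dirac operator are supported at vanishing occupation numbers. -/
theorem diracFun_eq_zero_iff {ψ : Index → Fock} :
    (∀ i, diracFun ψ i = 0) ↔ ∀ i, occ i ≠ 0 → ψ i = 0 := by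
  constructor
  · intro h i hi
    have h1 := diracFun_diracFun ψ i
    rw [show diracFun ψ = 0 from funext h] at h1
    have h2 : diracFun 0 i = 0 := by simp [diracFun]
    rw [h2, eq_comm, smul_eq_zero] at h1
    refine h1.resolve_left ?_
    have h3 : 0 < ∑ k ∈ (occ i).support, (k * occ i k : ℝ) :=
      Finset.sum_pos (fun k hk => by
        have h4 := Nat.pos_of_ne_zero (Finsupp.mem_support_iff.1 hk)
        have h5 := k.pos
        positivity) (Finsupp.support_nonempty_iff.2 hi)
    exact_mod_cast (by positivity : (4 * ∑ k ∈ (occ i).support, (k * occ i k : ℝ)) ≠ 0)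
  · intro h i
    refine Finset.sum_eq_zero fun k hk => ?_
    have hk' := Finsupp.mem_support_iff.1 hk
    rw [h _ (by rw [occ_exch hk']; exact fun h0 => hk' (by rw [h0]; rfl)), smul_zero]

theorem finToH_single (j : Index) (v : Fock) : finToH (Finsupp.single j v) = lp.single 2 j v := by
  rw [finToH, Finsupp.lsum_single]; rfl

theorem finToH_apply (x : Index →₀ Fock) (i : Index) : finToH x i = x i := by
  induction x using Finsupp.induction_linear with
  | zero => rw [map_zero]; rfl
  | add x y hx hy => rw [map_add, lp.coeFn_add, Pi.add_apply, hx, hy, Finsupp.add_apply]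
  | single j v =>
    rw [finToH_single]
    by_cases h : i = j
    · subst h; rw [lp.single_apply_self, Finsupp.single_eq_same]
    · rw [lp.single_apply_ne _ _ _ h, Finsupp.single_eq_of_ne h]

variable (χ : TwistedChar τ)

theorem dirac_apply (ψ : (dirac χ).domain) (i : Index) : dirac χ ψ i = diracFun ψ.1 i := by
  show finToH (diracFin (Finsupp.ofSupportFinite ψ.1 ψ.2)) i = _
  rw [finToH_apply, diracFin_apply]; rfl

theorem finToH_mem_domain (x : Index →₀ Fock) : finToH x ∈ (dirac χ).domain :=
  x.hasFiniteSupport.subset fun i hi => by rwa [Function.mem_support, finToH_apply] at hi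

theorem mem_graph_dirac {ψ φ : HSpace} (hψ : ψ ∈ (dirac χ).domain)
    (h : ∀ i, φ i = diracFun ψ i) : (ψ, φ) ∈ (dirac χ).graph := by
  rw [LinearPMap.mem_graph_iff]
  exact ⟨⟨ψ, hψ⟩, rfl, lp.ext (funext fun i => by rw [dirac_apply, h])⟩

theorem dirac_dense : Dense ((dirac χ).domain : Set HSpace) := by
  refine lp_dense_single_univ.mono (Submodule.span_le.2 ?_)
  rintro _ ⟨j, v, rfl⟩
  rw [← finToH_single]
  exact finToH_mem_domain χ _

theorem inner_finToH_diracFin_single (j : Index) (v : Fock) (y : HSpace) :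
    ⟪finToH (diracFin (Finsupp.single j v)), y⟫_ℂ = ⟪v, diracFun y j⟫_ℂ := by
  rw [diracFin_single, map_sum, sum_inner, diracFun, inner_sum]
  refine Finset.sum_congr rfl fun k _ => ?_
  rw [finToH_single, lp.inner_single_left, inner_smul_left, inner_smul_right, diracCoeff_conj]

theorem finToH_ofSupportFinite {ψ : HSpace} (h : (Function.support ψ).Finite) :
    finToH (Finsupp.ofSupportFinite ψ h) = ψ :=
  lp.ext (funext fun i => by rw [finToH_apply]; rfl)

/-- The adjoint of the Dirac operator is the formal operator with its maximal domain. -/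
theorem mem_graph_adjoint_dirac {y w : HSpace} :
    (y, w) ∈ (dirac χ).adjoint.graph ↔ ∀ j, w j = diracFun y j := by
  rw [LinearPMap.adjoint_graph_eq_graph_adjoint (dirac_dense χ), Submodule.mem_adjoint_iff]
  constructor
  · intro h j
    refine ext_inner_left ℂ fun v => ?_
    have h1 := h (finToH (Finsupp.single j v)) (finToH (diracFin (Finsupp.single j v)))
      (mem_graph_dirac χ (finToH_mem_domain χ _) fun i => by
        rw [finToH_apply, diracFin_apply]
        congr 1; funext i; rw [finToH_apply])
    rw [inner_finToH_diracFin_single, finToH_single, lp.inner_single_left, sub_eq_zero] at h1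
    exact h1.symm
  · intro h a b hab
    have key : ∀ x : Index →₀ Fock, ⟪finToH (diracFin x), y⟫_ℂ = ⟪finToH x, w⟫_ℂ := fun x => by
      induction x using Finsupp.induction_linear with
      | zero => simp
      | add x y hx hy => rw [map_add, map_add, map_add, inner_add_left, inner_add_left, hx, hy]
      | single j v => rw [inner_finToH_diracFin_single, finToH_single, lp.inner_single_left, h]
    rw [LinearPMap.mem_graph_iff] at hab
    obtain ⟨⟨x, hx⟩, rfl, rfl⟩ := hab
    rw [sub_eq_zero]
    exact (key (Finsupp.ofSupportFinite x hx)).trans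
      (congrArg (fun z => ⟪z, w⟫_ℂ) (finToH_ofSupportFinite hx))

theorem block_finite (j : Index) : {i : Index | i.1 = j.1 ∧ occ i = occ j}.Finite := by
  refine Set.Finite.of_injOn (f := fun i : Index => i.2.2)
    (t := ((occ j).support.powerset : Set (Finset ℕ+))) (fun i hi => ?_) (fun i hi i' hi' h => ?_)
    (Finset.finite_toSet _)
  · rw [Finset.mem_coe, Finset.mem_powerset]
    intro k hk
    rw [Finsupp.mem_support_iff, ← hi.2, occ_apply, if_pos hk]
    exact Nat.succ_ne_zero _
  · have h0 : i.2.2 = i'.2.2 := h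
    refine index_ext (hi.1.trans hi'.1.symm) (fun k => ?_) fun k => by rw [h0]
    have h1 := DFunLike.congr_fun (hi.2.trans hi'.2.symm) k
    rw [occ_apply, occ_apply, h0] at h1
    exact Nat.add_right_cancel h1

/-- The basis vectors that the Dirac operator can reach from a given finite set. -/
noncomputable def blocks (F : Finset Index) : Finset Index :=
  F.biUnion fun j => (block_finite j).toFinset

theorem mem_blocks {F : Finset Index} {i : Index} :
    i ∈ blocks F ↔ ∃ j ∈ F, i.1 = j.1 ∧ occ i = occ j := by
  simp only [blocks, Finset.mem_biUnion, Set.Finite.mem_toFinset, Set.mem_ofPred_eq]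

theorem exch_mem_blocks {F : Finset Index} {k : ℕ+} {i : Index} (hk : occ i k ≠ 0) :
    exch k i ∈ blocks F ↔ i ∈ blocks F := by
  rw [mem_blocks, mem_blocks, exch_fst, occ_exch hk]

theorem tendsto_blocks : Tendsto blocks atTop atTop :=
  tendsto_atTop_mono (fun _ j hj => mem_blocks.2 ⟨j, hj, rfl, rfl⟩) tendsto_id

theorem sum_single_apply (T : Finset Index) (y : HSpace) (i : Index) :
    (∑ j ∈ T, lp.single 2 j (y j) : HSpace) i = if i ∈ T then y i else 0 := by
  rw [lp.coeFn_sum, Finset.sum_apply]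
  simp only [lp.single_apply, Pi.single_apply]
  exact Finset.sum_ite_eq T i fun j => y j

theorem dirac_graph_closure :
    (dirac χ).graph.topologicalClosure = (dirac χ).adjoint.graph := by
  refine le_antisymm (Submodule.topologicalClosure_minimal _ ?_
    (LinearPMap.adjoint_isClosed (dirac_dense χ))) ?_
  · rintro ⟨y, w⟩ h
    rw [LinearPMap.mem_graph_iff] at h
    obtain ⟨x, rfl, rfl⟩ := h
    exact (mem_graph_adjoint_dirac χ).2 (dirac_apply χ x)
  · rintro ⟨y, w⟩ h
    rw [mem_graph_adjoint_dirac] at h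
    have hlim : ∀ z : HSpace, Tendsto (fun F => (∑ j ∈ blocks F, lp.single 2 j (z j) : HSpace))
        atTop (𝓝 z) := fun z =>
      (lp.hasSum_single (by simp) z : Tendsto _ _ _).comp tendsto_blocks
    refine mem_closure_of_tendsto ((hlim y).prodMk_nhds (hlim w)) (Eventually.of_forall fun F => ?_)
    refine mem_graph_dirac χ ?_ fun i => ?_
    · refine (Finset.finite_toSet (blocks F)).subset fun i hi => ?_
      rw [Function.mem_support, sum_single_apply] at hi
      by_contra h0
      exact hi (if_neg h0)
    · rw [sum_single_apply, h, diracFun, diracFun]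
      simp only [sum_single_apply]
      split_ifs with hi
      · exact Finset.sum_congr rfl fun k hk => by
          rw [if_pos ((exch_mem_blocks (Finsupp.mem_support_iff.1 hk)).2 hi)]
      · exact (Finset.sum_eq_zero fun k hk => by
          rw [if_neg fun h0 => hi ((exch_mem_blocks (Finsupp.mem_support_iff.1 hk)).1 h0),
            smul_zero]).symm

theorem dirac_isClosable : (dirac χ).IsClosable := ⟨_, dirac_graph_closure χ⟩

theorem dirac_closure : (dirac χ).closure = (dirac χ).adjoint :=
  LinearPMap.eq_of_eq_graph <| by
    rw [← (dirac_isClosable χ).graph_closure_eq_closure_graph, dirac_graph_closure]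

theorem isSelfAdjoint_dirac_closure : IsSelfAdjoint (dirac χ).closure := by
  have hd : Dense ((dirac χ).closure.domain : Set HSpace) :=
    (dirac_dense χ).mono (dirac χ).le_closure.1
  rw [LinearPMap.isSelfAdjoint_def]
  refine LinearPMap.eq_of_eq_graph (le_antisymm ?_ ?_)
  · rw [LinearPMap.adjoint_graph_eq_graph_adjoint hd]
    conv_rhs => rw [dirac_closure, LinearPMap.adjoint_graph_eq_graph_adjoint (dirac_dense χ)]
    intro x hx
    rw [Submodule.mem_adjoint_iff] at hx ⊢
    exact fun a b hab => hx a b (LinearPMap.le_graph_of_le (dirac χ).le_closure hab)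
  · conv_lhs => rw [dirac_closure, LinearPMap.adjoint_graph_eq_graph_adjoint (dirac_dense χ)]
    rw [LinearPMap.adjoint_graph_eq_graph_adjoint hd,
      ← (dirac_isClosable χ).graph_closure_eq_closure_graph]
    intro x hx
    rw [Submodule.mem_adjoint_iff] at hx ⊢
    intro a b hab
    have hc : IsClosed {p : HSpace × HSpace | ⟪p.2, x.1⟫_ℂ - ⟪p.1, x.2⟫_ℂ = 0} :=
      isClosed_eq (by fun_prop) continuous_const
    exact closure_minimal (fun p hp => hx p.1 p.2 hp) hc hab

theorem exch_shift (k : ℕ+) (j : Index) (n : ℤ) : exch k (n, j.2) = (n, (exch k j).2) := by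
  unfold exch; split_ifs <;> rfl

theorem dirac_comm (l : LoopGp) (ψ : (dirac χ).domain) :
    ∃ h : rhoH χ l ψ ∈ (dirac χ).domain, dirac χ ⟨rhoH χ l ψ, h⟩ = rhoH χ l (dirac χ ψ) := by
  have hap : ∀ (φ : HSpace) (j : Index), rhoH χ l φ j =
      (mult χ ⟨ofCoord l.t l.n 0, 1⟩ (point (j.1 - l.n) 0) : ℂ) •
        weyl (alpha τ l.f) (φ (j.1 - l.n, j.2)) := fun _ _ => rfl
  have h : rhoH χ l ψ ∈ (dirac χ).domain := by
    refine Set.Finite.subset (ψ.2.preimage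
      (((Equiv.subRight l.n).prodCongr (Equiv.refl (MultiIndex × Finset ℕ+))).injective.injOn))
      fun j hj h0 => hj ?_
    rw [hap, show (ψ : HSpace) (j.1 - l.n, j.2) = 0 from h0, map_zero, smul_zero]
  refine ⟨h, lp.ext (funext fun j => ?_)⟩
  rw [dirac_apply, hap, dirac_apply]
  simp only [diracFun, hap, exch_fst, map_sum, map_smul, Finset.smul_sum]
  refine Finset.sum_congr rfl fun k _ => ?_
  rw [smul_comm, exch_shift k j (j.1 - l.n)]
  rfl

theorem mem_gradedKer {p : ZMod 2} {ψ : HSpace} : ψ ∈ gradedKer χ p ↔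
    (∀ j : Index, (j.2.2.card : ZMod 2) ≠ p → ψ j = 0) ∧ ∀ j, occ j ≠ 0 → ψ j = 0 := by
  rw [← diracFun_eq_zero_iff]
  refine and_congr_right fun _ => ?_
  rw [dirac_closure, mem_graph_adjoint_dirac]
  exact forall_congr' fun j => eq_comm

theorem gradedKer_one : gradedKer χ 1 = ⊥ := by
  rw [Submodule.eq_bot_iff]
  intro ψ hψ
  rw [mem_gradedKer] at hψ
  refine lp.ext (funext fun j => ?_)
  by_cases h : occ j = 0
  · refine hψ.1 j ?_
    rw [(occ_eq_zero.1 h).2]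
    simp
  · exact hψ.2 j h

theorem mem_gradedKer_zero {ψ : HSpace} :
    ψ ∈ gradedKer χ 0 ↔ ∀ j : Index, j.2 ≠ (0, ∅) → ψ j = 0 := by
  rw [mem_gradedKer]
  constructor
  · exact fun h j hj => h.2 j fun h0 => hj (Prod.ext_iff.2 (occ_eq_zero.1 h0))
  · refine fun h => ⟨fun j hj => h j fun h0 => hj ?_, fun j hj => h j fun h0 => hj ?_⟩
    · rw [h0]; simp
    · exact occ_eq_zero.2 (Prod.ext_iff.1 h0)

/-- The basis vector `δ_{-n} ⊗ 1 ⊗ 1`. -/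
def zeroModeIndex (n : ℤ) : Index := (-n, 0, ∅)

theorem zeroModeIndex_injective : Function.Injective zeroModeIndex := fun _ _ h =>
  neg_injective (congrArg Prod.fst h)

theorem zeroModeIndex_eq {j : Index} (h : j.2 = (0, ∅)) : zeroModeIndex (-j.1) = j :=
  Prod.ext (neg_neg _) h.symm

/-- The family of vectors supported at the zero modes. -/
noncomputable def zeroModeFun (ψ : ℤ → Fock) (j : Index) : Fock :=
  if j.2 = (0, ∅) then ψ (-j.1) else 0

theorem zeroModeFun_index (ψ : ℤ → Fock) (n : ℤ) : zeroModeFun ψ (zeroModeIndex n) = ψ n := by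
  exact (if_pos rfl).trans (congrArg ψ (neg_neg n))

theorem zeroModeFun_hasSum (ψ : VSpace) :
    HasSum (fun j => ‖zeroModeFun ψ j‖ ^ 2) (‖ψ‖ ^ 2) := by
  rw [← zeroModeIndex_injective.hasSum_iff]
  · convert! lp_hasSum_norm_sq ψ using 1
    funext n
    rw [Function.comp_apply, zeroModeFun_index]
  · intro j hj
    rw [zeroModeFun, if_neg fun h => hj ⟨_, zeroModeIndex_eq h⟩, norm_zero, sq, zero_mul]

/-- The vector supported at the zero modes, with given components there. -/
noncomputable def zeroModeVec (ψ : VSpace) : HSpace :=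
  ⟨zeroModeFun ψ, memℓp_gen (by
    simpa only [ENNReal.toReal_ofNat, Real.rpow_ofNat] using (zeroModeFun_hasSum ψ).summable)⟩

theorem zeroModeVec_apply (ψ : VSpace) (j : Index) :
    zeroModeVec ψ j = if j.2 = (0, ∅) then ψ (-j.1) else 0 := rfl

theorem norm_zeroModeVec (ψ : VSpace) : ‖zeroModeVec ψ‖ = ‖ψ‖ :=
  (pow_left_inj₀ (norm_nonneg _) (norm_nonneg _) two_ne_zero).1
    ((lp_hasSum_norm_sq (zeroModeVec ψ)).unique (zeroModeFun_hasSum ψ))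

/-- The embedding of `V_[χ]` as the space of zero modes of the Dirac operator. -/
noncomputable def zeroMode : VSpace →ₗᵢ[ℂ] HSpace where
  toFun := zeroModeVec
  map_add' ψ φ := lp.ext (funext fun j => by
    rw [lp.coeFn_add, Pi.add_apply]
    simp only [zeroModeVec_apply]
    split_ifs
    · rfl
    · rw [add_zero])
  map_smul' c ψ := lp.ext (funext fun j => by
    rw [RingHom.id_apply, lp.coeFn_smul, Pi.smul_apply]
    simp only [zeroModeVec_apply]
    split_ifs
    · rfl
    · rw [smul_zero])
  norm_map' := norm_zeroModeVec

theorem zeroMode_apply (ψ : VSpace) (j : Index) :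
    zeroMode ψ j = if j.2 = (0, ∅) then ψ (-j.1) else 0 := rfl

theorem range_zeroMode : LinearMap.range zeroMode.toLinearMap = gradedKer χ 0 := by
  ext φ
  rw [mem_gradedKer_zero, LinearMap.mem_range]
  constructor
  · rintro ⟨ψ, rfl⟩ j hj
    exact if_neg hj
  · intro h
    refine ⟨⟨fun n => φ (zeroModeIndex n), memℓp_gen ?_⟩, lp.ext (funext fun j => ?_)⟩
    · simp only [ENNReal.toReal_ofNat, Real.rpow_ofNat]
      exact (lp_hasSum_norm_sq φ).summable.comp_injective zeroModeIndex_injective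
    · refine (zeroMode_apply _ j).trans ?_
      split_ifs with hj
      · exact congrArg φ (zeroModeIndex_eq hj)
      · exact (h j hj).symm

theorem zeroMode_rhoV (l : LoopGp) (ψ : VSpace) :
    zeroMode (rhoV χ l ψ) = rhoH χ l (zeroMode ψ) := by
  refine lp.ext (funext fun j => ?_)
  rw [zeroMode_apply, show rhoH χ l (zeroMode ψ) j =
    (mult χ ⟨ofCoord l.t l.n 0, 1⟩ (point (j.1 - l.n) 0) : ℂ) •
      weyl (alpha τ l.f) (zeroMode ψ (j.1 - l.n, j.2)) from rfl, zeroMode_apply, mult_point,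
    rhoV_apply]
  split_ifs
  · rw [mul_neg, neg_sub, sub_eq_neg_add]
  · rw [map_zero, smul_zero]

section
variable {H : Type} [NormedAddCommGroup H] [InnerProductSpace ℂ H] {ρ : LoopGp → H →L[ℂ] H}

theorem HasClass.eq_zero {x : Rτ τ} (h : HasClass ρ ⊥ x) : x = 0 := by
  obtain ⟨r, P, ι, -, -, hsup, rfl⟩ := h
  cases r with
  | zero => simp
  | succ r =>
    have := (P 0).irr.1
    obtain ⟨v, hv⟩ := exists_ne (0 : (P 0).H)
    have h1 : ι 0 v ∈ (⊥ : Submodule ℂ H) :=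
      hsup ▸ Submodule.mem_iSup_of_mem (p := fun i => LinearMap.range (ι i).toLinearMap) 0 ⟨v, rfl⟩
    exact absurd ((map_eq_zero_iff (ι 0) (ι 0).injective).1 h1) hv

theorem hasClass_bot : HasClass ρ ⊥ (0 : Rτ τ) :=
  ⟨0, Fin.elim0, fun i => i.elim0, fun i => i.elim0, fun i => i.elim0, by simp, by simp⟩

theorem hasClass_range (P : IrrPER τ) (J : P.H →ₗᵢ[ℂ] H) (hJ : ∀ l v, J (P.ρ l v) = ρ l (J v)) :
    HasClass ρ (LinearMap.range J.toLinearMap) P.cls :=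
  ⟨1, fun _ => P, fun _ => J, fun _ => hJ, fun i j hij => absurd (Subsingleton.elim i j) hij,
    by simp, by simp⟩

/-- The class of an embedded irreducible representation is unique. -/
theorem HasClass.eq_cls {P : IrrPER τ} {J : P.H →ₗᵢ[ℂ] H} (hJ : ∀ l v, J (P.ρ l v) = ρ l (J v))
    {x : Rτ τ} (h : HasClass ρ (LinearMap.range J.toLinearMap) x) : x = P.cls := by
  obtain ⟨r, Q, ι, hι, horth, hsup, rfl⟩ := h
  have hle : ∀ i, LinearMap.range (ι i).toLinearMap ≤ LinearMap.range J.toLinearMap := fun i =>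
    hsup ▸ le_iSup (fun i => LinearMap.range (ι i).toLinearMap) i
  have hge : ∀ i v, ∃ w, ι i w = J v := fun i => by
    have := (Q i).irr.1
    obtain ⟨w, hw⟩ := exists_ne (0 : (Q i).H)
    set W : Submodule ℂ P.H := (LinearMap.range (ι i).toLinearMap).comap J.toLinearMap with hW
    have hcl : IsClosed (W : Set P.H) :=
      (ι i).isometry.isClosedEmbedding.isClosed_range.preimage J.continuous
    rcases P.irr.2 W hcl fun l v ⟨u, hu⟩ => ⟨(Q i).ρ l u, by
      rw [LinearIsometry.coe_toLinearMap] at hu ⊢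
      rw [hι, hu]; exact (hJ l v).symm⟩ with h | h
    · obtain ⟨v, hv⟩ := hle i ⟨w, rfl⟩
      have hv' : v ∈ W := ⟨w, hv.symm⟩
      rw [h, Submodule.mem_bot] at hv'
      rw [hv', map_zero] at hv
      exact absurd ((map_eq_zero_iff (ι i) (ι i).injective).1 hv.symm) hw
    · intro v
      have hv : v ∈ W := h ▸ Submodule.mem_top
      exact hv
  rcases r with - | - | r
  · have := P.irr.1
    obtain ⟨v, hv⟩ := exists_ne (0 : P.H)
    rw [iSup_of_empty, eq_comm, LinearMap.range_eq_bot] at hsup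
    exact absurd ((map_eq_zero_iff J J.injective).1 (LinearMap.congr_fun hsup v)) hv
  · have hr : LinearMap.range (ι 0).toLinearMap = LinearMap.range J.toLinearMap :=
      le_antisymm (hle 0) fun _ ⟨v, hv⟩ => by
        obtain ⟨w, hw⟩ := hge 0 v
        exact ⟨w, hw.trans hv⟩
    let e : (Q 0).H ≃ₗᵢ[ℂ] P.H :=
      ((ι 0).equivRange.trans (LinearIsometryEquiv.ofEq _ _ hr)).trans J.equivRange.symm
    have he : ∀ v, J (e v) = ι 0 v := fun v =>
      congrArg Subtype.val (J.equivRange.apply_symm_apply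
        (LinearIsometryEquiv.ofEq _ _ hr ((ι 0).equivRange v)))
    have hQ : Quotient.mk (IrrPER.setoid τ) (Q 0) = Quotient.mk (IrrPER.setoid τ) P :=
      Quotient.sound ⟨e, fun l v => J.injective (by rw [he, hJ, he, hι])⟩
    simp [IrrPER.cls, hQ]
  · have := (Q 0).irr.1
    obtain ⟨w, hw⟩ := exists_ne (0 : (Q 0).H)
    obtain ⟨v, hv⟩ := hle 0 ⟨w, rfl⟩
    obtain ⟨u, hu⟩ := hge 1 v
    have h1 := horth (i := 0) (j := 1) (by simp) w u
    rw [hu, show J v = ι 0 w from hv, inner_self_eq_zero] at h1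
    exact absurd ((map_eq_zero_iff (ι 0) (ι 0).injective).1 h1) hw

end

theorem hasAnalyticIndex_iff (hper : IsPER τ (rhoV χ)) (hirr : IsIrreducibleRep (rhoV χ))
    (x : Rτ τ) : HasAnalyticIndex χ x ↔ x = IrrPER.cls ⟨VSpace, rhoV χ, hper, hirr⟩ := by
  rw [HasAnalyticIndex, gradedKer_one, ← range_zeroMode]
  constructor
  · rintro ⟨x₀, x₁, h₀, h₁, rfl⟩
    rw [h₁.eq_zero, sub_zero]
    exact HasClass.eq_cls (P := ⟨VSpace, rhoV χ, hper, hirr⟩) (J := zeroMode) (zeroMode_rhoV χ) h₀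
  · rintro rfl
    exact ⟨_, 0, hasClass_range ⟨VSpace, rhoV χ, hper, hirr⟩ zeroMode (zeroMode_rhoV χ),
      hasClass_bot, (sub_zero _).symm⟩

end BorelWeilLT

theorem mainTheorem6 (τ : Level) (χ : TwistedChar τ) :
    LineBundle.IsEquivariantLineBundle χ ∧
    IsTauRep τ (rhoH χ) ∧
    IsSelfAdjoint (dirac χ).closure ∧
    (∀ (l : LoopGp) (ψ : (dirac χ).domain), ∃ h : rhoH χ l ψ ∈ (dirac χ).domain,
      dirac χ ⟨rhoH χ l ψ, h⟩ = rhoH χ l (dirac χ ψ)) ∧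
    ∃ (hper : IsPER τ (rhoV χ)) (hirr : IsIrreducibleRep (rhoV χ)),
      ∀ x : Rτ τ, HasAnalyticIndex χ x ↔ x = IrrPER.cls ⟨VSpace, rhoV χ, hper, hirr⟩ :=
  ⟨LineBundle.isEquivariantLineBundle χ, isTauRep_rhoH χ, isSelfAdjoint_dirac_closure χ,
    dirac_comm χ, isPER_rhoV χ, isIrreducibleRep_rhoV χ, hasAnalyticIndex_iff χ _ _⟩
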